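/- **Notation.** Write $[M]=\{1,\dots,M\}$ and $R_M=\{a+bi\in\mathbb{Z}[i]: 1\le a,b\le M\}$, and write $\mathbb{E}_{x\in S}$ for the average over a finite set $S$. Fix an integer $\ell\ge 1$; for $N\in\mathbb{N}$ let $\tilde N$ be the smallest prime greater than $100\,\ell N$. Let $X=\mathbb{T}^s=\mathbb{R}^s/\mathbb{Z}^s$ with its Haar probability measure $m_X$ and the quotient metric $d_X$ of the Euclidean metric on $\mathbb{R}^s$. For $F\colon X\to\mathbb{C}$ put $$\|F\|_{Lip(X)}=\sup_{x}|F(x)|+\sup_{x\ne y}\frac{|F(x)-F(y)|}{d_X(x,y)} .$$ A *test function* is an $F\colon X\to\mathbb{C}$ with $\|F\|_{Lip(X)}\le 1$ and $\int F\,dm_X=0$. A sequence $(g(m,n))_{(m,n)\in[M]\times[M]}$ in $X$ is *totally $\sigma$-equidistributed* if $$\Bigl|\mathbb{E}_{(m,n)\in[M]\times[M]}\mathbf{1}_{P_1\times P_2}(m,n)\,F(g(m,n))\Bigr|\le\sigma$$ for every test function $F$ and all arithmetic progressions $P_1,P_2\subseteq[M]$. Let $\mathcal{M}_{\mathbb{Z}[i]}$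 be the set of functions $\chi\colon\mathbb{Z}[i]\to\mathbb{C}$ with $\chi(xy)=\chi(x)\chi(y)$ and $|\chi(x)|=1$ for all non-zero $x,y\in\mathbb{Z}[i]$. **Proposition 7.8 (correlation property, abelian case).** Let $\ell\ge1$, let $X=\mathbb{T}^s$ and let $\Delta>0$. There exist $\sigma>0$ and $N_0\in\mathbb{N}$, depending only on $\ell$, $s$ and $\Delta$, such that the following holds for every $N\ge N_0$. Let $$g(m,n)=\alpha_0+\alpha_1m+\alpha_2n+\beta_1\binom m2+\beta_2mn+\beta_3\binom n2\qquad(\alpha_0,\alpha_1,\alpha_2,\beta_1,\beta_2,\beta_3\in\mathbb{T}^s)$$ be such that $(g(m,n))_{(m,n)\in[\tilde N]\times[\tilde N]}$ is totally $\sigma$-equidistributed in $X$. Then $$\sup_{\beta,\chi,\Phi,P}\Bigl|\mathbb{E}_{\alpha\in R_{\tilde N}}\mathbf{1}_P(\alpha)\,\chi(\alpha)\,\Phi\bigl(g'(\beta+\alpha)\bigr)\Bigr|<\Delta ,$$ where $g'(a+bi)=g(a,b)$, and the supremum is over all $\beta\in R_{\tilde N}$, all $\chi\in\mathcal{M}_{\mathbb{Z}[i]}$,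 all test functions $\Phi$, and all $P=\{a+bi: a\in P_1,\ b\in P_2\}$ with $P_1,P_2$ arithmetic progressions in $[\tilde N]$. This holds both when $\beta+\alpha$ is reduced modulo $\tilde N$ (both coordinates) to its representative in $R_{\tilde N}$, and when $g'$ is evaluated by the polynomial formula at the unreduced sum $\beta+\alpha\in\mathbb{Z}[i]$. -/

import Mathlib

open MeasureTheory
open scoped BigOperators ENNReal

noncomputable section

/-- The smallest prime number greater than `100 * ℓ * N`. -/
def primeScale (ℓ N : ℕ) : ℕ :=
  Nat.find (p := fun p => 100 * ℓ * N < p ∧ p.Prime)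
    (Nat.exists_infinite_primes (100 * ℓ * N + 1))

/-- The box `R_M = {a + b i : 1 ≤ a, b ≤ M}` of Gaussian integers. -/
def gaussianBox (M : ℕ) : Finset GaussianInt :=
  (Finset.Icc (1 : ℤ) M ×ˢ Finset.Icc (1 : ℤ) M).image fun p => ⟨p.1, p.2⟩

/-- The (completely) multiplicative functions of modulus `1` on the Gaussian integers.
Both conditions are imposed on non-zero elements only. -/
structure IsUnimodularMultiplicative (χ : GaussianInt → ℂ) : Prop where
  map_mul : ∀ x y : GaussianInt, x ≠ 0 → y ≠ 0 → χ (x * y) = χ x * χ y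
  norm_eq_one : ∀ x : GaussianInt, x ≠ 0 → ‖χ x‖ = 1

/-- `P` is a (finite) arithmetic progression contained in `[M] = {1, …, M}`. -/
def IsProgressionIn (M : ℕ) (P : Finset ℤ) : Prop :=
  (∃ (a d : ℤ) (L : ℕ), 0 < d ∧ P = (Finset.range L).image fun k : ℕ => a + d * k) ∧
    P ⊆ Finset.Icc (1 : ℤ) M

/-- The quotient metric on `𝕋ˢ = ℝˢ / ℤˢ` induced by the Euclidean metric of `ℝˢ`
(the metric that Mathlib puts on a product is the maximum metric instead). -/
def torusDist {s : ℕ} (x y : UnitAddTorus (Fin s)) : ℝ :=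
  Real.sqrt (∑ i, ‖x i - y i‖ ^ 2)

/-- The Lipschitz norm: supremum norm plus best Lipschitz constant, with value `∞` if `F` is
not a Lipschitz function. -/
def torusLipNorm {s : ℕ} (F : UnitAddTorus (Fin s) → ℂ) : ℝ≥0∞ :=
  (⨆ x, ENNReal.ofReal ‖F x‖) +
    ⨆ (x) (y) (_ : x ≠ y), ENNReal.ofReal (‖F x - F y‖ / torusDist x y)

/-- The test functions: `‖F‖_Lip ≤ 1` and mean zero for the Haar probability measure. -/
def IsTestFunction {s : ℕ} (F : UnitAddTorus (Fin s) → ℂ) : Prop :=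
  torusLipNorm F ≤ 1 ∧ ∫ x, F x = 0

/-- Total `ε`-equidistribution of `(g (m, n))`, `(m, n) ∈ [M] × [M]`, in `𝕋ˢ`. -/
def IsTotallyEquidistributed {s : ℕ} (M : ℕ) (ε : ℝ) (g : ℤ → ℤ → UnitAddTorus (Fin s)) :
    Prop :=
  ∀ F : UnitAddTorus (Fin s) → ℂ, IsTestFunction F →
    ∀ P₁ P₂ : Finset ℤ, IsProgressionIn M P₁ → IsProgressionIn M P₂ →
      ‖𝔼 p ∈ Finset.Icc (1 : ℤ) M ×ˢ Finset.Icc (1 : ℤ) M,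
        (if p.1 ∈ P₁ ∧ p.2 ∈ P₂ then 1 else 0) * F (g p.1 p.2)‖ ≤ ε

/-- The degree 2 polynomial map
`α₀ + α₁ m + α₂ n + β₁ (m choose 2) + β₂ m n + β₃ (n choose 2)` into `𝕋ˢ`. -/
def quadraticSequence {s : ℕ} (α₀ α₁ α₂ β₁ β₂ β₃ : UnitAddTorus (Fin s)) (m n : ℤ) :
    UnitAddTorus (Fin s) :=
  α₀ + m • α₁ + n • α₂ + Ring.choose m 2 • β₁ + (m * n) • β₂ + Ring.choose n 2 • β₃

/-- The representative of `z` modulo `M` with both coordinates in `{1, …, M}`. -/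
def reduceToBox (M : ℕ) (z : GaussianInt) : GaussianInt :=
  ⟨(z.re - 1) % (M : ℤ) + 1, (z.im - 1) % (M : ℤ) + 1⟩

/-- All numbers `|𝔼_{α ∈ R_M} 1_P(α) χ(α) Φ(h(β + α))|`, where `β ∈ R_M`, `χ` is a multiplicative
function of modulus `1`, `Φ` is a test function, and `P = {a + b i : a ∈ P₁, b ∈ P₂}` for
arithmetic progressions `P₁, P₂` in `[M]`. -/
def correlationValues {s : ℕ} (M : ℕ) (h : GaussianInt → UnitAddTorus (Fin s)) : Set ℝ :=
  {r | ∃ β ∈ gaussianBox M, ∃ χ : GaussianInt → ℂ, IsUnimodularMultiplicative χ ∧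
    ∃ Φ : UnitAddTorus (Fin s) → ℂ, IsTestFunction Φ ∧
    ∃ P₁ P₂ : Finset ℤ, IsProgressionIn M P₁ ∧ IsProgressionIn M P₂ ∧
      r = ‖𝔼 α ∈ gaussianBox M,
        (if α.re ∈ P₁ ∧ α.im ∈ P₂ then 1 else 0) * χ α * Φ (h (β + α))‖}

end

/-! The engine is Kátai's orthogonality criterion over ℤ[i] (`weight_mul_norm_sum_sq_le`). Fix
finitely many Gaussian primes π whose reciprocal norms have a large sum W. By Turán–Kubilius most z
in the box have about W divisors among them, so ∑ χ(z)F(z) is close to W⁻¹ ∑_z χ(z) ∑_π χ(π)F(πz).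
Cauchy–Schwarz in z removes χ, and it remains to show that ∑_z F(πz) conj F(π'z) is small compared
with M² for π ≠ π'. Primes of distinct norms p ≡ 1 mod 4 suffice, because the sum of their
reciprocals diverges (`not_summable_one_div_primes_one_mod_four`).

By compactness, test functions are uniformly approximated by finitely many trigonometric polynomials
without constant term (`exists_finset_trigPoly_approx`), so F may be taken to be e(φ(β + z)) with φ
a real-valued quadratic phase modulo 1, cut off to a product of progressions. The correlation of two
dilates is then an exponential sum with the quadratic phase φ(β + πz) - φ(β + π'z). If it is large,
van der Corput differencing and geometric sums (`weyl_inverse`, `weyl_inverse_planar`) show that a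
bounded multiple of each quadratic coefficient is O(M⁻²) and of each linear coefficient O(M⁻¹)
modulo 1.

Since π and π' have different norms, the map from the coefficients of φ to those of the difference
is invertible over ℚ, uniformly in the shift β (`coeffs_of_coeffs_sub_comp`). Hence the coefficients
of φ have the same structure, and φ is nearly constant on a product of progressions of bounded step
and length proportional to M. This contradicts equidistribution (`not_phaseEquidistributed`). -/

/-! ### The circle norm and its character -/

/-- The standard character `θ ↦ exp (2πiθ)` of the circle. -/
noncomputable def circleChar (θ : UnitAddCircle) : ℂ := (AddCircle.toCircle θ : ℂ)

lemma circleChar_add (x y : UnitAddCircle) :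
    circleChar (x + y) = circleChar x * circleChar y := by
  simp [circleChar, AddCircle.toCircle_add]

lemma norm_circleChar (x : UnitAddCircle) : ‖circleChar x‖ = 1 :=
  Circle.norm_coe _

lemma circleChar_zero : circleChar 0 = 1 := by
  simp [circleChar]

lemma star_circleChar (x : UnitAddCircle) :
    (starRingEnd ℂ) (circleChar x) = circleChar (-x) := by
  simp only [circleChar, AddCircle.toCircle_neg]
  exact (Circle.coe_inv_eq_conj _).symm

lemma circleChar_sub (x y : UnitAddCircle) :
    circleChar (x - y) = circleChar x * (starRingEnd ℂ) (circleChar y) := by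
  rw [star_circleChar, sub_eq_add_neg, circleChar_add]

/-- Subtracting the nearest integer from any lift gives a representative realising the norm. -/
lemma exists_real_rep (θ : UnitAddCircle) : ∃ x : ℝ, (x : UnitAddCircle) = θ ∧ ‖θ‖ = |x| := by
  obtain ⟨x, rfl⟩ := QuotientAddGroup.mk_surjective θ
  refine ⟨x - round x, ?_, ?_⟩
  · have h : ((round x : ℝ) : UnitAddCircle) = 0 := by
      rw [AddCircle.coe_eq_zero_iff]
      exact ⟨round x, by simp⟩
    change ((x - round x : ℝ) : UnitAddCircle) = (x : UnitAddCircle)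
    rw [AddCircle.coe_sub, h, sub_zero]
  · exact UnitAddCircle.norm_eq

lemma norm_circleChar_coe_sub_one (x : ℝ) :
    ‖circleChar (x : UnitAddCircle) - 1‖ = 2 * |Real.sin (Real.pi * x)| := by
  have h := Complex.norm_exp_I_mul_ofReal_sub_one (2 * Real.pi * x)
  rw [circleChar, AddCircle.toCircle_apply_mk, Circle.coe_exp]
  rw [mul_comm Complex.I] at h
  rw [div_one, h, norm_mul, Real.norm_eq_abs, Real.norm_eq_abs, abs_of_pos (by norm_num : (0:ℝ) < 2)]
  congr 3; ring

lemma norm_le_half (θ : UnitAddCircle) : ‖θ‖ ≤ 1 / 2 := by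
  simpa using AddCircle.norm_le_half_period (1 : ℝ) (x := θ) one_ne_zero

/-- Jordan's inequality for the sine, valid since the short representative satisfies |πx| ≤ π/2. It
turns the denominator of a geometric sum into a multiple of ‖θ‖. -/
lemma four_mul_norm_le (θ : UnitAddCircle) : 4 * ‖θ‖ ≤ ‖circleChar θ - 1‖ := by
  have hle := norm_le_half θ
  obtain ⟨x, rfl, hx⟩ := exists_real_rep θ
  rw [hx] at hle ⊢
  rw [norm_circleChar_coe_sub_one]
  have hpi := Real.pi_pos
  have h1 : |Real.pi * x| ≤ Real.pi / 2 := by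
    rw [abs_mul, abs_of_pos hpi]; nlinarith
  have h2 := Real.mul_abs_le_abs_sin h1
  rw [abs_mul, abs_of_pos hpi] at h2
  have : 2 / Real.pi * (Real.pi * |x|) = 2 * |x| := by field_simp
  linarith

lemma norm_circleChar_sub_one_le (θ : UnitAddCircle) : ‖circleChar θ - 1‖ ≤ 7 * ‖θ‖ := by
  obtain ⟨x, rfl, hx⟩ := exists_real_rep θ
  rw [hx, norm_circleChar_coe_sub_one]
  have h := Real.abs_sin_le_abs (x := Real.pi * x)
  rw [abs_mul, abs_of_pos Real.pi_pos] at h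
  nlinarith [Real.pi_lt_d2, abs_nonneg x]

lemma norm_circleChar_sub_le (θ η : UnitAddCircle) :
    ‖circleChar θ - circleChar η‖ ≤ 7 * ‖θ - η‖ := by
  have h : circleChar θ - circleChar η = circleChar η * (circleChar (θ - η) - 1) := by
    rw [mul_sub, ← circleChar_add]; simp
  rw [h, norm_mul, norm_circleChar, one_mul]
  exact norm_circleChar_sub_one_le _

/-- Multiples of the short representative do not wrap around the circle before reaching half a
period. This is what allows a bound on a multiple to be divided by n. -/
lemma norm_zsmul_eq_of_lt {n : ℤ} {θ : UnitAddCircle} (h : |(n : ℝ)| * ‖θ‖ ≤ 1 / 2) :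
    ‖n • θ‖ = |(n : ℝ)| * ‖θ‖ := by
  obtain ⟨x, rfl, hx⟩ := exists_real_rep θ
  rw [hx, ← abs_mul] at h ⊢
  have : n • (x : UnitAddCircle) = ((n * x : ℝ) : UnitAddCircle) := by
    rw [← AddCircle.coe_zsmul, zsmul_eq_mul]
  rw [this, AddCircle.norm_coe_eq_abs_iff (1 : ℝ) one_ne_zero]
  simpa using h

lemma norm_zsmul_le' (n : ℤ) (θ : UnitAddCircle) : ‖n • θ‖ ≤ |(n : ℝ)| * ‖θ‖ := by
  simpa [Int.norm_eq_abs] using norm_zsmul_le n θ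

lemma norm_nsmul_le' (n : ℕ) (θ : UnitAddCircle) : ‖n • θ‖ ≤ (n : ℝ) * ‖θ‖ := norm_nsmul_le

/-! ### Geometric sums and recurrence of multiples -/

/-- Intervals are handled as order-connected finite sets, a property stable under intersection and
translation. The range form is needed only to telescope. -/
lemma exists_sum_eq_sum_range_of_ordConnected {I : Finset ℤ} (hI : (I : Set ℤ).OrdConnected) :
    ∃ (u : ℤ) (n : ℕ), ∀ F : ℤ → ℂ, ∑ t ∈ I, F t = ∑ j ∈ Finset.range n, F (u + j) := by
  rcases I.eq_empty_or_nonempty with rfl | hne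
  · exact ⟨0, 0, fun F => by simp⟩
  have hIcc : I = Finset.Icc (I.min' hne) (I.max' hne) := by
    ext t
    rw [Finset.mem_Icc]
    exact ⟨fun h => ⟨I.min'_le t h, I.le_max' t h⟩, fun h =>
      Finset.mem_coe.1 (hI.out (Finset.mem_coe.2 (I.min'_mem hne))
        (Finset.mem_coe.2 (I.max'_mem hne)) h)⟩
  generalize I.min' hne = u at hIcc
  generalize I.max' hne = v at hIcc
  subst hIcc
  refine ⟨u, (v + 1 - u).toNat, fun F => ?_⟩
  refine Finset.sum_nbij' (fun t => (t - u).toNat) (fun j => u + j) ?_ ?_ ?_ ?_ ?_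
  · intro t ht; simp only [Finset.mem_Icc, Finset.mem_range] at *; omega
  · intro t ht; simp only [Finset.mem_Icc, Finset.mem_range] at *; omega
  · intro t ht; simp only [Finset.mem_Icc] at *; omega
  · intro t ht; simp only [Finset.mem_range] at *; omega
  · intro t ht; simp only [Finset.mem_Icc] at *; congr 1; omega

/-- The bound for a geometric sum over an interval. -/
lemma norm_sum_linear_phase_mul_le {I : Finset ℤ} (hI : (I : Set ℤ).OrdConnected)
    (c b : UnitAddCircle) : ‖∑ t ∈ I, circleChar (c + t • b)‖ * ‖b‖ ≤ 1 / 2 := by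
  obtain ⟨u, n, h⟩ := exists_sum_eq_sum_range_of_ordConnected hI
  rw [h]
  have key : (∑ j ∈ Finset.range n, circleChar (c + (u + (j : ℤ)) • b)) * (circleChar b - 1)
      = circleChar (c + (u + (n : ℤ)) • b) - circleChar (c + u • b) := by
    have := Finset.sum_range_sub (fun j : ℕ => circleChar (c + (u + (j : ℤ)) • b)) n
    simp only [Nat.cast_zero, add_zero] at this
    rw [← this, Finset.sum_mul]
    refine Finset.sum_congr rfl fun j _ => ?_
    rw [mul_sub, ← circleChar_add, mul_one]
    congr 2
    push_cast
    rw [← add_assoc u, add_smul _ (1 : ℤ), one_smul, add_assoc]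
  have h2 := congrArg norm key
  rw [norm_mul] at h2
  have h3 : ‖circleChar (c + (u + (n : ℤ)) • b) - circleChar (c + u • b)‖ ≤ 2 := by
    refine (norm_sub_le _ _).trans ?_
    rw [norm_circleChar, norm_circleChar]; norm_num
  have h4 := four_mul_norm_le b
  have h5 := norm_nonneg (∑ j ∈ Finset.range n, circleChar (c + (u + (j : ℤ)) • b))
  nlinarith

/-- If a sum of terms in `[0, B]` is large, then many terms are large. -/
lemma le_card_filter_mul_add {α : Type*} (s : Finset α) (f : α → ℝ) {B l : ℝ}
    (hB : ∀ a ∈ s, f a ≤ B) (hl : 0 ≤ l) :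
    ∑ a ∈ s, f a ≤ ((s.filter fun a => l ≤ f a).card : ℝ) * B + s.card * l := by
  rw [← Finset.sum_filter_add_sum_filter_not s (fun a => l ≤ f a)]
  gcongr
  · rw [← nsmul_eq_mul]
    exact Finset.sum_le_card_nsmul _ _ _ fun a ha => hB a (Finset.mem_filter.1 ha).1
  · refine (Finset.sum_le_card_nsmul _ _ l fun a ha => ?_).trans ?_
    · exact (not_le.1 (Finset.mem_filter.1 ha).2).le
    · rw [nsmul_eq_mul]
      gcongr
      exact Finset.filter_subset _ _

/-- Pigeonhole over the m blocks of width w that tile [x, x + mw). -/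
lemma exists_window {H : Finset ℤ} {w m c : ℕ} (hw : 0 < w) {x : ℤ}
    (hH : ∀ n ∈ H, x ≤ n ∧ n < x + m * w) (hc : m * c < H.card) :
    ∃ y : ℤ, c < (H.filter fun n => y ≤ n ∧ n < y + w).card := by
  have hw' : (0 : ℤ) < w := by exact_mod_cast hw
  obtain ⟨q, -, hq⟩ := Finset.exists_lt_card_fiber_of_mul_lt_card_of_maps_to
    (s := H) (t := Finset.Ico (0 : ℤ) m) (f := fun n => (n - x) / w) (n := c) (by
      intro n hn
      have := hH n hn
      rw [Finset.mem_Ico]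
      refine ⟨Int.ediv_nonneg (by omega) hw'.le, ?_⟩
      rw [Int.ediv_lt_iff_lt_mul hw']
      linarith) (by simpa using hc)
  refine ⟨x + w * q, hq.trans_le (Finset.card_le_card ?_)⟩
  intro n hn
  rw [Finset.mem_filter] at hn ⊢
  refine ⟨hn.1, ?_⟩
  have h1 := Int.mul_ediv_add_emod (n - x) w
  have h2 := Int.emod_nonneg (n - x) hw'.ne'
  have h3 := Int.emod_lt_of_pos (n - x) hw'
  rw [hn.2] at h1
  constructor <;> linarith

lemma two_mul_choose_two (n : ℤ) : 2 * Ring.choose n 2 = n * (n - 1) := by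
  have h := Ring.descPochhammer_eq_factorial_smul_choose n 2
  simp [descPochhammer_succ_left, Polynomial.smeval_mul, Polynomial.smeval_sub,
    Polynomial.smeval_X, Polynomial.smeval_one, Nat.factorial] at h
  linarith

/-- Blocks of length s, w / s + 1 in number, cover the window, so two points share a block. -/
lemma exists_two_in_window {H : Finset ℤ} {w s : ℕ} (hs : 0 < s) {x : ℤ}
    (hH : ∀ n ∈ H, x ≤ n ∧ n < x + w) (hc : w / s + 1 < H.card) :
    ∃ a ∈ H, ∃ b ∈ H, a ≠ b ∧ |a - b| < s := by
  obtain ⟨y, hy⟩ := exists_window (H := H) (m := w / s + 1) (c := 1) hs (x := x) (by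
    intro n hn
    refine ⟨(hH n hn).1, (hH n hn).2.trans_le ?_⟩
    have : w ≤ (w / s + 1) * s := by
      have := Nat.div_add_mod w s
      have := Nat.mod_lt w hs
      nlinarith
    have : (w : ℤ) ≤ ((w / s + 1 : ℕ) : ℤ) * s := by exact_mod_cast this
    linarith) (by simpa using hc)
  obtain ⟨a, ha, b, hb, hab⟩ := Finset.one_lt_card.1 hy
  rw [Finset.mem_filter] at ha hb
  exact ⟨a, ha.1, b, hb.1, hab, by rw [abs_lt]; constructor <;> linarith [ha.2.1, ha.2.2, hb.2.1, hb.2.2]⟩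

/-- If `‖n θ‖ = O(1 / M)` for a positive proportion of the `n = O(M)`, then `‖k θ‖ = O(1 / M²)`
for a bounded positive integer `k`. -/
lemma exists_norm_nsmul_of_recurrent (C : ℕ) (hC : 0 < C) :
    ∃ k K : ℕ, 0 < k ∧ 0 < K ∧ ∀ M : ℕ, K ≤ M → ∀ (H : Finset ℤ) (θ : UnitAddCircle),
      (∀ n ∈ H, |n| ≤ C * M) → M ≤ C * H.card → (∀ n ∈ H, ‖n • θ‖ * M ≤ C) →
      ‖k • θ‖ * (M : ℝ) ^ 2 ≤ K := by
  -- In a window of width about M/(16C) that is rich in H, two elements a, b lie closer than s, and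
  -- κ = (a - b)θ has norm at most 2C/M. Multiplying κ by the span d of the elements of H in the
  -- window improves this to O(M⁻²). The value of s gives 4(w/s) ≤ c + 1 below, which forces such a
  -- pair.
  set s : ℕ := 24 * C ^ 2 with hs
  have hs0 : 0 < s := by positivity
  refine ⟨s.factorial, s.factorial * (192 * C ^ 4 * s) + 192 * C ^ 3, s.factorial_pos,
    by positivity, ?_⟩
  intro M hM H θ hH hcard hθ
  have hM1 : 192 * C ^ 3 ≤ M := by omega
  have hCC : C ≤ C ^ 3 := Nat.le_self_pow (by norm_num) C
  have hM0 : 0 < M := by omega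
  set w : ℕ := M / (16 * C) + 1 with hw
  -- Since w ≥ M/(16C), these m windows have total length at least 3CM and cover [-CM, CM]. One of
  -- them must contain more than c elements of H.
  set m : ℕ := 48 * C ^ 2 with hm
  set c : ℕ := (M - 1) / (m * C) with hc
  have hmC : 0 < m * C := by positivity
  have hwM : w * (16 * C) ≤ M + 16 * C := by
    have := Nat.div_mul_le_self M (16 * C)
    rw [hw, add_mul]; omega
  have hMw : M ≤ w * (16 * C) := by
    have h1 := Nat.div_add_mod M (16 * C)
    have h2 := Nat.mod_lt M (show 0 < 16 * C by omega)
    rw [hw]; nlinarith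
  have hcM : M ≤ (c + 1) * (48 * C ^ 3) := by
    have h1 := Nat.div_add_mod (M - 1) (m * C)
    have h2 := Nat.mod_lt (M - 1) hmC
    have h3 : m * C = 48 * C ^ 3 := by rw [hm]; ring
    rw [← h3]
    rw [← hc] at h1
    have : M - 1 < (c + 1) * (m * C) := by rw [add_mul, mul_comm c]; omega
    omega
  have hc4 : 4 ≤ c + 1 := by
    have h3 : 0 < 48 * C ^ 3 := by positivity
    by_contra h
    have : (c + 1) * (48 * C ^ 3) ≤ 3 * (48 * C ^ 3) := Nat.mul_le_mul_right _ (by omega)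
    omega
  obtain ⟨y, hy⟩ := exists_window (H := H) (w := w) (m := m) (c := c) (Nat.succ_pos _)
    (x := -(C * M)) (by
      intro n hn
      have h1 := abs_le.1 (hH n hn)
      refine ⟨h1.1, h1.2.trans_lt ?_⟩
      have : 2 * (C * M) < m * w := by
        have : 0 < C * M := by positivity
        calc 2 * (C * M) < 3 * C * M := by nlinarith
          _ ≤ 3 * C * (w * (16 * C)) := Nat.mul_le_mul_left _ hMw
          _ = m * w := by rw [hm]; ring
      have : (2 * (C * M) : ℤ) < m * w := by exact_mod_cast this
      linarith) (by
      have h1 := Nat.mul_div_le (M - 1) (m * C)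
      rw [← hc] at h1
      have : C * (m * c) < C * H.card := by
        calc C * (m * c) = m * C * c := by ring
          _ < M := by omega
          _ ≤ _ := hcard
      exact Nat.lt_of_mul_lt_mul_left this)
  set H1 := H.filter fun n => y ≤ n ∧ n < y + w with hH1
  have hH1m : ∀ n ∈ H1, n ∈ H ∧ y ≤ n ∧ n < y + w := fun n hn => Finset.mem_filter.1 hn
  obtain ⟨a, ha, b, hb, hab, habs⟩ := exists_two_in_window (H := H1) (w := w) hs0 (x := y)
    (fun n hn => (hH1m n hn).2) (by
      refine lt_of_le_of_lt ?_ hy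
      have h1 : 4 * (w / s) ≤ c + 1 := by
        have h2 : w / s * s ≤ w := Nat.div_mul_le_self w s
        have h3 : w / s * (24 * C ^ 2) * (16 * C) ≤ 2 * M := by
          calc _ ≤ w * (16 * C) := Nat.mul_le_mul_right _ h2
            _ ≤ M + 16 * C := hwM
            _ ≤ 2 * M := by omega
        have h4 : (4 * (w / s)) * (48 * C ^ 3) ≤ (c + 1) * (48 * C ^ 3) := by
          refine le_trans ?_ hcM
          nlinarith
        exact Nat.le_of_mul_le_mul_right h4 (by positivity)
      omega)
  set κ := (a - b) • θ with hκ
  have hMr : (0 : ℝ) < M := by exact_mod_cast hM0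
  have hsub : ∀ n ∈ H1, ∀ n' ∈ H1, ‖(n - n') • θ‖ * M ≤ 2 * C := by
    intro n hn n' hn'
    have h1 := hθ n (hH1m n hn).1
    have h2 := hθ n' (hH1m n' hn').1
    have h3 : ‖(n - n') • θ‖ ≤ ‖n • θ‖ + ‖n' • θ‖ := by rw [sub_smul]; exact norm_sub_le _ _
    nlinarith
  have hκM := hsub a ha b hb
  rw [← hκ] at hκM
  have hne : H1.Nonempty := ⟨a, ha⟩
  set n0 := H1.min' hne
  set n1 := H1.max' hne
  have hd1 : (c : ℤ) ≤ n1 - n0 := by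
    have : H1 ⊆ Finset.Icc n0 n1 := fun t ht =>
      Finset.mem_Icc.2 ⟨H1.min'_le t ht, H1.le_max' t ht⟩
    have := Finset.card_le_card this
    rw [Int.card_Icc] at this
    omega
  have hd2 : (n1 - n0 : ℤ) ≤ M / (16 * C) := by
    have h1 := (hH1m n1 (H1.max'_mem hne)).2.2
    have h2 := (hH1m n0 (H1.min'_mem hne)).2.1
    rw [hw] at h1
    push_cast at h1
    omega
  have hCr : (1 : ℝ) ≤ C := by exact_mod_cast hC
  have hd2r : ((n1 - n0 : ℤ) : ℝ) * (16 * C) ≤ M := by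
    have : (n1 - n0 : ℤ) * (16 * C) ≤ M :=
      (mul_le_mul_of_nonneg_right hd2 (by positivity)).trans (Int.ediv_mul_le _ (by positivity))
    exact_mod_cast this
  have hd1r : (c : ℝ) ≤ ((n1 - n0 : ℤ) : ℝ) := by exact_mod_cast hd1
  have hc0 : (0 : ℝ) ≤ c := by positivity
  have hdabs : |((n1 - n0 : ℤ) : ℝ)| = ((n1 - n0 : ℤ) : ℝ) := abs_of_nonneg (hc0.trans hd1r)
  set d : ℤ := n1 - n0 with hd
  have hκ0 := norm_nonneg κ
  -- Here d ≤ M/(16C) and ‖κ‖ ≤ 2C/M, so there is no wrap-around. This dictated the width of the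
  -- windows.
  have hsmall : |(d : ℝ)| * ‖κ‖ ≤ 1 / 2 := by
    rw [hdabs]
    have h1 : ((d : ℝ) * (16 * C)) * (‖κ‖ * M) ≤ M * (2 * C) :=
      mul_le_mul hd2r hκM (by positivity) hMr.le
    have h2 : (C * M : ℝ) * (16 * (d * ‖κ‖)) ≤ (C * M : ℝ) * 2 := by nlinarith
    have h3 := le_of_mul_le_mul_left h2 (by positivity)
    linarith
  have heq := norm_zsmul_eq_of_lt hsmall
  -- The two multipliers commute: d is also a difference of elements of H, so ‖dθ‖ ≤ 2C/M, and the
  -- factor a - b costs at most s.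
  have hle : ‖d • κ‖ * M ≤ s * (2 * C) := by
    have h1 : d • κ = (a - b) • (d • θ) := by rw [hκ, smul_comm]
    have h2 := norm_zsmul_le' (a - b) (d • θ)
    have h3 := hsub n1 (H1.max'_mem hne) n0 (H1.min'_mem hne)
    have h4 : |((a - b : ℤ) : ℝ)| ≤ s := by
      rw [← Int.cast_abs]; exact_mod_cast habs.le
    rw [h1]
    calc _ ≤ |((a - b : ℤ) : ℝ)| * ‖d • θ‖ * M := by gcongr
      _ = |((a - b : ℤ) : ℝ)| * (‖d • θ‖ * M) := by ring
      _ ≤ _ := mul_le_mul h4 h3 (by positivity) (by positivity)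
  rw [heq, hdabs] at hle
  have hdM : (M : ℝ) ≤ d * (96 * C ^ 3) := by
    have h1 : (M : ℝ) ≤ (c + 1) * (48 * C ^ 3) := by exact_mod_cast hcM
    have h2 : (4 : ℝ) ≤ c + 1 := by exact_mod_cast hc4
    have h3 : (0 : ℝ) < C ^ 3 := by positivity
    have h4 : (c + 1 : ℝ) ≤ 2 * d := by linarith
    calc (M : ℝ) ≤ (c + 1) * (48 * C ^ 3) := h1
      _ ≤ 2 * d * (48 * C ^ 3) := by gcongr
      _ = _ := by ring
  have hfin : ‖κ‖ * (M : ℝ) ^ 2 ≤ 192 * C ^ 4 * s := by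
    calc ‖κ‖ * (M : ℝ) ^ 2 = (‖κ‖ * M) * M := by ring
      _ ≤ (‖κ‖ * M) * (d * (96 * C ^ 3)) := by gcongr
      _ = (d * ‖κ‖ * M) * (96 * C ^ 3) := by ring
      _ ≤ (s * (2 * C)) * (96 * C ^ 3) := by gcongr
      _ = _ := by ring
  -- The difference a - b depends on H and θ. Passing to s! gives a multiplier depending on C only.
  have hdvd : (a - b) ∣ (s.factorial : ℤ) := by
    rw [← Int.natAbs_dvd, Int.natCast_dvd_natCast]
    rw [Int.abs_eq_natAbs] at habs
    exact Nat.dvd_factorial (by omega) (by omega)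
  obtain ⟨q, hq⟩ := hdvd
  have hqle : |(q : ℝ)| ≤ s.factorial := by
    have h1 : |(s.factorial : ℤ)| = |a - b| * |q| := by rw [hq, abs_mul]
    have h2 : 1 ≤ |a - b| := Int.one_le_abs (by omega)
    have h3 : |q| ≤ (s.factorial : ℤ) := by
      rw [Nat.abs_cast] at h1; rw [h1]; nlinarith [abs_nonneg q]
    rw [← Int.cast_abs]; exact_mod_cast h3
  have hkey : s.factorial • θ = q • κ := by
    rw [hκ, smul_smul, mul_comm, ← hq, natCast_zsmul]
  rw [hkey]
  have hlast := norm_zsmul_le' q κ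
  push_cast
  calc ‖q • κ‖ * (M : ℝ) ^ 2 ≤ |(q : ℝ)| * ‖κ‖ * (M : ℝ) ^ 2 := by gcongr
    _ = |(q : ℝ)| * (‖κ‖ * (M : ℝ) ^ 2) := by ring
    _ ≤ s.factorial * (192 * C ^ 4 * s) := by gcongr
    _ ≤ _ := le_add_of_nonneg_right (by positivity)

/-! ### Quadratic exponential sums in one variable -/

lemma choose_two_add (m n : ℤ) :
    Ring.choose (m + n) 2 = Ring.choose m 2 + Ring.choose n 2 + m * n := by
  have h1 := two_mul_choose_two (m + n)
  have h2 := two_mul_choose_two m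
  have h3 := two_mul_choose_two n
  linarith

/-- The van der Corput inequality (without smoothing). -/
lemma norm_sum_sq_le_sum_norm_shift {I : Finset ℤ} {R : ℤ}
    (hR : ∀ t ∈ I, ∀ t' ∈ I, |t - t'| ≤ R) (z : ℤ → ℂ) :
    ‖∑ t ∈ I, z t‖ ^ 2 ≤ ∑ h ∈ Finset.Icc (-R) R,
      ‖∑ t ∈ I.filter (fun t => t + h ∈ I), z (t + h) * (starRingEnd ℂ) (z t)‖ := by
  have h1 : (‖∑ t ∈ I, z t‖ ^ 2 : ℝ) =
      ‖(∑ t ∈ I, z t) * (starRingEnd ℂ) (∑ t ∈ I, z t)‖ := by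
    rw [norm_mul, RCLike.norm_conj, sq]
  have h2 : (∑ t ∈ I, z t) * (starRingEnd ℂ) (∑ t ∈ I, z t) =
      ∑ h ∈ Finset.Icc (-R) R,
        ∑ t ∈ I.filter (fun t => t + h ∈ I), z (t + h) * (starRingEnd ℂ) (z t) := by
    rw [map_sum, Finset.mul_sum]
    simp_rw [Finset.sum_filter]
    rw [Finset.sum_comm]
    refine Finset.sum_congr rfl fun t ht => ?_
    rw [← Finset.sum_filter, Finset.sum_mul]
    refine Finset.sum_nbij' (fun t' => t' - t) (fun h => t + h) ?_ ?_ ?_ ?_ ?_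
    · intro t' ht'
      simp only [Finset.mem_filter, Finset.mem_Icc]
      exact ⟨abs_le.1 (hR t' ht' t ht), by simpa using ht'⟩
    · intro h hh; exact (Finset.mem_filter.1 hh).2
    · intro t' _; ring
    · intro h _; ring
    · intro t' _; simp
  rw [h1, h2]
  exact norm_sum_le _ _

/-- Differencing by h leaves a linear phase of frequency h • a. If the sum is large, a positive
proportion of the shifts h leave a large linear sum, and each of these forces ‖h • a‖ = O(1/M). Then
`exists_norm_nsmul_of_recurrent` applies. -/
lemma norm_leading_coeff_of_large_sum (C : ℕ) (hC : 0 < C) :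
    ∃ k K : ℕ, 0 < k ∧ 0 < K ∧ ∀ M : ℕ, K ≤ M → ∀ (I : Finset ℤ) (a b c : UnitAddCircle),
      (I : Set ℤ).OrdConnected → (∀ t ∈ I, |t| ≤ C * M) →
      M ≤ C * ‖∑ t ∈ I, circleChar (c + t • b + Ring.choose t 2 • a)‖ →
      ‖k • a‖ * (M : ℝ) ^ 2 ≤ K := by
  obtain ⟨k, K, hk, hK, h⟩ := exists_norm_nsmul_of_recurrent (10 * C ^ 3) (by positivity)
  refine ⟨k, K, hk, hK, fun M hM I a b c hI hIM hsum => ?_⟩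
  have hM0 : 0 < M := by omega
  have hMr : (1 : ℝ) ≤ M := by exact_mod_cast hM0
  have hCr : (1 : ℝ) ≤ C := by exact_mod_cast hC
  set z : ℤ → ℂ := fun t => circleChar (c + t • b + Ring.choose t 2 • a) with hz
  have hR : ∀ t ∈ I, ∀ t' ∈ I, |t - t'| ≤ 2 * C * M := fun t ht t' ht' => by
    have := abs_sub t t'
    linarith [hIM t ht, hIM t' ht']
  have hvdc := norm_sum_sq_le_sum_norm_shift hR z
  set s := Finset.Icc (-(2 * C * M : ℤ)) (2 * C * M) with hs
  set f : ℤ → ℝ := fun h =>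
    ‖∑ t ∈ I.filter (fun t => t + h ∈ I), z (t + h) * (starRingEnd ℂ) (z t)‖ with hf
  have hz1 : ∀ t, ‖z t‖ = 1 := fun t => norm_circleChar _
  have hIcard : (I.card : ℝ) ≤ 3 * C * M := by
    have h1 : I ⊆ Finset.Icc (-(C * M : ℤ)) (C * M) := fun t ht =>
      Finset.mem_Icc.2 (abs_le.1 (hIM t ht))
    have h2 := Finset.card_le_card h1
    rw [Int.card_Icc] at h2
    have h3 : I.card ≤ 2 * (C * M) + 1 := by
      have : ((C * M : ℤ) + 1 - -(C * M : ℤ)).toNat = 2 * (C * M) + 1 := by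
        have : ((C * M : ℤ) + 1 - -(C * M : ℤ)) = ((2 * (C * M) + 1 : ℕ) : ℤ) := by push_cast; ring
        rw [this, Int.toNat_natCast]
      omega
    have h4 : (I.card : ℝ) ≤ 2 * (C * M) + 1 := by exact_mod_cast h3
    nlinarith
  have hscard : (s.card : ℝ) ≤ 5 * C * M := by
    have : s.card = 4 * (C * M) + 1 := by
      rw [hs, Int.card_Icc]
      have : ((2 * C * M : ℤ) + 1 - -(2 * C * M : ℤ)) = ((4 * (C * M) + 1 : ℕ) : ℤ) := by
        push_cast; ring
      rw [this, Int.toNat_natCast]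
    rw [this]; push_cast
    nlinarith
  have hfB : ∀ x ∈ s, f x ≤ 3 * C * M := by
    intro x _
    refine (norm_sum_le _ _).trans (le_trans ?_ hIcard)
    refine (Finset.sum_le_card_nsmul _ _ 1 fun t _ => ?_).trans ?_
    · rw [norm_mul, RCLike.norm_conj, hz1, hz1, one_mul]
    · rw [nsmul_one]
      exact_mod_cast Finset.card_filter_le _ _
  -- At this threshold the shifts below it, at most 5CM in number, account for at most half of
  -- M²/C².
  set l : ℝ := M / (10 * C ^ 3) with hl
  have hlow := le_card_filter_mul_add s f hfB (l := l) (by positivity)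
  set H := s.filter fun x => l ≤ f x with hH
  have hcount : (M : ℝ) ≤ 10 * C ^ 3 * H.card := by
    have h1 : (M : ℝ) ^ 2 ≤ C ^ 2 * ‖∑ t ∈ I, z t‖ ^ 2 := by
      rw [← mul_pow]; gcongr
    have h2 : (M : ℝ) ^ 2 ≤ C ^ 2 * (H.card * (3 * C * M) + 5 * C * M * l) := by
      refine h1.trans (mul_le_mul_of_nonneg_left ?_ (by positivity))
      refine hvdc.trans (hlow.trans ?_)
      gcongr
    have h3 : C ^ 2 * (5 * C * M * l) = (M : ℝ) ^ 2 / 2 := by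
      rw [hl]; field_simp; ring
    have h4 : (M : ℝ) * M ≤ M * (6 * C ^ 3 * H.card) := by nlinarith
    have h5 := le_of_mul_le_mul_left h4 (by linarith)
    have h6 : (0 : ℝ) ≤ C ^ 3 * H.card := by positivity
    linarith
  refine h M hM H a ?_ (by exact_mod_cast hcount) ?_
  · intro n hn
    have h1 := abs_le.2 (Finset.mem_Icc.1 (Finset.mem_filter.1 hn).1)
    refine h1.trans ?_
    have h2 : C ≤ C ^ 3 := Nat.le_self_pow (by norm_num) C
    have : 2 * C * M ≤ 10 * C ^ 3 * M := Nat.mul_le_mul_right _ (by omega)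
    exact_mod_cast this
  · intro n hn
    have hln := (Finset.mem_filter.1 hn).2
    have hconn : ((I.filter (fun t => t + n ∈ I) : Finset ℤ) : Set ℤ).OrdConnected := by
      refine ⟨fun x hx y hy t ht => ?_⟩
      simp only [Finset.coe_filter, Set.mem_ofPred_eq] at hx hy ⊢
      refine ⟨hI.out hx.1 hy.1 ht, hI.out hx.2 hy.2 ⟨?_, ?_⟩⟩
      · linarith [ht.1]
      · linarith [ht.2]
    have hgeo := norm_sum_linear_phase_mul_le hconn (n • b + Ring.choose n 2 • a) (n • a)
    have hsumeq : ∑ t ∈ I.filter (fun t => t + n ∈ I),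
        circleChar (n • b + Ring.choose n 2 • a + t • (n • a)) =
        ∑ t ∈ I.filter (fun t => t + n ∈ I), z (t + n) * (starRingEnd ℂ) (z t) := by
      refine Finset.sum_congr rfl fun t _ => ?_
      rw [hz, ← circleChar_sub, choose_two_add]
      congr 1
      module
    rw [hsumeq] at hgeo
    have h1 : l * ‖n • a‖ ≤ 1 / 2 := (mul_le_mul_of_nonneg_right hln (norm_nonneg _)).trans hgeo
    have h2 : (M : ℝ) = l * (10 * C ^ 3) := by rw [hl]; field_simp
    push_cast
    have h3 : (0 : ℝ) < C ^ 3 := by positivity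
    calc ‖n • a‖ * M = (l * ‖n • a‖) * (10 * C ^ 3) := by rw [h2]; ring
      _ ≤ 1 / 2 * (10 * C ^ 3) := by gcongr
      _ ≤ _ := by linarith

/-- Averaging over translates: some progression of step `d` and length `J` carries its share of
a sum over `I`. -/
lemma exists_progression_share {I : Finset ℤ} {R : ℕ} (hI : ∀ t ∈ I, |t| ≤ R) (d J : ℕ)
    (z : ℤ → ℂ) :
    ∃ t₀ : ℤ, |t₀| ≤ R + d * J ∧ J * ‖∑ t ∈ I, z t‖ ≤ (2 * R + d * J + 1) *
      ‖∑ j ∈ (Finset.Ico (0 : ℤ) J).filter (fun j => t₀ + d * j ∈ I), z (t₀ + d * j)‖ := by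
  -- For each j, every t ∈ I is t₀ + dj for exactly one starting point t₀ of this range, so summing
  -- over t₀ gives J times the full sum.
  set s := Finset.Icc (-(R + d * J : ℤ)) R with hs
  set g : ℤ → ℂ := fun t₀ =>
    ∑ j ∈ (Finset.Ico (0 : ℤ) J).filter (fun j => t₀ + d * j ∈ I), z (t₀ + d * j) with hg
  have hsum : ∑ t₀ ∈ s, g t₀ = J * ∑ t ∈ I, z t := by
    simp_rw [hg, Finset.sum_filter]
    rw [Finset.sum_comm]
    have : ∀ j ∈ Finset.Ico (0 : ℤ) J,
        ∑ t₀ ∈ s, (if t₀ + d * j ∈ I then z (t₀ + d * j) else 0) = ∑ t ∈ I, z t := by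
      intro j hj
      rw [Finset.mem_Ico] at hj
      rw [← Finset.sum_filter]
      have hdj : (d : ℤ) * j ≤ d * J := mul_le_mul_of_nonneg_left hj.2.le (by positivity)
      have hdj0 : (0 : ℤ) ≤ d * j := mul_nonneg (by positivity) hj.1
      refine Finset.sum_nbij' (fun t => t + d * j) (fun t => t - d * j) ?_ ?_ ?_ ?_ ?_
      · intro t ht; exact (Finset.mem_filter.1 ht).2
      · intro t ht
        have := abs_le.1 (hI t ht)
        rw [Finset.mem_filter, hs, Finset.mem_Icc]
        refine ⟨⟨by linarith, by linarith⟩, by simpa using ht⟩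
      · intro t _; ring
      · intro t _; ring
      · intro t _; rfl
    rw [Finset.sum_congr rfl this, Finset.sum_const, nsmul_eq_mul]
    simp
  have hcard : s.card = 2 * R + d * J + 1 := by
    rw [hs, Int.card_Icc]
    have : ((R : ℤ) + 1 - -(R + d * J : ℤ)) = ((2 * R + d * J + 1 : ℕ) : ℤ) := by push_cast; ring
    rw [this, Int.toNat_natCast]
  obtain ⟨t₀, ht₀, hle⟩ := Finset.exists_le_of_sum_le (s := s)
    (f := fun _ => (J * ‖∑ t ∈ I, z t‖) / (2 * R + d * J + 1 : ℝ)) (g := fun t => ‖g t‖)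
    (by rw [← Finset.card_pos, hcard]; omega) (by
      rw [Finset.sum_const, hcard, nsmul_eq_mul]
      push_cast
      rw [mul_div_cancel₀ _ (by positivity)]
      calc (J : ℝ) * ‖∑ t ∈ I, z t‖ = ‖∑ t₀ ∈ s, g t₀‖ := by rw [hsum, norm_mul]; simp
        _ ≤ _ := norm_sum_le _ _)
  rw [div_le_iff₀' (by positivity)] at hle
  refine ⟨t₀, ?_, hle⟩
  rw [hs, Finset.mem_Icc] at ht₀
  rw [abs_le]
  have : (0 : ℤ) ≤ d * J := by positivity
  constructor <;> linarith

/-- The step 2k, rather than k, makes the binomial coefficient divisible by k: it equals k · j(2kj -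
1). So only k • a matters; its multiplier is at most 2kJ², and J ≤ 2M/Q. -/
lemma norm_choose_two_smul_le {k K₀ M J Q : ℕ} {a : UnitAddCircle} (hk : 0 < k) (hQ : 0 < Q)
    (hM : 0 < M) (hJQ : J * Q ≤ 2 * M) (ha : ‖k • a‖ * (M : ℝ) ^ 2 ≤ K₀) {j : ℤ} (hj0 : 0 ≤ j)
    (hjJ : j ≤ J) :
    7 * ‖Ring.choose (((2 * k : ℕ) : ℤ) * j) 2 • a‖ ≤ 56 * k * K₀ / Q := by
  have hc2 : Ring.choose (((2 * k : ℕ) : ℤ) * j) 2 = (j * (2 * k * j - 1)) * k := by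
    have := two_mul_choose_two (((2 * k : ℕ) : ℤ) * j)
    push_cast at this ⊢
    linarith
  have hsm : Ring.choose (((2 * k : ℕ) : ℤ) * j) 2 • a = (j * (2 * k * j - 1)) • (k • a) := by
    rw [hc2, mul_smul, natCast_zsmul]
  rw [hsm]
  have hkr : (1 : ℝ) ≤ k := by exact_mod_cast hk
  have hQ1 : (1 : ℝ) ≤ Q := by exact_mod_cast hQ
  have hMr : (1 : ℝ) ≤ M := by exact_mod_cast hM
  have hJQr : (J : ℝ) * Q ≤ 2 * M := by exact_mod_cast hJQ
  have h1 := norm_zsmul_le' (j * (2 * k * j - 1)) (k • a)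
  have hj0r : (0 : ℝ) ≤ j := by exact_mod_cast hj0
  have hjJr : (j : ℝ) ≤ J := by exact_mod_cast hjJ
  have h2 : |((j * (2 * k * j - 1) : ℤ) : ℝ)| ≤ 2 * k * J ^ 2 := by
    push_cast
    rcases eq_or_lt_of_le hj0 with h | h
    · rw [← h]; simp only [Int.cast_zero, zero_mul, abs_zero]; positivity
    have hj1 : (1 : ℝ) ≤ j := by exact_mod_cast h
    have : (1 : ℝ) ≤ 2 * k * j := by nlinarith
    rw [abs_of_nonneg (mul_nonneg hj0r (by linarith))]
    have : (j : ℝ) ^ 2 ≤ J ^ 2 := by gcongr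
    nlinarith
  generalize ‖(j * (2 * k * j - 1)) • (k • a)‖ = y at h1 ⊢
  generalize ‖k • a‖ = x at h1 ha
  have hx : y * M ^ 2 ≤ 2 * k * J ^ 2 * K₀ := by
    have hx0 : 0 ≤ x ∨ x < 0 := le_or_gt 0 x
    rcases hx0 with hx0 | hx0
    · calc y * M ^ 2 ≤ 2 * k * J ^ 2 * x * M ^ 2 := by gcongr; exact h1.trans (by gcongr)
        _ = 2 * k * J ^ 2 * (x * M ^ 2) := by ring
        _ ≤ _ := by gcongr
    · have : y ≤ 0 := h1.trans (mul_nonpos_of_nonneg_of_nonpos (abs_nonneg _) hx0.le)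
      have : y * M ^ 2 ≤ 0 := mul_nonpos_of_nonpos_of_nonneg this (by positivity)
      exact this.trans (by positivity)
  have h4 : (J : ℝ) ^ 2 * Q ≤ 4 * M ^ 2 := by
    have h5 : ((J : ℝ) * Q) ^ 2 ≤ (2 * M) ^ 2 := by gcongr
    have h6 : (J : ℝ) ^ 2 * Q * 1 ≤ J ^ 2 * Q * Q := by gcongr
    linarith [mul_pow (J : ℝ) Q 2, mul_pow (2 : ℝ) M 2]
  rw [le_div_iff₀ (by linarith)]
  have h5 : (M : ℝ) ^ 2 * (7 * y * Q) ≤ M ^ 2 * (56 * k * K₀) := by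
    calc _ = 7 * Q * (y * M ^ 2) := by ring
      _ ≤ 7 * Q * (2 * k * J ^ 2 * K₀) := by gcongr
      _ = 14 * k * K₀ * (J ^ 2 * Q) := by ring
      _ ≤ 14 * k * K₀ * (4 * M ^ 2) := by gcongr
      _ = _ := by ring
  exact le_of_mul_le_mul_left h5 (by positivity)

/-- Along a progression t₀ + dj with d = 2k and j < J ≈ M/Q, the purely quadratic contribution is
negligible and the phase is essentially linear in j with slope `d • b + (t₀ * d) • a`. Some such
progression keeps its share of the sum, so the geometric series bounds this slope. Its second term
is a multiple of k • a and is itself O(1/M). -/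
lemma norm_linear_coeff_of_large_sum (C k K₀ : ℕ) (hC : 0 < C) (hk : 0 < k) (hK₀ : 0 < K₀) :
    ∃ K : ℕ, 0 < K ∧ ∀ M : ℕ, K ≤ M → ∀ (I : Finset ℤ) (a b c : UnitAddCircle),
      (I : Set ℤ).OrdConnected → (∀ t ∈ I, |t| ≤ C * M) →
      M ≤ C * ‖∑ t ∈ I, circleChar (c + t • b + Ring.choose t 2 • a)‖ →
      ‖k • a‖ * (M : ℝ) ^ 2 ≤ K₀ → ‖(2 * k) • b‖ * M ≤ K := by
  set d := 2 * k with hd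
  set G := C * (2 * C + d + 1) with hG
  have hG0 : 0 < G := by positivity
  set Q := 112 * k * K₀ * G + 2 with hQ
  refine ⟨G * Q + 2 * (C + d) * K₀ + Q, by positivity, ?_⟩
  intro M hM I a b c hI hIM hsum ha
  have hQM : Q ≤ M := le_trans (Nat.le_add_left _ _) hM
  have hM0 : 0 < M := by omega
  set J := M / Q + 1 with hJ
  have hJM : J ≤ M := by
    have : M / Q ≤ M / 2 := Nat.div_le_div_left (by omega) (by norm_num)
    omega
  have hJQ : M ≤ J * Q := by
    have h1 := Nat.div_add_mod M Q
    have h2 := Nat.mod_lt M (show 0 < Q by omega)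
    rw [hJ]; nlinarith
  have hJQ2 : J * Q ≤ 2 * M := by
    have h1 := Nat.div_mul_le_self M Q
    rw [hJ, add_mul]; omega
  obtain ⟨t₀, ht₀, hshare⟩ := exists_progression_share (I := I) (R := C * M)
    (by intro t ht; exact_mod_cast hIM t ht) d J
    (fun t => circleChar (c + t • b + Ring.choose t 2 • a))
  set T := (Finset.Ico (0 : ℤ) J).filter (fun j => t₀ + d * j ∈ I) with hT
  have hMr : (1 : ℝ) ≤ M := by exact_mod_cast hM0
  have hCr : (1 : ℝ) ≤ C := by exact_mod_cast hC
  have hkr : (1 : ℝ) ≤ k := by exact_mod_cast hk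
  have hKr : (1 : ℝ) ≤ K₀ := by exact_mod_cast hK₀
  have hGr : (1 : ℝ) ≤ G := by exact_mod_cast hG0
  have hJ0 : (1 : ℝ) ≤ J := by rw [hJ]; push_cast; linarith [show (0:ℝ) ≤ ((M / Q : ℕ) : ℝ) by positivity]
  have hJMr : (J : ℝ) ≤ M := by exact_mod_cast hJM
  have hJQr : (M : ℝ) ≤ J * Q := by exact_mod_cast hJQ
  have hJQ2r : (J : ℝ) * Q ≤ 2 * M := by exact_mod_cast hJQ2
  have hTconn : (T : Set ℤ).OrdConnected := by
    refine ⟨fun x hx y hy t ht => ?_⟩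
    simp only [hT, Finset.coe_filter, Set.mem_ofPred_eq, Finset.mem_Ico] at hx hy ⊢
    have hd0 : (0 : ℤ) ≤ d := by positivity
    refine ⟨⟨by linarith [ht.1], by linarith [ht.2]⟩, hI.out hx.2 hy.2 ⟨?_, ?_⟩⟩
    · linarith [mul_le_mul_of_nonneg_left ht.1 hd0]
    · linarith [mul_le_mul_of_nonneg_left ht.2 hd0]
  set b' := d • b + (t₀ * d) • a with hb'
  have hgeo := norm_sum_linear_phase_mul_le hTconn (c + t₀ • b + Ring.choose t₀ 2 • a) b'
  set Lsum := ∑ t ∈ T, circleChar (c + t₀ • b + Ring.choose t₀ 2 • a + t • b') with hL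
  set Qsum := ∑ j ∈ T, circleChar (c + (t₀ + d * j) • b + Ring.choose (t₀ + d * j) 2 • a) with hQs
  have hJG : (J : ℝ) ≤ G * ‖Qsum‖ := by
    have h1 : (J : ℝ) * M ≤ C * ((2 * ((C * M : ℕ) : ℝ) + d * J + 1) * ‖Qsum‖) := by
      calc (J : ℝ) * M ≤ J * (C * ‖∑ t ∈ I, circleChar (c + t • b + Ring.choose t 2 • a)‖) := by
            gcongr
        _ = C * (J * ‖∑ t ∈ I, circleChar (c + t • b + Ring.choose t 2 • a)‖) := by ring
        _ ≤ _ := by gcongr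
    have h2 : (2 * ((C * M : ℕ) : ℝ) + d * J + 1) ≤ (2 * C + d + 1) * M := by
      push_cast
      have : (d : ℝ) * J ≤ d * M := by gcongr
      linarith
    have h3 : (M : ℝ) * J ≤ M * (G * ‖Qsum‖) := by
      calc (M : ℝ) * J = J * M := by ring
        _ ≤ _ := h1
        _ ≤ C * ((2 * C + d + 1) * M * ‖Qsum‖) := by gcongr
        _ = _ := by rw [hG]; push_cast; ring
    exact le_of_mul_le_mul_left h3 (by linarith)
  have herr : ‖Qsum - Lsum‖ ≤ J * (56 * k * K₀ / Q) := by
    rw [hQs, hL, ← Finset.sum_sub_distrib]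
    have hTcard : (T.card : ℝ) ≤ J := by
      have := Finset.card_filter_le (Finset.Ico (0 : ℤ) J) (fun j => t₀ + d * j ∈ I)
      rw [Int.card_Ico, sub_zero, Int.toNat_natCast] at this
      exact_mod_cast this
    refine (norm_sum_le _ _).trans ((Finset.sum_le_card_nsmul _ _ (56 * k * K₀ / Q : ℝ) ?_).trans ?_)
    · intro j hj
      rw [hT, Finset.mem_filter, Finset.mem_Ico] at hj
      obtain ⟨⟨hj0, hjJ⟩, -⟩ := hj
      have hdiff : (c + (t₀ + d * j) • b + Ring.choose (t₀ + d * j) 2 • a) -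
          (c + t₀ • b + Ring.choose t₀ 2 • a + j • b') = Ring.choose (d * j : ℤ) 2 • a := by
        rw [choose_two_add, hb']
        module
      refine (norm_circleChar_sub_le _ _).trans ?_
      rw [hdiff]
      exact norm_choose_two_smul_le hk (by omega) hM0 hJQ2 ha hj0 hjJ.le
    · rw [nsmul_eq_mul]; gcongr
  have hlin : (J : ℝ) ≤ 2 * G * ‖Lsum‖ := by
    have h1 : ‖Qsum‖ ≤ ‖Lsum‖ + J * (56 * k * K₀ / Q) := by
      have := norm_sub_norm_le Qsum Lsum; linarith
    have h2 : G * (56 * k * K₀ / Q : ℝ) ≤ 1 / 2 := by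
      have hQpos : (0 : ℝ) < Q := by exact_mod_cast (show 0 < Q by omega)
      rw [← mul_div_assoc, div_le_iff₀ hQpos, hQ]
      push_cast
      linarith
    have h3 : (J : ℝ) ≤ G * ‖Lsum‖ + J * (1 / 2) := by
      calc (J : ℝ) ≤ G * (‖Lsum‖ + J * (56 * k * K₀ / Q)) := hJG.trans (by gcongr)
        _ = G * ‖Lsum‖ + J * (G * (56 * k * K₀ / Q)) := by ring
        _ ≤ _ := by gcongr
    linarith
  have hb'J : ‖b'‖ * J ≤ G := by
    calc ‖b'‖ * J ≤ ‖b'‖ * (2 * G * ‖Lsum‖) := by gcongr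
      _ = 2 * G * (‖Lsum‖ * ‖b'‖) := by ring
      _ ≤ 2 * G * (1 / 2) := by gcongr
      _ = G := by ring
  have hb'M : ‖b'‖ * M ≤ G * Q := by
    calc ‖b'‖ * M ≤ ‖b'‖ * (J * Q) := by gcongr
      _ = ‖b'‖ * J * Q := by ring
      _ ≤ _ := by gcongr
  have ht₀r : |(t₀ : ℝ)| ≤ (C + d) * M := by
    have h1 : |(t₀ : ℝ)| ≤ C * M + d * J := by rw [← Int.cast_abs]; exact_mod_cast ht₀
    have : (d : ℝ) * J ≤ d * M := by gcongr
    linarith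
  have hdb : d • b = b' - (2 * t₀) • (k • a) := by
    rw [hb', hd]
    module
  have hta : ‖(2 * t₀) • (k • a)‖ * M ≤ 2 * (C + d) * K₀ := by
    have h1 := norm_zsmul_le' (2 * t₀) (k • a)
    push_cast at h1
    rw [abs_mul, abs_of_pos (by norm_num : (0 : ℝ) < 2)] at h1
    calc _ ≤ 2 * ((C + d) * M) * ‖k • a‖ * M := by gcongr; exact h1.trans (by gcongr)
      _ = 2 * (C + d) * (‖k • a‖ * M ^ 2) := by ring
      _ ≤ _ := by gcongr
  have hfin : ‖d • b‖ ≤ ‖b'‖ + ‖(2 * t₀) • (k • a)‖ := by rw [hdb]; exact norm_sub_le _ _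
  push_cast
  calc ‖d • b‖ * M ≤ (‖b'‖ + ‖(2 * t₀) • (k • a)‖) * M := by gcongr
    _ = ‖b'‖ * M + ‖(2 * t₀) • (k • a)‖ * M := by ring
    _ ≤ G * Q + 2 * (C + d) * K₀ := add_le_add hb'M hta
    _ ≤ _ := le_add_of_nonneg_right (by positivity)

/-- A quadratic inverse theorem of Weyl type in one variable: if a quadratic exponential sum over
an interval is large, then its coefficients are close to rationals of bounded denominator. -/
lemma weyl_inverse (C : ℕ) (hC : 0 < C) :
    ∃ k K : ℕ, 0 < k ∧ 0 < K ∧ ∀ M : ℕ, K ≤ M → ∀ (I : Finset ℤ) (a b c : UnitAddCircle),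
      (I : Set ℤ).OrdConnected → (∀ t ∈ I, |t| ≤ C * M) →
      M ≤ C * ‖∑ t ∈ I, circleChar (c + t • b + Ring.choose t 2 • a)‖ →
      ‖k • a‖ * (M : ℝ) ^ 2 ≤ K ∧ ‖k • b‖ * M ≤ K := by
  obtain ⟨k, K₁, hk, hK₁, h₁⟩ := norm_leading_coeff_of_large_sum C hC
  obtain ⟨K₂, hK₂, h₂⟩ := norm_linear_coeff_of_large_sum C k K₁ hC hk hK₁
  refine ⟨2 * k, 2 * K₁ + K₂, by omega, by omega, fun M hM I a b c hI hIM hsum => ?_⟩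
  have ha := h₁ M (by omega) I a b c hI hIM hsum
  have hb := h₂ M (by omega) I a b c hI hIM hsum ha
  push_cast
  constructor
  · have : ‖(2 * k) • a‖ ≤ 2 * ‖k • a‖ := by
      rw [mul_smul]; simpa using norm_nsmul_le' 2 (k • a)
    have h0 : (0 : ℝ) ≤ K₂ := by positivity
    nlinarith [sq_nonneg (M : ℝ)]
  · have h0 : (0 : ℝ) ≤ K₁ := by positivity
    linarith

/-! ### Quadratic exponential sums in two variables -/

/-- A quadratic phase in two variables, in binomial coordinates. -/
noncomputable def quadPhase (c e₁ e₂ A B D : UnitAddCircle) (x y : ℤ) : UnitAddCircle :=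
  c + x • e₁ + y • e₂ + Ring.choose x 2 • A + (x * y) • B + Ring.choose y 2 • D

lemma quadPhase_swap (c e₁ e₂ A B D : UnitAddCircle) (x y : ℤ) :
    quadPhase c e₁ e₂ A B D x y = quadPhase c e₂ e₁ D B A y x := by
  unfold quadPhase; module

lemma choose_two_mul (m n : ℤ) :
    Ring.choose (m * n) 2 = n * Ring.choose m 2 + m ^ 2 * Ring.choose n 2 := by
  have h1 := two_mul_choose_two (m * n)
  have h2 := two_mul_choose_two m
  have h3 := two_mul_choose_two n
  have : 2 * Ring.choose (m * n) 2 = 2 * (n * Ring.choose m 2 + m ^ 2 * Ring.choose n 2) := by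
    rw [h1, mul_add, mul_left_comm 2 n, h2, mul_left_comm 2 (m ^ 2), h3]; ring
  linarith

lemma norm_zsmul_mul_le {n : ℤ} {θ : UnitAddCircle} {N T K : ℝ} (hn : |(n : ℝ)| ≤ N)
    (hT : 0 ≤ T) (h : ‖θ‖ * T ≤ K) : ‖n • θ‖ * T ≤ N * K := by
  have h1 := norm_zsmul_le' n θ
  have h0 : 0 ≤ ‖θ‖ * T := by positivity
  calc ‖n • θ‖ * T ≤ |(n : ℝ)| * ‖θ‖ * T := by gcongr
    _ = |(n : ℝ)| * (‖θ‖ * T) := by ring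
    _ ≤ _ := mul_le_mul hn h h0 ((abs_nonneg _).trans hn)

lemma norm_sum_circleChar_le {α : Type*} (s : Finset α) (f : α → UnitAddCircle) :
    ‖∑ a ∈ s, circleChar (f a)‖ ≤ s.card := by
  refine (norm_sum_le _ _).trans ?_
  simp [norm_circleChar]

lemma card_Icc_neg_le {R : ℕ} : ((Finset.Icc (-(R : ℤ)) R).card : ℝ) = 2 * R + 1 := by
  rw [Int.card_Icc]
  have : ((R : ℤ) + 1 - -(R : ℤ)) = ((2 * R + 1 : ℕ) : ℤ) := by push_cast; ring
  rw [this, Int.toNat_natCast]; push_cast; ring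

/-- Splitting a planar sum into rows and residue classes modulo `D` within each row. -/
lemma sum_eq_sum_rows {S : Finset (ℤ × ℤ)} {D R R' : ℕ} (hD : 0 < D)
    (hS : ∀ p ∈ S, |p.1| ≤ R ∧ |p.2| ≤ R) (hR : R + 1 ≤ R') (F : ℤ × ℤ → ℂ) :
    ∑ p ∈ S, F p = ∑ r ∈ Finset.Ico (0 : ℤ) D, ∑ y ∈ Finset.Icc (-(R : ℤ)) R,
      ∑ t ∈ (Finset.Icc (-(R' : ℤ)) R').filter (fun t => ((D : ℤ) * t + r, y) ∈ S),
        F (D * t + r, y) := by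
  have hD' : (0 : ℤ) < D := by exact_mod_cast hD
  rw [← Finset.sum_fiberwise_of_maps_to (t := Finset.Ico (0 : ℤ) D) (g := fun p => p.1 % D)
    (fun p _ => Finset.mem_Ico.2 ⟨Int.emod_nonneg _ hD'.ne', Int.emod_lt_of_pos _ hD'⟩)]
  refine Finset.sum_congr rfl fun r hr => ?_
  rw [Finset.mem_Ico] at hr
  rw [← Finset.sum_fiberwise_of_maps_to (t := Finset.Icc (-(R : ℤ)) R) (g := fun p => p.2)
    (fun p hp => Finset.mem_Icc.2 (abs_le.1 (hS p (Finset.mem_filter.1 hp).1).2))]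
  refine Finset.sum_congr rfl fun y _ => ?_
  refine Finset.sum_nbij' (fun p => p.1 / D) (fun t => (D * t + r, y)) ?_ ?_ ?_ ?_ ?_
  · rintro ⟨x, y'⟩ hp
    simp only [Finset.mem_filter] at hp
    obtain ⟨⟨hp, rfl⟩, rfl⟩ := hp
    have h1 := Int.mul_ediv_add_emod x D
    have h2 := abs_le.1 (hS _ hp).1
    simp only at h2
    simp only [Finset.mem_filter, Finset.mem_Icc, h1]
    refine ⟨⟨?_, ?_⟩, hp⟩
    · rw [Int.le_ediv_iff_mul_le hD']
      have : (R' : ℤ) * 1 ≤ R' * D := mul_le_mul_of_nonneg_left hD' (by positivity)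
      have : (R : ℤ) + 1 ≤ R' := by exact_mod_cast hR
      linarith
    · refine (Int.ediv_le_iff_le_mul hD').2 ?_
      have : (R' : ℤ) * 1 ≤ R' * D := mul_le_mul_of_nonneg_left hD' (by positivity)
      have : (R : ℤ) + 1 ≤ R' := by exact_mod_cast hR
      linarith
  · intro t ht
    have ht := (Finset.mem_filter.1 ht).2
    simp only [Finset.mem_filter]
    refine ⟨⟨ht, ?_⟩, trivial⟩
    rw [Int.mul_add_emod_self_left, Int.emod_eq_of_lt hr.1 hr.2]
  · rintro ⟨x, y'⟩ hp
    simp only [Finset.mem_filter] at hp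
    obtain ⟨⟨hp, rfl⟩, rfl⟩ := hp
    simp only [Int.mul_ediv_add_emod]
  · intro t _
    simp only
    rw [Int.mul_add_ediv_left _ _ hD'.ne', Int.ediv_eq_zero_of_lt hr.1 hr.2, add_zero]
  · rintro ⟨x, y'⟩ hp
    simp only [Finset.mem_filter] at hp
    obtain ⟨⟨hp, rfl⟩, rfl⟩ := hp
    simp only [Int.mul_ediv_add_emod]

set_option maxHeartbeats 1000000 in
/-- The row half of the two-dimensional inverse theorem. -/
lemma weyl_inverse_rows (C D : ℕ) (hC : 0 < C) (hD : 0 < D) :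
    ∃ k K : ℕ, 0 < k ∧ 0 < K ∧ ∀ M : ℕ, K ≤ M → ∀ (S : Finset (ℤ × ℤ))
      (c e₁ e₂ A B E : UnitAddCircle),
      (∀ p ∈ S, |p.1| ≤ C * M ∧ |p.2| ≤ C * M) →
      (∀ r y : ℤ, {t : ℤ | ((D : ℤ) * t + r, y) ∈ S}.OrdConnected) →
      (M : ℝ) ^ 2 ≤ C * ‖∑ p ∈ S, circleChar (quadPhase c e₁ e₂ A B E p.1 p.2)‖ →
      ‖k • A‖ * (M : ℝ) ^ 2 ≤ K ∧ ‖k • B‖ * (M : ℝ) ^ 2 ≤ K ∧ ‖k • e₁‖ * M ≤ K := by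
  -- Rows with a sum of at least M/(6C²D) are kept, and there are at least M/C₁ of them. The same C₁
  -- serves in the one-variable theorem on each row.
  set C₁ := 10 * C ^ 2 * D with hC₁
  obtain ⟨k₁, K₁, hk₁, hK₁, h₁⟩ := weyl_inverse C₁ (by positivity)
  obtain ⟨k₂, K₂, hk₂, hK₂, h₂⟩ := exists_norm_nsmul_of_recurrent (C₁ + 2 * K₁) (by positivity)
  refine ⟨k₂ * k₁ * D ^ 3, 3 * D ^ 2 * k₂ * K₁ + 2 * C * D ^ 2 * K₂ + K₁, by positivity,
    by positivity, fun M hM S c e₁ e₂ A B E hS hconn hsum => ?_⟩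
  have hKM₁ : K₁ ≤ M := by omega
  have hD2 : 1 ≤ D ^ 2 := Nat.one_le_pow _ _ hD
  have hKM₂ : K₂ ≤ M := by
    have : K₂ ≤ 2 * C * D ^ 2 * K₂ := Nat.le_mul_of_pos_left _ (by positivity)
    omega
  have hM0 : 0 < M := by omega
  have hMr : (1 : ℝ) ≤ M := by exact_mod_cast hM0
  have hCr : (1 : ℝ) ≤ C := by exact_mod_cast hC
  have hDr : (1 : ℝ) ≤ D := by exact_mod_cast hD
  set f : ℤ × ℤ → ℂ := fun p => circleChar (quadPhase c e₁ e₂ A B E p.1 p.2) with hf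
  set T : ℤ → ℤ → Finset ℤ := fun r y => (Finset.Icc (-((2 * C * M : ℕ) : ℤ)) (2 * C * M : ℕ)).filter
    (fun t => ((D : ℤ) * t + r, y) ∈ S) with hT
  set Y := Finset.Icc (-((C * M : ℕ) : ℤ)) (C * M : ℕ) with hY
  have hCM : 0 < C * M := by positivity
  have hdec := sum_eq_sum_rows (S := S) (D := D) (R := C * M) (R' := 2 * C * M) hD
    (by exact_mod_cast hS) (by rw [mul_assoc]; omega) f
  -- choose the residue class
  obtain ⟨r, hr, hrsum⟩ : ∃ r ∈ Finset.Ico (0 : ℤ) D,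
      (M : ℝ) ^ 2 / (C * D) ≤ ∑ y ∈ Y, ‖∑ t ∈ T r y, f (D * t + r, y)‖ := by
    refine Finset.exists_le_of_sum_le (by simpa using hD) ?_
    rw [Finset.sum_const, nsmul_eq_mul, Int.card_Ico, sub_zero, Int.toNat_natCast]
    have : (D : ℝ) * ((M : ℝ) ^ 2 / (C * D)) = M ^ 2 / C := by field_simp
    rw [this, div_le_iff₀' (by positivity)]
    refine hsum.trans (mul_le_mul_of_nonneg_left ?_ (by positivity))
    rw [hdec]
    exact (norm_sum_le _ _).trans (Finset.sum_le_sum fun _ _ => norm_sum_le _ _)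
  rw [Finset.mem_Ico] at hr
  have hYcard : (Y.card : ℝ) ≤ 3 * C * M := by
    rw [hY, card_Icc_neg_le]; push_cast; nlinarith
  have hTB : ∀ y ∈ Y, ‖∑ t ∈ T r y, f (D * t + r, y)‖ ≤ 5 * C * M := by
    intro y _
    refine (norm_sum_circleChar_le _ _).trans ?_
    have h1 : ((T r y).card : ℝ) ≤ 2 * ((2 * C * M : ℕ) : ℝ) + 1 := by
      rw [← card_Icc_neg_le]
      exact_mod_cast Finset.card_filter_le _ _
    push_cast at h1
    nlinarith
  set l : ℝ := M / (6 * C ^ 2 * D) with hl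
  have hlow := le_card_filter_mul_add Y _ hTB (l := l) (by positivity)
  set G := Y.filter fun y => l ≤ ‖∑ t ∈ T r y, f (D * t + r, y)‖ with hG
  have hGcard : (M : ℝ) ≤ C₁ * G.card := by
    have h1 : (M : ℝ) ^ 2 / (C * D) ≤ G.card * (5 * C * M) + 3 * C * M * l :=
      hrsum.trans (hlow.trans (by gcongr))
    have h2 : 3 * C * M * l = (M : ℝ) ^ 2 / (C * D) / 2 := by rw [hl]; field_simp; ring
    have h3 : (M : ℝ) ^ 2 / (C * D) ≤ 2 * (G.card * (5 * C * M)) := by linarith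
    rw [div_le_iff₀ (by positivity)] at h3
    have h4 : (M : ℝ) * M ≤ M * (C₁ * G.card) := by
      rw [hC₁]; push_cast; nlinarith
    exact le_of_mul_le_mul_left h4 (by linarith)
  -- At x = Dt + r the phase is quadratic in t with leading coefficient D²A and linear coefficient
  -- `b y`. The integer m collects what choose x 2 contributes to the linear term.
  set m : ℤ := D * r + Ring.choose (D : ℤ) 2 with hm
  set b : ℤ → UnitAddCircle := fun y => (D : ℤ) • e₁ + m • A + ((D : ℤ) * y) • B with hb
  have hrow : ∀ y ∈ G, ‖k₁ • ((D ^ 2 : ℤ) • A)‖ * (M : ℝ) ^ 2 ≤ K₁ ∧ ‖k₁ • b y‖ * M ≤ K₁ := by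
    intro y hy
    have hly := (Finset.mem_filter.1 hy).2
    refine h₁ M hKM₁ (T r y) ((D ^ 2 : ℤ) • A) (b y) (quadPhase c e₁ e₂ A B E r y) ?_ ?_ ?_
    · have : ((T r y : Finset ℤ) : Set ℤ) =
          Set.Icc (-((2 * C * M : ℕ) : ℤ)) (2 * C * M : ℕ) ∩ {t : ℤ | ((D : ℤ) * t + r, y) ∈ S} := by
        ext t; simp [hT]
      rw [this]
      exact Set.ordConnected_Icc.inter (hconn r y)
    · intro t ht
      have h3 := abs_le.2 (Finset.mem_Icc.1 (Finset.mem_filter.1 ht).1)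
      refine h3.trans ?_
      have : 2 * C * M ≤ C₁ * M := by
        refine Nat.mul_le_mul_right _ ?_
        rw [hC₁]; nlinarith
      exact_mod_cast this
    · have heq : ∀ t ∈ T r y, circleChar (quadPhase c e₁ e₂ A B E r y + t • b y +
          Ring.choose t 2 • ((D ^ 2 : ℤ) • A)) = f (D * t + r, y) := by
        intro t _
        simp only [hf, hb, hm]
        congr 1
        unfold quadPhase
        rw [choose_two_add, choose_two_mul]
        module
      rw [Finset.sum_congr rfl heq]
      have h4 : (M : ℝ) = 6 * C ^ 2 * D * l := by rw [hl]; field_simp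
      have h5 : (0 : ℝ) ≤ ‖∑ t ∈ T r y, f (D * t + r, y)‖ := norm_nonneg _
      calc (M : ℝ) = 6 * C ^ 2 * D * l := h4
        _ ≤ 6 * C ^ 2 * D * ‖∑ t ∈ T r y, f (D * t + r, y)‖ := by gcongr
        _ ≤ _ := by
          gcongr
          rw [hC₁]; push_cast; gcongr; norm_num
  obtain ⟨y₀, hy₀⟩ : G.Nonempty := by
    rw [← Finset.card_pos]
    by_contra h
    have : G.card = 0 := by omega
    rw [this] at hGcard
    simp at hGcard; linarith
  have hYabs : ∀ y ∈ G, |y| ≤ C * M := fun y hy => by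
    have := abs_le.2 (Finset.mem_Icc.1 (Finset.mem_filter.1 hy).1)
    exact_mod_cast this
  -- The linear coefficients of two good rows differ by (y - y₀)DB. Both are O(1/M) after
  -- multiplication by k₁, so k₁DB is recurrent along the differences y - y₀ and is therefore
  -- controlled to order M⁻².
  have hB := h₂ M hKM₂ (G.image fun y => y - y₀) (k₁ • ((D : ℤ) • B)) (by
      intro n hn
      obtain ⟨y, hy, rfl⟩ := Finset.mem_image.1 hn
      have h3 := abs_sub y y₀
      have h4 := hYabs y hy
      have h5 := hYabs y₀ hy₀
      have : 2 * C * M ≤ (C₁ + 2 * K₁) * M := by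
        refine Nat.mul_le_mul_right _ ?_
        rw [hC₁]; nlinarith
      have : (2 * C * M : ℤ) ≤ ((C₁ + 2 * K₁ : ℕ) : ℤ) * M := by exact_mod_cast this
      linarith) (by
      rw [Finset.card_image_of_injective _ (sub_left_injective)]
      have : M ≤ C₁ * G.card := by exact_mod_cast hGcard
      nlinarith) (by
      intro n hn
      obtain ⟨y, hy, rfl⟩ := Finset.mem_image.1 hn
      have heq : (y - y₀) • (k₁ • ((D : ℤ) • B)) = k₁ • b y - k₁ • b y₀ := by
        simp only [hb]; module
      rw [heq]
      have h3 := (hrow y hy).2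
      have h4 := (hrow y₀ hy₀).2
      have h5 := norm_sub_le (k₁ • b y) (k₁ • b y₀)
      push_cast
      have : (0 : ℝ) ≤ C₁ := by positivity
      nlinarith)
  obtain ⟨hA, hb₀⟩ := hrow y₀ hy₀
  have hT2 : (0 : ℝ) ≤ (M : ℝ) ^ 2 := by positivity
  have hMM : (M : ℝ) ≤ M ^ 2 := by nlinarith
  have hK₁r : (0 : ℝ) ≤ K₁ := by positivity
  have hK₂r : (0 : ℝ) ≤ K₂ := by positivity
  have hk₂r : (1 : ℝ) ≤ k₂ := by exact_mod_cast hk₂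
  have hD2r : (1 : ℝ) ≤ (D : ℝ) ^ 2 := by exact_mod_cast hD2
  have hDD : (D : ℝ) ≤ (D : ℝ) ^ 2 := by nlinarith
  push_cast
  refine ⟨?_, ?_, ?_⟩
  · have heq : (k₂ * k₁ * D ^ 3) • A = ((k₂ * D : ℕ) : ℤ) • (k₁ • ((D ^ 2 : ℤ) • A)) := by
      module
    rw [heq]
    refine (norm_zsmul_mul_le (N := k₂ * D) (by simp) hT2 hA).trans ?_
    have : (k₂ : ℝ) * D * K₁ ≤ k₂ * D ^ 2 * K₁ := by gcongr
    have : (0 : ℝ) ≤ k₂ * D ^ 2 * K₁ := by positivity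
    have : (0 : ℝ) ≤ 2 * C * D ^ 2 * K₂ := by positivity
    linarith
  · have heq : (k₂ * k₁ * D ^ 3) • B = ((D ^ 2 : ℕ) : ℤ) • (k₂ • (k₁ • ((D : ℤ) • B))) := by
      module
    rw [heq]
    refine (norm_zsmul_mul_le (N := D ^ 2) (by simp) hT2 hB).trans ?_
    have : (0 : ℝ) ≤ 3 * D ^ 2 * k₂ * K₁ := by positivity
    have : 1 * (D : ℝ) ^ 2 * K₂ ≤ (2 * C) * D ^ 2 * K₂ := by gcongr; linarith
    linarith
  -- One row determines e₁: its A and B terms can be subtracted, the multiplier y₀ = O(M) being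
  -- absorbed by the M⁻² control of B.
  · have heq : (k₂ * k₁ * D ^ 3) • e₁ = ((k₂ * D ^ 2 : ℕ) : ℤ) • (k₁ • b y₀) -
        (m * k₂) • (k₁ • ((D ^ 2 : ℤ) • A)) - (y₀ * (D ^ 2 : ℕ)) • (k₂ • (k₁ • ((D : ℤ) • B))) := by
      simp only [hb]; module
    rw [heq]
    have hmle : |((m * k₂ : ℤ) : ℝ)| ≤ 2 * D ^ 2 * k₂ := by
      push_cast
      rw [abs_mul, abs_of_nonneg (by positivity : (0 : ℝ) ≤ k₂)]
      gcongr
      have hch := congrArg (Int.cast : ℤ → ℝ) (two_mul_choose_two (D : ℤ))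
      push_cast at hch
      have hr0 : (0 : ℝ) ≤ r := by exact_mod_cast hr.1
      have hr1 : (r : ℝ) ≤ D := by exact_mod_cast hr.2.le
      rw [hm]; push_cast
      rw [abs_of_nonneg (by nlinarith)]
      nlinarith
    have hyle : |((y₀ * (D ^ 2 : ℕ) : ℤ) : ℝ)| ≤ C * M * D ^ 2 := by
      push_cast
      rw [abs_mul, abs_of_nonneg (by positivity : (0 : ℝ) ≤ (D : ℝ) ^ 2)]
      gcongr
      rw [← Int.cast_abs]; exact_mod_cast hYabs y₀ hy₀
    have g1 := norm_zsmul_mul_le (n := ((k₂ * D ^ 2 : ℕ) : ℤ)) (N := k₂ * D ^ 2) (by simp)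
      (by linarith : (0 : ℝ) ≤ M) hb₀
    have g2 := norm_zsmul_mul_le hmle hT2 hA
    have g3 := norm_zsmul_mul_le hyle hT2 hB
    have g3' : ‖(y₀ * (D ^ 2 : ℕ)) • (k₂ • (k₁ • ((D : ℤ) • B)))‖ * M ≤ C * D ^ 2 * K₂ := by
      have : M * (‖(y₀ * (D ^ 2 : ℕ)) • (k₂ • (k₁ • ((D : ℤ) • B)))‖ * M) ≤
          M * (C * D ^ 2 * K₂) := by linarith
      exact le_of_mul_le_mul_left this (by linarith)
    have g2' : ‖(m * k₂) • (k₁ • ((D ^ 2 : ℤ) • A))‖ * M ≤ 2 * D ^ 2 * k₂ * K₁ := by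
      refine le_trans ?_ g2; gcongr
    have t1 := norm_sub_le (((k₂ * D ^ 2 : ℕ) : ℤ) • (k₁ • b y₀) -
        (m * k₂) • (k₁ • ((D ^ 2 : ℤ) • A))) ((y₀ * (D ^ 2 : ℕ)) • (k₂ • (k₁ • ((D : ℤ) • B))))
    have t2 := norm_sub_le (((k₂ * D ^ 2 : ℕ) : ℤ) • (k₁ • b y₀))
        ((m * k₂) • (k₁ • ((D ^ 2 : ℤ) • A)))
    refine (mul_le_mul_of_nonneg_right (t1.trans (add_le_add_left t2 _)) (by linarith)).trans ?_
    have : (0 : ℝ) ≤ C * D ^ 2 * K₂ := by positivity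
    rw [add_mul, add_mul]
    linarith

lemma norm_nsmul_nsmul_mul_le {m n : ℕ} {θ : UnitAddCircle} {T K : ℝ} (hT : 0 ≤ T)
    (h : ‖n • θ‖ * T ≤ K) : ‖(m * n) • θ‖ * T ≤ m * K := by
  have := norm_zsmul_mul_le (n := (m : ℤ)) (N := m) (by simp) hT h
  rwa [natCast_zsmul, ← mul_smul] at this

/-- A two-dimensional inverse theorem of Weyl type: if a quadratic exponential sum over a set
whose rows and columns are unions of progressions of common difference `D` is large, then all
non-constant coefficients are close to rationals of bounded denominator. -/
lemma weyl_inverse_planar (C D : ℕ) (hC : 0 < C) (hD : 0 < D) :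
    ∃ k K : ℕ, 0 < k ∧ 0 < K ∧ ∀ M : ℕ, K ≤ M → ∀ (S : Finset (ℤ × ℤ))
      (c e₁ e₂ A B E : UnitAddCircle),
      (∀ p ∈ S, |p.1| ≤ C * M ∧ |p.2| ≤ C * M) →
      (∀ r y : ℤ, {t : ℤ | ((D : ℤ) * t + r, y) ∈ S}.OrdConnected) →
      (∀ r x : ℤ, {t : ℤ | (x, (D : ℤ) * t + r) ∈ S}.OrdConnected) →
      (M : ℝ) ^ 2 ≤ C * ‖∑ p ∈ S, circleChar (quadPhase c e₁ e₂ A B E p.1 p.2)‖ →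
      ‖k • A‖ * (M : ℝ) ^ 2 ≤ K ∧ ‖k • B‖ * (M : ℝ) ^ 2 ≤ K ∧ ‖k • E‖ * (M : ℝ) ^ 2 ≤ K ∧
        ‖k • e₁‖ * M ≤ K ∧ ‖k • e₂‖ * M ≤ K := by
  obtain ⟨k, K, hk, hK, h⟩ := weyl_inverse_rows C D hC hD
  refine ⟨k, K, hk, hK, fun M hM S c e₁ e₂ A B E hS hrow hcol hsum => ?_⟩
  obtain ⟨hA, hB, h₁⟩ := h M hM S c e₁ e₂ A B E hS hrow hsum
  have hmem : ∀ x y : ℤ, (x, y) ∈ S.image Prod.swap ↔ (y, x) ∈ S := fun x y => by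
    rw [Finset.mem_image]
    exact ⟨fun ⟨p, hp, he⟩ => by obtain ⟨rfl, rfl⟩ := Prod.mk.inj he; exact hp,
      fun hp => ⟨_, hp, rfl⟩⟩
  -- Columns are the rows of the transposed set, which gives the coefficients of the second
  -- variable.
  obtain ⟨hE, -, h₂⟩ := h M hM (S.image Prod.swap) c e₂ e₁ E B A
    (by rintro ⟨x, y⟩ hp; exact (hS _ ((hmem x y).1 hp)).symm)
    (by intro r y; simp only [hmem]; exact hcol r y)
    (by
      rw [Finset.sum_image (fun _ _ _ _ he => Prod.swap_injective he)]
      refine hsum.trans (le_of_eq ?_)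
      congr 2
      exact Finset.sum_congr rfl fun p _ => by rw [quadPhase_swap]; rfl)
  exact ⟨hA, hB, hE, h₁, h₂⟩

/-! ### Dilation of phases by Gaussian integers -/

/-- The composition of a quadratic phase with `z ↦ β + π z`, where `π = a + b i`. -/
lemma quadPhase_comp (c e₁ e₂ A B E : UnitAddCircle) (a b u v x y : ℤ) :
    quadPhase c e₁ e₂ A B E (u + (a * x - b * y)) (v + (b * x + a * y)) =
      quadPhase (quadPhase c e₁ e₂ A B E u v)
        (a • e₁ + b • e₂ + (Ring.choose a 2 + u * a) • A + (a * b + u * b + v * a) • B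
          + (Ring.choose b 2 + v * b) • E)
        (-b • e₁ + a • e₂ + (Ring.choose (-b) 2 - u * b) • A + (-(a * b) + u * a - v * b) • B
          + (Ring.choose a 2 + v * a) • E)
        (a ^ 2 • A + (2 * a * b) • B + b ^ 2 • E)
        (-(a * b) • A + (a ^ 2 - b ^ 2) • B + (a * b) • E)
        (b ^ 2 • A + -(2 * a * b) • B + a ^ 2 • E) x y := by
  have h1 : a * x - b * y = a * x + (-b) * y := by ring
  have h2 : (u + (a * x - b * y)) * (v + (b * x + a * y)) = u * v + u * (b * x + a * y) +
      v * (a * x - b * y) + a * b * (2 * Ring.choose x 2 + x) + (a ^ 2 - b ^ 2) * (x * y)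
      - a * b * (2 * Ring.choose y 2 + y) := by
    rw [two_mul_choose_two, two_mul_choose_two]; ring
  unfold quadPhase
  rw [h2, h1]
  simp only [choose_two_add, choose_two_mul]
  module

lemma quadPhase_sub (c e₁ e₂ A B E c' e₁' e₂' A' B' E' : UnitAddCircle) (x y : ℤ) :
    quadPhase c e₁ e₂ A B E x y - quadPhase c' e₁' e₂' A' B' E' x y =
      quadPhase (c - c') (e₁ - e₁') (e₂ - e₂') (A - A') (B - B') (E - E') x y := by
  unfold quadPhase; module

lemma norm_three_zsmul_le {x y z : ℤ} {α β γ : UnitAddCircle} {X T K : ℝ} (hT : 0 ≤ T)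
    (hx : |(x : ℝ)| ≤ X) (hy : |(y : ℝ)| ≤ X) (hz : |(z : ℝ)| ≤ X)
    (hα : ‖α‖ * T ≤ K) (hβ : ‖β‖ * T ≤ K) (hγ : ‖γ‖ * T ≤ K) :
    ‖x • α + y • β + z • γ‖ * T ≤ 3 * X * K := by
  have h1 := norm_zsmul_mul_le hx hT hα
  have h2 := norm_zsmul_mul_le hy hT hβ
  have h3 := norm_zsmul_mul_le hz hT hγ
  calc _ ≤ (‖x • α‖ + ‖y • β‖ + ‖z • γ‖) * T := by gcongr; exact norm_add₃_le
    _ = ‖x • α‖ * T + ‖y • β‖ * T + ‖z • γ‖ * T := by ring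
    _ ≤ _ := by linarith

set_option maxHeartbeats 1000000 in
/-- The coefficients of `φ` are controlled by those of `z ↦ φ (β + π z) - φ (β + π' z)` when
`π` and `π'` have different norms. -/
lemma coeffs_of_coeffs_sub_comp (a b a' b' : ℤ) (hne : a ^ 2 + b ^ 2 ≠ a' ^ 2 + b' ^ 2)
    (k K : ℕ) (hk : 0 < k) :
    ∃ n L : ℕ, 0 < n ∧ 0 < L ∧ ∀ M : ℕ, 0 < M → ∀ (u v : ℤ), |u| ≤ M → |v| ≤ M →
      ∀ (e₁ e₂ A B E f₁ f₂ A₁ B₁ E₁ : UnitAddCircle),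
      f₁ = (a • e₁ + b • e₂ + (Ring.choose a 2 + u * a) • A + (a * b + u * b + v * a) • B
          + (Ring.choose b 2 + v * b) • E) - (a' • e₁ + b' • e₂ + (Ring.choose a' 2 + u * a') • A
          + (a' * b' + u * b' + v * a') • B + (Ring.choose b' 2 + v * b') • E) →
      f₂ = (-b • e₁ + a • e₂ + (Ring.choose (-b) 2 - u * b) • A + (-(a * b) + u * a - v * b) • B
          + (Ring.choose a 2 + v * a) • E) - (-b' • e₁ + a' • e₂ + (Ring.choose (-b') 2 - u * b') • A
          + (-(a' * b') + u * a' - v * b') • B + (Ring.choose a' 2 + v * a') • E) →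
      A₁ = (a ^ 2 • A + (2 * a * b) • B + b ^ 2 • E) -
        (a' ^ 2 • A + (2 * a' * b') • B + b' ^ 2 • E) →
      B₁ = (-(a * b) • A + (a ^ 2 - b ^ 2) • B + (a * b) • E) -
        (-(a' * b') • A + (a' ^ 2 - b' ^ 2) • B + (a' * b') • E) →
      E₁ = (b ^ 2 • A + -(2 * a * b) • B + a ^ 2 • E) -
        (b' ^ 2 • A + -(2 * a' * b') • B + a' ^ 2 • E) →
      ‖k • A₁‖ * (M : ℝ) ^ 2 ≤ K → ‖k • B₁‖ * (M : ℝ) ^ 2 ≤ K → ‖k • E₁‖ * (M : ℝ) ^ 2 ≤ K →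
      ‖k • f₁‖ * M ≤ K → ‖k • f₂‖ * M ≤ K →
      ‖n • A‖ * (M : ℝ) ^ 2 ≤ L ∧ ‖n • B‖ * (M : ℝ) ^ 2 ≤ L ∧ ‖n • E‖ * (M : ℝ) ^ 2 ≤ L ∧
        ‖n • e₁‖ * M ≤ L ∧ ‖n • e₂‖ * M ≤ L := by
  have sum_le : ∀ x₁ x₂ x₃ x₄ x₅ : ℕ, x₁ ≤ x₁ + x₂ + x₃ + x₄ + x₅ ∧ x₂ ≤ x₁ + x₂ + x₃ + x₄ + x₅ ∧
      x₃ ≤ x₁ + x₂ + x₃ + x₄ + x₅ ∧ x₄ ≤ x₁ + x₂ + x₃ + x₄ + x₅ ∧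
      x₅ ≤ x₁ + x₂ + x₃ + x₄ + x₅ := by
    intro x₁ x₂ x₃ x₄ x₅; omega
  have sum_le' : ∀ x₁ x₂ x₃ x₄ x₅ x₆ x₇ x₈ n₁ n₂ n₃ n₄ d₁ d₂ : ℕ, d₁ ≤ n₁ + n₃ → d₂ ≤ n₂ + n₄ →
      x₁ + x₅ + (d₁ + 0) ≤ x₁ + x₂ + x₃ + x₄ + x₅ + x₆ + x₇ + x₈ + 2 * (n₁ + n₂ + n₃ + n₄) ∧
      x₁ + x₅ + (0 + d₁) ≤ x₁ + x₂ + x₃ + x₄ + x₅ + x₆ + x₇ + x₈ + 2 * (n₁ + n₂ + n₃ + n₄) ∧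
      x₂ + x₆ + (0 + d₂) ≤ x₁ + x₂ + x₃ + x₄ + x₅ + x₆ + x₇ + x₈ + 2 * (n₁ + n₂ + n₃ + n₄) ∧
      x₃ + x₇ + (d₂ + 0) ≤ x₁ + x₂ + x₃ + x₄ + x₅ + x₆ + x₇ + x₈ + 2 * (n₁ + n₂ + n₃ + n₄) ∧
      x₄ + x₈ + (d₂ + d₁) ≤ x₁ + x₂ + x₃ + x₄ + x₅ + x₆ + x₇ + x₈ + 2 * (n₁ + n₂ + n₃ + n₄) ∧
      x₈ + x₄ + (d₁ + d₂) ≤ x₁ + x₂ + x₃ + x₄ + x₅ + x₆ + x₇ + x₈ + 2 * (n₁ + n₂ + n₃ + n₄) := by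
    intros; omega
  -- Write π = a + bi and π' = a' + b'i. Passing to the difference multiplies A + E by N = |π|² -
  -- |π'|², and acts on (A - E, 2B) as a rotation-dilation by U + iV = π² - π'², up to conjugation,
  -- with determinant W. On (e₁, e₂), up to contributions of A, B and E, it acts through π - π',
  -- with determinant P. The denominators needed for the inverse are thus q = 2WN and P.
  obtain ⟨N, hN⟩ : ∃ z : ℤ, z = a ^ 2 + b ^ 2 - (a' ^ 2 + b' ^ 2) := ⟨_, rfl⟩
  obtain ⟨U, hU⟩ : ∃ z : ℤ, z = a ^ 2 - b ^ 2 - (a' ^ 2 - b' ^ 2) := ⟨_, rfl⟩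
  obtain ⟨V, hV⟩ : ∃ z : ℤ, z = 2 * (a * b - a' * b') := ⟨_, rfl⟩
  obtain ⟨W, hW⟩ : ∃ z : ℤ, z = U ^ 2 + V ^ 2 := ⟨_, rfl⟩
  obtain ⟨P, hP⟩ : ∃ z : ℤ, z = (a - a') ^ 2 + (b - b') ^ 2 := ⟨_, rfl⟩
  have hN0 : N ≠ 0 := by rw [hN]; exact sub_ne_zero.2 hne
  have hW0 : W ≠ 0 := by
    intro h
    have hU0 : U = 0 := by nlinarith [sq_nonneg U, sq_nonneg V]
    have hV0 : V = 0 := by nlinarith [sq_nonneg U, sq_nonneg V]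
    -- The left side is |π|⁴ - |π'|⁴ = Re((π² - π'²) conj(π² + π'²)), so π² = π'² would force equal
    -- norms.
    have : N * (a ^ 2 + b ^ 2 + (a' ^ 2 + b' ^ 2)) = 0 := by
      have e1 : N * (a ^ 2 + b ^ 2 + (a' ^ 2 + b' ^ 2)) =
        U * (a ^ 2 - b ^ 2 + (a' ^ 2 - b' ^ 2)) + V * (2 * (a * b + a' * b')) := by
        rw [hN, hU, hV]; ring
      rw [e1, hU0, hV0]; ring
    rcases mul_eq_zero.1 this with h | h
    · exact hN0 h
    · refine hN0 ?_
      have := sq_nonneg a; have := sq_nonneg b; have := sq_nonneg a'; have := sq_nonneg b'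
      rw [hN]; linarith
  have hP0 : P ≠ 0 := by
    intro h
    have h1 : a - a' = 0 := by nlinarith [sq_nonneg (a - a'), sq_nonneg (b - b')]
    have h2 : b - b' = 0 := by nlinarith [sq_nonneg (a - a'), sq_nonneg (b - b')]
    refine hN0 ?_
    rw [hN, sub_eq_zero.1 h1, sub_eq_zero.1 h2]; ring
  obtain ⟨q, hq⟩ : ∃ z : ℤ, z = 2 * W * N := ⟨_, rfl⟩
  have hq0 : q ≠ 0 := by rw [hq]; positivity
  obtain ⟨X, hX⟩ : ∃ z : ℕ, z = (W + N * U).natAbs + (2 * N * V).natAbs + (W - N * U).natAbs + (N * V).natAbs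
    + (2 * N * U).natAbs := ⟨_, rfl⟩
  obtain ⟨Y, hY⟩ : ∃ z : ℕ, z = (Ring.choose a 2).natAbs + (Ring.choose b 2).natAbs + (Ring.choose (-b) 2).natAbs +
    (a * b).natAbs + (Ring.choose a' 2).natAbs + (Ring.choose b' 2).natAbs +
    (Ring.choose (-b') 2).natAbs + (a' * b').natAbs + 2 * (a.natAbs + b.natAbs + a'.natAbs + b'.natAbs)
    := ⟨_, rfl⟩
  obtain ⟨hX1, hX2, hX3, hX4, hX5⟩ := sum_le (W + N * U).natAbs (2 * N * V).natAbs
    (W - N * U).natAbs (N * V).natAbs (2 * N * U).natAbs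
  rw [← hX] at hX1 hX2 hX3 hX4 hX5
  obtain ⟨hY1, hY2, hY3, hY4, hY5, hY6⟩ := sum_le' (Ring.choose a 2).natAbs (Ring.choose b 2).natAbs
    (Ring.choose (-b) 2).natAbs (a * b).natAbs (Ring.choose a' 2).natAbs (Ring.choose b' 2).natAbs
    (Ring.choose (-b') 2).natAbs (a' * b').natAbs a.natAbs b.natAbs a'.natAbs b'.natAbs
    (a - a').natAbs (b - b').natAbs (Int.natAbs_sub_le _ _) (Int.natAbs_sub_le _ _)
  rw [← hY] at hY1 hY2 hY3 hY4 hY5 hY6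
  have hbb : (b' - b).natAbs = (b - b').natAbs := by rw [← Int.natAbs_neg, neg_sub]
  obtain ⟨Z, hZ⟩ : ∃ z : ℕ, z = (a - a').natAbs + (b - b').natAbs := ⟨_, rfl⟩
  obtain ⟨L₁, hL₁⟩ : ∃ z : ℕ, z = 3 * X * K := ⟨_, rfl⟩
  refine ⟨P.natAbs * (q.natAbs * k), P.natAbs * L₁ + 2 * Z * (q.natAbs * K + 3 * Y * L₁) + 1,
    by positivity, by positivity, ?_⟩
  intro M hM u v hu hv e₁ e₂ A B E f₁ f₂ A₁ B₁ E₁ hf₁ hf₂ hA₁ hB₁ hE₁ kA kB kE kf₁ kf₂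
  have hMr : (1 : ℝ) ≤ M := by exact_mod_cast hM
  have hT2 : (0 : ℝ) ≤ (M : ℝ) ^ 2 := by positivity
  have hM0 : (0 : ℝ) ≤ M := by linarith
  have natAbs_le : ∀ (z : ℤ) (m : ℕ), z.natAbs ≤ m → |(z : ℝ)| ≤ m := fun z m h => by
    have : |(z : ℝ)| = (z.natAbs : ℝ) := by simp
    rw [this]; exact_mod_cast h
  have norm_natAbs : ∀ (z : ℤ) (θ : UnitAddCircle), ‖z.natAbs • θ‖ = ‖z • θ‖ := fun z θ => by
    rcases Int.natAbs_eq z with h | h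
    · conv_rhs => rw [h]
      rw [natCast_zsmul]
    · conv_rhs => rw [h]
      rw [neg_smul, norm_neg, natCast_zsmul]
  have keyA : ‖q • (k • A)‖ * (M : ℝ) ^ 2 ≤ L₁ := by
    have : q • (k • A) = (W + N * U) • (k • A₁) + (-(2 * N * V)) • (k • B₁)
        + (W - N * U) • (k • E₁) := by
      rw [hA₁, hB₁, hE₁, hq, hW, hN, hU, hV]; module
    rw [this, hL₁]; push_cast
    exact norm_three_zsmul_le hT2 (natAbs_le _ X hX1) (natAbs_le _ X (by rwa [Int.natAbs_neg]))
      (natAbs_le _ X hX3) kA kB kE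
  have keyE : ‖q • (k • E)‖ * (M : ℝ) ^ 2 ≤ L₁ := by
    have : q • (k • E) = (W - N * U) • (k • A₁) + (2 * N * V) • (k • B₁)
        + (W + N * U) • (k • E₁) := by
      rw [hA₁, hB₁, hE₁, hq, hW, hN, hU, hV]; module
    rw [this, hL₁]; push_cast
    exact norm_three_zsmul_le hT2 (natAbs_le _ X hX3) (natAbs_le _ X hX2)
      (natAbs_le _ X hX1) kA kB kE
  have keyB : ‖q • (k • B)‖ * (M : ℝ) ^ 2 ≤ L₁ := by
    have : q • (k • B) = (N * V) • (k • A₁) + (2 * N * U) • (k • B₁)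
        + (-(N * V)) • (k • E₁) := by
      rw [hA₁, hB₁, hE₁, hq, hW, hN, hU, hV]; module
    rw [this, hL₁]; push_cast
    exact norm_three_zsmul_le hT2 (natAbs_le _ X hX4) (natAbs_le _ X hX5)
      (natAbs_le _ X (by rwa [Int.natAbs_neg])) kA kB kE
  -- the contribution of the quadratic coefficients to the linear ones
  have stuff : ∀ x y z : ℤ, |x| ≤ Y * M → |y| ≤ Y * M → |z| ≤ Y * M →
      ‖x • (q • (k • A)) + y • (q • (k • B)) + z • (q • (k • E))‖ * M ≤ 3 * Y * L₁ := by
    intro x y z hx hy hz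
    have cast_le : ∀ w : ℤ, |w| ≤ Y * M → |(w : ℝ)| ≤ Y * M := fun w hw => by
      rw [← Int.cast_abs]; exact_mod_cast hw
    have := norm_three_zsmul_le hT2 (cast_le x hx) (cast_le y hy) (cast_le z hz) keyA keyB keyE
    have h2 : M * (‖x • (q • (k • A)) + y • (q • (k • B)) + z • (q • (k • E))‖ * M) ≤
        M * (3 * Y * L₁) := by linarith
    exact le_of_mul_le_mul_left h2 (by linarith)
  have hM1 : (1 : ℤ) ≤ M := by exact_mod_cast hM
  have coef_le : ∀ x y s t : ℤ, x.natAbs + y.natAbs + (s.natAbs + t.natAbs) ≤ Y →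
      |x - y + u * s + v * t| ≤ Y * M := by
    intro x y s t h
    have h1 : |x| + |y| + (|s| + |t|) ≤ Y := by
      have : ((x.natAbs + y.natAbs + (s.natAbs + t.natAbs) : ℕ) : ℤ) ≤ Y := by exact_mod_cast h
      push_cast at this
      simpa only [Int.natCast_natAbs] using this
    calc |x - y + u * s + v * t| ≤ |x| + |y| + |u| * |s| + |v| * |t| := by
          rw [← abs_mul, ← abs_mul]
          linarith [abs_add_le (x - y + u * s) (v * t), abs_add_le (x - y) (u * s), abs_sub x y]
      _ ≤ |x| * M + |y| * M + M * |s| + M * |t| := by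
          gcongr
          · exact le_mul_of_one_le_right (abs_nonneg _) hM1
          · exact le_mul_of_one_le_right (abs_nonneg _) hM1
      _ = (|x| + |y| + (|s| + |t|)) * M := by ring
      _ ≤ _ := by gcongr
  have lin₁ : ‖q • (k • ((a - a') • e₁ + (b - b') • e₂))‖ * M ≤ q.natAbs * K + 3 * Y * L₁ := by
    have heq : q • (k • ((a - a') • e₁ + (b - b') • e₂)) = q • (k • f₁) -
        ((Ring.choose a 2 - Ring.choose a' 2 + u * (a - a') + v * 0) • (q • (k • A)) +
        (a * b - a' * b' + u * (b - b') + v * (a - a')) • (q • (k • B)) +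
        (Ring.choose b 2 - Ring.choose b' 2 + u * 0 + v * (b - b')) • (q • (k • E))) := by
      rw [hf₁]; module
    have h1 := stuff _ _ _ (coef_le (Ring.choose a 2) (Ring.choose a' 2) (a - a') 0 hY1)
      (coef_le (a * b) (a' * b') (b - b') (a - a') hY5)
      (coef_le (Ring.choose b 2) (Ring.choose b' 2) 0 (b - b') hY3)
    have h2 := norm_zsmul_mul_le (natAbs_le q _ le_rfl) hM0 kf₁
    rw [heq]
    refine (mul_le_mul_of_nonneg_right (norm_sub_le _ _) hM0).trans ?_
    rw [add_mul]
    exact add_le_add h2 h1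
  have lin₂ : ‖q • (k • (-(b - b') • e₁ + (a - a') • e₂))‖ * M ≤ q.natAbs * K + 3 * Y * L₁ := by
    have heq : q • (k • (-(b - b') • e₁ + (a - a') • e₂)) = q • (k • f₂) -
        ((Ring.choose (-b) 2 - Ring.choose (-b') 2 + u * (b' - b) + v * 0) • (q • (k • A)) +
        (a' * b' - a * b + u * (a - a') + v * (b' - b)) • (q • (k • B)) +
        (Ring.choose a 2 - Ring.choose a' 2 + u * 0 + v * (a - a')) • (q • (k • E))) := by
      rw [hf₂]; module
    have h1 := stuff _ _ _
      (coef_le (Ring.choose (-b) 2) (Ring.choose (-b') 2) (b' - b) 0 (by rw [hbb]; exact hY4))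
      (coef_le (a' * b') (a * b) (a - a') (b' - b) (by rw [hbb]; exact hY6))
      (coef_le (Ring.choose a 2) (Ring.choose a' 2) 0 (a - a') hY2)
    have h2 := norm_zsmul_mul_le (natAbs_le q _ le_rfl) hM0 kf₂
    rw [heq]
    refine (mul_le_mul_of_nonneg_right (norm_sub_le _ _) hM0).trans ?_
    rw [add_mul]
    exact add_le_add h2 h1
  have hPnn : (0 : ℝ) ≤ P.natAbs * L₁ := by positivity
  have hZnn : (0 : ℝ) ≤ 2 * Z * (q.natAbs * K + 3 * Y * L₁) := by positivity
  have quadfin : ∀ θ : UnitAddCircle, ‖q • (k • θ)‖ * (M : ℝ) ^ 2 ≤ L₁ →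
      ‖(P.natAbs * (q.natAbs * k)) • θ‖ * (M : ℝ) ^ 2 ≤
        P.natAbs * L₁ + 2 * Z * (q.natAbs * K + 3 * Y * L₁) + 1 := by
    intro θ h
    rw [← norm_natAbs, ← mul_smul] at h
    have := norm_nsmul_nsmul_mul_le (m := P.natAbs) hT2 h
    linarith
  have linfin : ∀ (θ : UnitAddCircle) (x y : ℤ), x.natAbs ≤ Z → y.natAbs ≤ Z →
      P • θ = x • ((a - a') • e₁ + (b - b') • e₂) + y • (-(b - b') • e₁ + (a - a') • e₂) →
      ‖(P.natAbs * (q.natAbs * k)) • θ‖ * (M : ℝ) ≤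
        P.natAbs * L₁ + 2 * Z * (q.natAbs * K + 3 * Y * L₁) + 1 := by
    intro θ x y hx hy h
    have e1 : ‖(P.natAbs * (q.natAbs * k)) • θ‖ = ‖q • (k • (P • θ))‖ := by
      rw [mul_smul, norm_natAbs, mul_smul]
      rw [smul_comm P, norm_natAbs, smul_comm P k]
    have e2 : q • (k • (P • θ)) = x • (q • (k • ((a - a') • e₁ + (b - b') • e₂))) +
        y • (q • (k • (-(b - b') • e₁ + (a - a') • e₂))) := by
      rw [h]; module
    have h1 := norm_zsmul_mul_le (natAbs_le x _ hx) hM0 lin₁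
    have h2 := norm_zsmul_mul_le (natAbs_le y _ hy) hM0 lin₂
    rw [e1, e2]
    refine (mul_le_mul_of_nonneg_right (norm_add_le _ _) hM0).trans ?_
    rw [add_mul]
    linarith
  push_cast
  refine ⟨?_, ?_, ?_, ?_, ?_⟩
  · simpa using quadfin A keyA
  · simpa using quadfin B keyB
  · simpa using quadfin E keyE
  · simpa using linfin e₁ (a - a') (-(b - b')) (by rw [hZ]; exact Nat.le_add_right _ _)
      (by rw [hZ, Int.natAbs_neg]; exact Nat.le_add_left _ _) (by rw [hP]; module)
  · simpa using linfin e₂ (b - b') (a - a') (by rw [hZ]; exact Nat.le_add_left _ _)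
      (by rw [hZ]; exact Nat.le_add_right _ _) (by rw [hP]; module)

/-! ### Equidistributed phases along two dilates -/

/-- All sums of the phase `f` over products of progressions in `[M]` are at most `σ M²`. -/
def PhaseEquidistributed (M : ℕ) (σ : ℝ) (f : ℤ → ℤ → UnitAddCircle) : Prop :=
  ∀ P₁ P₂ : Finset ℤ, IsProgressionIn M P₁ → IsProgressionIn M P₂ →
    ‖∑ p ∈ P₁ ×ˢ P₂, circleChar (f p.1 p.2)‖ ≤ σ * (M : ℝ) ^ 2

/-- A quadratic phase is almost constant along short progressions of step `2n` if its
coefficients are close to rationals of denominator `n`. -/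
lemma norm_quadPhase_sub_le {n L M J : ℕ} {c e₁ e₂ A B E : UnitAddCircle} (hn : 0 < n)
    (hM : 0 < M)
    (hA : ‖n • A‖ * (M : ℝ) ^ 2 ≤ L) (hB : ‖n • B‖ * (M : ℝ) ^ 2 ≤ L)
    (hE : ‖n • E‖ * (M : ℝ) ^ 2 ≤ L) (h₁ : ‖n • e₁‖ * M ≤ L) (h₂ : ‖n • e₂‖ * M ≤ L)
    (hJ : J * (500 * n * L) ≤ M) {i j : ℕ} (hi : i < J) (hj : j < J) (hL : 0 < L) :
    7 * ‖quadPhase c e₁ e₂ A B E (1 + (2 * n : ℕ) * i) (1 + (2 * n : ℕ) * j) -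
      quadPhase c e₁ e₂ A B E 1 1‖ ≤ 1 / 2 := by
  have hch : ∀ t : ℕ, Ring.choose (((2 * n : ℕ) : ℤ) * t) 2 = ((t : ℤ) * (2 * n * t - 1)) * n := by
    intro t
    have := two_mul_choose_two (((2 * n : ℕ) : ℤ) * t)
    push_cast at this ⊢
    linarith
  -- With step 2n every coefficient of the increment is a multiple of n. The zero third term lets
  -- `norm_three_zsmul_le` serve for the linear part too. The factor 500 in the length condition
  -- leads to 7 · (6 + 24)/500 < 1/2 at the end.
  have hdiff : quadPhase c e₁ e₂ A B E (1 + (2 * n : ℕ) * i) (1 + (2 * n : ℕ) * j) -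
      quadPhase c e₁ e₂ A B E 1 1 = (((2 * i : ℤ) • (n • e₁) + (2 * j : ℤ) • (n • e₂) +
        (0 : ℤ) • (n • e₁)) + ((2 * i + i * (2 * n * i - 1) : ℤ) • (n • A) +
        (2 * i + 2 * j + 4 * n * i * j : ℤ) • (n • B) +
        (2 * j + j * (2 * n * j - 1) : ℤ) • (n • E))) := by
    unfold quadPhase
    simp only [choose_two_add, hch]
    module
  have hM0 : (0 : ℝ) ≤ M := by positivity
  have hMr : (1 : ℝ) ≤ M := by exact_mod_cast hM
  have hnr : (1 : ℝ) ≤ n := by exact_mod_cast hn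
  have hLr : (1 : ℝ) ≤ L := by exact_mod_cast hL
  have hiJ : (i : ℝ) ≤ J := by exact_mod_cast hi.le
  have hjJ : (j : ℝ) ≤ J := by exact_mod_cast hj.le
  have hi0 : (0 : ℝ) ≤ i := by positivity
  have hj0 : (0 : ℝ) ≤ j := by positivity
  have hJ1 : (1 : ℝ) ≤ J := by
    have : 1 ≤ J := by omega
    exact_mod_cast this
  have hJr : (J : ℝ) * (500 * n * L) ≤ M := by exact_mod_cast hJ
  have hlin : ∀ t : ℕ, (t : ℝ) ≤ J → |((2 * t : ℤ) : ℝ)| ≤ 2 * J := by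
    intro t ht
    push_cast
    rw [abs_of_nonneg (by positivity)]
    linarith
  have hquad : ∀ t : ℕ, (t : ℝ) ≤ J → |((2 * t + t * (2 * n * t - 1) : ℤ) : ℝ)| ≤ 8 * n * J ^ 2 := by
    intro t ht
    have ht0 : (0 : ℝ) ≤ t := by positivity
    push_cast
    have h1 : (2 * t + t * (2 * n * t - 1) : ℝ) = t + 2 * n * t ^ 2 := by ring
    have h2 : (t : ℝ) ^ 2 ≤ J ^ 2 := by gcongr
    have h3 : (t : ℝ) ≤ n * J ^ 2 := by nlinarith
    have h4 : (n : ℝ) * t ^ 2 ≤ n * J ^ 2 := by gcongr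
    rw [h1, abs_of_nonneg (by positivity)]
    linarith [show (0 : ℝ) ≤ n * J ^ 2 by positivity]
  have hmix : |((2 * i + 2 * j + 4 * n * i * j : ℤ) : ℝ)| ≤ 8 * n * J ^ 2 := by
    push_cast
    have h2 : (i : ℝ) * j ≤ J ^ 2 := by rw [sq]; gcongr
    have h3 : (i : ℝ) ≤ n * J ^ 2 := by nlinarith
    have h3' : (j : ℝ) ≤ n * J ^ 2 := by nlinarith
    have h4 : (n : ℝ) * (i * j) ≤ n * J ^ 2 := by gcongr
    rw [abs_of_nonneg (by positivity)]
    linarith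
  have g1 := norm_three_zsmul_le hM0 (hlin i hiJ) (hlin j hjJ) (z := 0) (by simp) h₁ h₂ h₁
  have g2 := norm_three_zsmul_le (by positivity : (0 : ℝ) ≤ (M : ℝ) ^ 2) (hquad i hiJ) hmix
    (hquad j hjJ) hA hB hE
  rw [hdiff]
  generalize (2 * i : ℤ) • (n • e₁) + (2 * j : ℤ) • (n • e₂) + (0 : ℤ) • (n • e₁) = α at g1 ⊢
  generalize (2 * i + i * (2 * n * i - 1) : ℤ) • (n • A) +
        (2 * i + 2 * j + 4 * n * i * j : ℤ) • (n • B) +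
        (2 * j + j * (2 * n * j - 1) : ℤ) • (n • E) = β at g2 ⊢
  have g3 := norm_add_le α β
  have b1 : ‖α‖ * (M * 500) ≤ M * 6 := by
    have : 500 * ((J : ℝ) * L * 1) ≤ M := by
      have : (J : ℝ) * L * 1 ≤ J * L * n := by gcongr
      linarith
    nlinarith
  have b2 : ‖β‖ * ((M : ℝ) ^ 2 * 500) ≤ M ^ 2 * 24 := by
    have h5 : (J : ℝ) * 1 ≤ M := by
      have : (J : ℝ) * 1 ≤ J * (500 * n * L) := by
        gcongr
        nlinarith [mul_le_mul hnr hLr zero_le_one (by linarith)]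
      linarith
    have h6 : 500 * (n * J ^ 2 * L : ℝ) ≤ M ^ 2 := by
      calc 500 * (n * J ^ 2 * L : ℝ) = (J * (500 * n * L)) * (J * 1) := by ring
        _ ≤ M * M := by gcongr
        _ = _ := by ring
    nlinarith
  have b1' : ‖α‖ * 500 ≤ 6 := by
    have : (M : ℝ) * (‖α‖ * 500) ≤ M * 6 := by linarith
    exact le_of_mul_le_mul_left this (by linarith)
  have b2' : ‖β‖ * 500 ≤ 24 := by
    have : (M : ℝ) ^ 2 * (‖β‖ * 500) ≤ M ^ 2 * 24 := by linarith
    exact le_of_mul_le_mul_left this (by positivity)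
  linarith [g3]

/-- On the product of two copies of {1 + 2nk : k < J}, with J = M / Q, the exponential stays within
1/2 of a fixed unit complex number. Its sum is then at least J²/2 ≥ M²/(8Q²), too large for the
stated level. -/
lemma not_phaseEquidistributed (n L : ℕ) (hn : 0 < n) (hL : 0 < L) :
    ∃ Q : ℕ, 0 < Q ∧ ∀ M : ℕ, Q ≤ M → ∀ c e₁ e₂ A B E : UnitAddCircle,
      ‖n • A‖ * (M : ℝ) ^ 2 ≤ L → ‖n • B‖ * (M : ℝ) ^ 2 ≤ L → ‖n • E‖ * (M : ℝ) ^ 2 ≤ L →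
      ‖n • e₁‖ * M ≤ L → ‖n • e₂‖ * M ≤ L →
      ¬ PhaseEquidistributed M (1 / (16 * (Q : ℝ) ^ 2)) (quadPhase c e₁ e₂ A B E) := by
  set Q := 500 * n * L with hQ
  have hQ0 : 0 < Q := by positivity
  refine ⟨Q, hQ0, fun M hM c e₁ e₂ A B E hA hB hE h₁ h₂ heq => ?_⟩
  have hM0 : 0 < M := by omega
  set J := M / Q with hJ
  have hJ1 : 1 ≤ J := (Nat.one_le_div_iff hQ0).2 hM
  have hJQ : J * Q ≤ M := Nat.div_mul_le_self M Q
  have hMJ : M ≤ 2 * J * Q := by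
    have h1 := Nat.div_add_mod M Q
    have h2 := Nat.mod_lt M hQ0
    rw [← hJ] at h1
    nlinarith
  set P : Finset ℤ := (Finset.range J).image fun k : ℕ => 1 + ((2 * n : ℕ) : ℤ) * k with hP
  have h2n : 2 * n ≤ Q := by
    rw [hQ]; nlinarith
  have hprog : IsProgressionIn M P := by
    refine ⟨⟨1, ((2 * n : ℕ) : ℤ), J, by exact_mod_cast (by omega), rfl⟩, ?_⟩
    intro z hz
    obtain ⟨k, hk, rfl⟩ := Finset.mem_image.1 hz
    rw [Finset.mem_range] at hk
    rw [Finset.mem_Icc]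
    have h3 : 1 + 2 * n * k ≤ M := by
      have : 2 * n * (k + 1) ≤ Q * J := Nat.mul_le_mul h2n hk
      nlinarith
    exact ⟨by linarith [show (0 : ℤ) ≤ ((2 * n : ℕ) : ℤ) * k by positivity], by exact_mod_cast h3⟩
  have hsum := heq P P hprog hprog
  have hinj : Function.Injective (fun k : ℕ => 1 + ((2 * n : ℕ) : ℤ) * k) := by
    intro x y hxy
    have : ((2 * n : ℕ) : ℤ) * x = ((2 * n : ℕ) : ℤ) * y := by simpa using hxy
    exact_mod_cast mul_left_cancel₀ (by positivity) this
  rw [Finset.sum_product, hP, Finset.sum_image (fun _ _ _ _ h => hinj h)] at hsum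
  simp_rw [Finset.sum_image (fun _ _ _ _ h => hinj h)] at hsum
  set F : ℕ → ℕ → ℂ := fun i j => circleChar (quadPhase c e₁ e₂ A B E
    (1 + ((2 * n : ℕ) : ℤ) * i) (1 + ((2 * n : ℕ) : ℤ) * j)) with hF
  set z := circleChar (quadPhase c e₁ e₂ A B E 1 1) with hz
  have hterm : ∀ i ∈ Finset.range J, ∀ j ∈ Finset.range J, ‖F i j - z‖ ≤ 1 / 2 := by
    intro i hi j hj
    rw [Finset.mem_range] at hi hj
    exact (norm_circleChar_sub_le _ _).trans
      (norm_quadPhase_sub_le hn hM0 hA hB hE h₁ h₂ hJQ hi hj hL)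
  have hJr : (1 : ℝ) ≤ J := by exact_mod_cast hJ1
  have hdist : ‖(∑ i ∈ Finset.range J, ∑ j ∈ Finset.range J, F i j) - (J : ℂ) ^ 2 * z‖ ≤
      (J : ℝ) ^ 2 / 2 := by
    have : (∑ i ∈ Finset.range J, ∑ j ∈ Finset.range J, F i j) - (J : ℂ) ^ 2 * z =
        ∑ i ∈ Finset.range J, ∑ j ∈ Finset.range J, (F i j - z) := by
      simp only [Finset.sum_sub_distrib, Finset.sum_const, Finset.card_range, nsmul_eq_mul]
      ring
    rw [this]
    calc _ ≤ ∑ i ∈ Finset.range J, ∑ j ∈ Finset.range J, (1 / 2 : ℝ) :=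
          (norm_sum_le _ _).trans (Finset.sum_le_sum fun i hi => (norm_sum_le _ _).trans
            (Finset.sum_le_sum fun j hj => hterm i hi j hj))
      _ = _ := by simp only [Finset.sum_const, Finset.card_range, nsmul_eq_mul]; ring
  have hnorm : ‖(J : ℂ) ^ 2 * z‖ = (J : ℝ) ^ 2 := by
    rw [norm_mul, hz, norm_circleChar]; simp
  have hlow : (J : ℝ) ^ 2 / 2 ≤ ‖∑ i ∈ Finset.range J, ∑ j ∈ Finset.range J, F i j‖ := by
    have h3 := norm_sub_norm_le ((J : ℂ) ^ 2 * z) (∑ i ∈ Finset.range J, ∑ j ∈ Finset.range J, F i j)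
    rw [norm_sub_rev] at h3
    linarith
  have hfin := hlow.trans hsum
  have hQr : (0 : ℝ) < Q := by exact_mod_cast hQ0
  have hMr : (M : ℝ) ≤ 2 * J * Q := by exact_mod_cast hMJ
  have hM2 : (M : ℝ) ^ 2 ≤ (2 * J * Q) ^ 2 := by gcongr
  rw [one_div_mul_eq_div, le_div_iff₀ (by positivity)] at hfin
  nlinarith [show (0 : ℝ) < (J : ℝ) ^ 2 * Q ^ 2 by positivity]

lemma card_le_of_isProgressionIn {M : ℕ} {P : Finset ℤ} (h : IsProgressionIn M P) :
    P.card ≤ M := by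
  simpa using Finset.card_le_card h.2

/-- A progression in `[M]` which is dense has a step of bounded size. -/
lemma mem_of_dvd_of_dense_progression {M C : ℕ} {P : Finset ℤ} (hP : IsProgressionIn M P)
    (hC : 0 < C) (hM : 2 * C ≤ M) (hcard : M < C * P.card) {z z' w : ℤ} (hz : z ∈ P)
    (hz' : z' ∈ P) (hw : (z ≤ w ∧ w ≤ z') ∨ (z' ≤ w ∧ w ≤ z))
    (hdvd : ((2 * C).factorial : ℤ) ∣ w - z) : w ∈ P := by
  obtain ⟨⟨s, d, L, hd, hPeq⟩, hsub⟩ := hP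
  have hinj : Function.Injective (fun k : ℕ => s + d * (k : ℤ)) := by
    intro x y hxy
    have : d * (x : ℤ) = d * (y : ℤ) := by simpa using hxy
    exact_mod_cast mul_left_cancel₀ hd.ne' this
  have hL : P.card = L := by rw [hPeq, Finset.card_image_of_injective _ hinj, Finset.card_range]
  rw [hL] at hcard
  have hL2 : 2 < L := by
    by_contra h
    have : C * L ≤ C * 2 := Nat.mul_le_mul_left _ (by omega)
    omega
  have h0 : s ∈ P := by
    rw [hPeq]; exact Finset.mem_image.2 ⟨0, Finset.mem_range.2 (by omega), by simp⟩
  have h1 : s + d * ((L - 1 : ℕ) : ℤ) ∈ P := by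
    rw [hPeq]; exact Finset.mem_image.2 ⟨L - 1, Finset.mem_range.2 (by omega), rfl⟩
  have h0' := (Finset.mem_Icc.1 (hsub h0)).1
  have h1' := (Finset.mem_Icc.1 (hsub h1)).2
  have hLcast : ((L - 1 : ℕ) : ℤ) = (L : ℤ) - 1 := by push_cast [show 1 ≤ L by omega]; ring
  rw [hLcast] at h1'
  -- A progression with L > M/C terms and step above 2C would span more than 2C(L - 1) ≥ CL > M.
  have hd2 : d ≤ 2 * C := by
    by_contra h
    have hd3 : (2 * C + 1 : ℤ) ≤ d := by omega
    have hLz : (2 : ℤ) < L := by exact_mod_cast hL2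
    have hcz : (M : ℤ) < C * L := by exact_mod_cast hcard
    have hCz : (1 : ℤ) ≤ C := by exact_mod_cast hC
    have : (2 * C + 1 : ℤ) * (L - 1) ≤ d * (L - 1) := mul_le_mul_of_nonneg_right hd3 (by omega)
    nlinarith
  have hdd : d ∣ w - z := by
    refine dvd_trans ?_ hdvd
    rw [← Int.natAbs_dvd, Int.natCast_dvd_natCast]
    exact Nat.dvd_factorial (by omega) (by omega)
  obtain ⟨q, hq⟩ := hdd
  rw [hPeq] at hz hz' ⊢
  obtain ⟨x, hx, rfl⟩ := Finset.mem_image.1 hz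
  obtain ⟨y, hy, rfl⟩ := Finset.mem_image.1 hz'
  rw [Finset.mem_range] at hx hy
  have hwq : w = s + d * (x + q) := by linarith
  have hbetween : ∀ t : ℤ, s + d * (x + q) ≤ s + d * t → x + q ≤ t := fun t ht =>
    le_of_mul_le_mul_left (by linarith) hd
  have hbetween' : ∀ t : ℤ, s + d * t ≤ s + d * (x + q) → t ≤ x + q := fun t ht =>
    le_of_mul_le_mul_left (by linarith) hd
  rw [hwq] at hw
  have hrange : 0 ≤ x + q ∧ x + q < L := by
    rcases hw with ⟨ha, hb⟩ | ⟨ha, hb⟩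
    · have := hbetween' _ ha; have := hbetween _ hb; omega
    · have := hbetween' _ ha; have := hbetween _ hb; omega
  refine Finset.mem_image.2 ⟨(x + q).toNat, Finset.mem_range.2 (by omega), ?_⟩
  rw [hwq, Int.toNat_of_nonneg hrange.1]

/-- The set of `z` in the box `[-M, M]²` such that `(a + b i) z` and `(a' + b' i) z` lie in the
product `P₁ × P₂`. -/
noncomputable def dilatePairSet (M : ℕ) (P₁ P₂ : Finset ℤ) (a b a' b' : ℤ) : Finset (ℤ × ℤ) :=
  (Finset.Icc (-(M : ℤ)) M ×ˢ Finset.Icc (-(M : ℤ)) M).filter fun p =>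
    (a * p.1 - b * p.2 ∈ P₁ ∧ b * p.1 + a * p.2 ∈ P₂) ∧
      (a' * p.1 - b' * p.2 ∈ P₁ ∧ b' * p.1 + a' * p.2 ∈ P₂)

lemma mem_dilatePairSet {M : ℕ} {P₁ P₂ : Finset ℤ} {a b a' b' : ℤ} {p : ℤ × ℤ} :
    p ∈ dilatePairSet M P₁ P₂ a b a' b' ↔ (|p.1| ≤ M ∧ |p.2| ≤ M) ∧
    (a * p.1 - b * p.2 ∈ P₁ ∧ b * p.1 + a * p.2 ∈ P₂) ∧
      (a' * p.1 - b' * p.2 ∈ P₁ ∧ b' * p.1 + a' * p.2 ∈ P₂) := by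
  simp only [dilatePairSet, Finset.mem_filter, Finset.mem_product, Finset.mem_Icc, abs_le]

/-- Multiplication by a + bi is injective and maps the set into P₁ × P₂. Consequently a large sum
over the set forces both progressions to be dense. -/
lemma card_dilatePairSet_le {M : ℕ} {P₁ P₂ : Finset ℤ} {a b a' b' : ℤ} (h : a ^ 2 + b ^ 2 ≠ 0) :
    (dilatePairSet M P₁ P₂ a b a' b').card ≤ P₁.card * P₂.card := by
  rw [← Finset.card_product]
  refine Finset.card_le_card_of_injOn (fun p => (a * p.1 - b * p.2, b * p.1 + a * p.2)) ?_ ?_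
  · intro p hp
    have := (mem_dilatePairSet.1 (Finset.mem_coe.1 hp)).2.1
    exact Finset.mem_coe.2 (Finset.mem_product.2 this)
  · rintro ⟨x, y⟩ - ⟨x', y'⟩ - hxy
    obtain ⟨h1, h2⟩ := Prod.mk.inj hxy
    simp only at h1 h2
    have e1 : (a ^ 2 + b ^ 2) * x = (a ^ 2 + b ^ 2) * x' := by linear_combination a * h1 + b * h2
    have e2 : (a ^ 2 + b ^ 2) * y = (a ^ 2 + b ^ 2) * y' := by linear_combination a * h2 - b * h1
    rw [mul_left_cancel₀ h e1, mul_left_cancel₀ h e2]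

/-- The step of a dense progression divides (2C)!, so an affine map sampled in steps of (2C)! that
meets P at two times meets it at all times between. Hence the sections of `dilatePairSet` along
residue classes modulo (2C)! are intervals, as `weyl_inverse_planar` requires. -/
lemma mem_of_affine_of_dense_progression {M C : ℕ} {P : Finset ℤ} (hP : IsProgressionIn M P)
    (hC : 0 < C) (hM : 2 * C ≤ M) (hcard : M < C * P.card) {a b t₁ t₂ t : ℤ}
    (h₁ : a * (((2 * C).factorial : ℤ) * t₁) + b ∈ P)
    (h₂ : a * (((2 * C).factorial : ℤ) * t₂) + b ∈ P) (ht₁ : t₁ ≤ t) (ht₂ : t ≤ t₂) :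
    a * (((2 * C).factorial : ℤ) * t) + b ∈ P := by
  refine mem_of_dvd_of_dense_progression hP hC hM hcard h₁ h₂ ?_ ⟨a * (t - t₁), by ring⟩
  have hD : (0 : ℤ) ≤ ((2 * C).factorial : ℤ) := by positivity
  rcases le_total 0 a with ha | ha
  · left
    constructor <;> gcongr
  · right
    have g1 := mul_le_mul_of_nonpos_left (mul_le_mul_of_nonneg_left ht₁ hD) ha
    have g2 := mul_le_mul_of_nonpos_left (mul_le_mul_of_nonneg_left ht₂ hD) ha
    constructor <;> linarith

/-- Correlations of an equidistributed quadratic phase along two dilates of different norms. -/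
lemma norm_sum_dilatePairSet_le (a b a' b' : ℤ) (hne : a ^ 2 + b ^ 2 ≠ a' ^ 2 + b' ^ 2)
    (h0 : a ^ 2 + b ^ 2 ≠ 0) {ε : ℝ} (hε : 0 < ε) :
    ∃ σ : ℝ, 0 < σ ∧ ∃ K : ℕ, ∀ M : ℕ, K ≤ M → ∀ c e₁ e₂ A B E : UnitAddCircle,
      PhaseEquidistributed M σ (quadPhase c e₁ e₂ A B E) →
      ∀ u v : ℤ, |u| ≤ M → |v| ≤ M →
      ∀ P₁ P₂ : Finset ℤ, IsProgressionIn M P₁ → IsProgressionIn M P₂ →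
      ‖∑ p ∈ dilatePairSet M P₁ P₂ a b a' b', circleChar
        (quadPhase c e₁ e₂ A B E (u + (a * p.1 - b * p.2)) (v + (b * p.1 + a * p.2)) -
        quadPhase c e₁ e₂ A B E (u + (a' * p.1 - b' * p.2)) (v + (b' * p.1 + a' * p.2)))‖ ≤
        ε * (M : ℝ) ^ 2 := by
  obtain ⟨C, hCε⟩ := exists_nat_ge (1 / ε)
  have hCr : (0 : ℝ) < C := lt_of_lt_of_le (by positivity) hCε
  have hC : 0 < C := by exact_mod_cast hCr
  obtain ⟨k, K, hk, hK, hweyl⟩ := weyl_inverse_planar C (2 * C).factorial hC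
    (Nat.factorial_pos _)
  obtain ⟨n, L, hn, hL, hrec⟩ := coeffs_of_coeffs_sub_comp a b a' b' hne k K hk
  obtain ⟨Q, hQ, hmajor⟩ := not_phaseEquidistributed n L hn hL
  -- This level is the one refuted by `not_phaseEquidistributed` once the coefficients of the phase
  -- are known to be near rationals of denominator n.
  refine ⟨1 / (16 * (Q : ℝ) ^ 2), by positivity, K + Q + 2 * C, ?_⟩
  intro M hM c e₁ e₂ A B E heq u v hu hv P₁ P₂ hP₁ hP₂
  by_contra! hlarge
  have hM0 : 0 < M := by omega
  have hMr : (1 : ℝ) ≤ M := by exact_mod_cast hM0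
  set S := dilatePairSet M P₁ P₂ a b a' b' with hS
  have hεC : (M : ℝ) ^ 2 ≤ C * (ε * M ^ 2) := by
    have : 1 ≤ C * ε := by rwa [div_le_iff₀ hε] at hCε
    nlinarith [sq_nonneg (M : ℝ)]
  -- As neither progression has more than M terms, this makes each of them longer than M/C.
  have hcardS : (M : ℝ) ^ 2 < C * (P₁.card * P₂.card) := by
    have h1 := norm_sum_circleChar_le S (fun p =>
      (quadPhase c e₁ e₂ A B E (u + (a * p.1 - b * p.2)) (v + (b * p.1 + a * p.2)) -
        quadPhase c e₁ e₂ A B E (u + (a' * p.1 - b' * p.2)) (v + (b' * p.1 + a' * p.2))))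
    have h2 : (S.card : ℝ) ≤ P₁.card * P₂.card := by
      exact_mod_cast card_dilatePairSet_le h0
    have h3 : ε * (M : ℝ) ^ 2 < P₁.card * P₂.card := hlarge.trans_le (h1.trans h2)
    exact hεC.trans_lt (mul_lt_mul_of_pos_left h3 hCr)
  have hc1 : (P₁.card : ℝ) ≤ M := by exact_mod_cast card_le_of_isProgressionIn hP₁
  have hc2 : (P₂.card : ℝ) ≤ M := by exact_mod_cast card_le_of_isProgressionIn hP₂
  have hd1 : M < C * P₁.card := by
    have : (M : ℝ) * M < M * (C * P₁.card) := by
      have : (P₁.card : ℝ) * P₂.card ≤ P₁.card * M := by gcongr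
      nlinarith
    exact_mod_cast lt_of_mul_lt_mul_left this (by linarith)
  have hd2 : M < C * P₂.card := by
    have : (M : ℝ) * M < M * (C * P₂.card) := by
      have : (P₁.card : ℝ) * P₂.card ≤ M * P₂.card := by gcongr
      nlinarith
    exact_mod_cast lt_of_mul_lt_mul_left this (by linarith)
  have hCM : 2 * C ≤ M := by omega
  simp_rw [quadPhase_comp, quadPhase_sub] at hlarge
  obtain ⟨kA, kB, kE, kf₁, kf₂⟩ := hweyl M (by omega) S _ _ _ _ _ _
    (by
      intro p hp
      have h1 := (mem_dilatePairSet.1 hp).1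
      have h2 : (M : ℤ) ≤ C * M := le_mul_of_one_le_left (by positivity) (by exact_mod_cast hC)
      exact ⟨h1.1.trans h2, h1.2.trans h2⟩)
    (by
      intro r y
      refine ⟨fun t₁ h₁ t₂ h₂ t ht => ?_⟩
      simp only [Set.mem_ofPred_eq, hS, mem_dilatePairSet] at h₁ h₂ ⊢
      have hD : (0 : ℤ) ≤ ((2 * C).factorial : ℤ) := by positivity
      refine ⟨⟨?_, h₁.1.2⟩, ⟨?_, ?_⟩, ?_, ?_⟩
      · have g1 := mul_le_mul_of_nonneg_left ht.1 hD
        have g2 := mul_le_mul_of_nonneg_left ht.2 hD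
        have g3 := abs_le.1 h₁.1.1
        have g4 := abs_le.1 h₂.1.1
        rw [abs_le]
        constructor <;> linarith
      · have := mem_of_affine_of_dense_progression hP₁ hC hCM hd1 (a := a) (b := a * r - b * y)
          (by convert h₁.2.1.1 using 1; ring) (by convert h₂.2.1.1 using 1; ring) ht.1 ht.2
        convert this using 1; ring
      · have := mem_of_affine_of_dense_progression hP₂ hC hCM hd2 (a := b) (b := b * r + a * y)
          (by convert h₁.2.1.2 using 1; ring) (by convert h₂.2.1.2 using 1; ring) ht.1 ht.2
        convert this using 1; ring
      · have := mem_of_affine_of_dense_progression hP₁ hC hCM hd1 (a := a') (b := a' * r - b' * y)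
          (by convert h₁.2.2.1 using 1; ring) (by convert h₂.2.2.1 using 1; ring) ht.1 ht.2
        convert this using 1; ring
      · have := mem_of_affine_of_dense_progression hP₂ hC hCM hd2 (a := b') (b := b' * r + a' * y)
          (by convert h₁.2.2.2 using 1; ring) (by convert h₂.2.2.2 using 1; ring) ht.1 ht.2
        convert this using 1; ring)
    (by
      intro r x
      refine ⟨fun t₁ h₁ t₂ h₂ t ht => ?_⟩
      simp only [Set.mem_ofPred_eq, hS, mem_dilatePairSet] at h₁ h₂ ⊢
      have hD : (0 : ℤ) ≤ ((2 * C).factorial : ℤ) := by positivity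
      refine ⟨⟨h₁.1.1, ?_⟩, ⟨?_, ?_⟩, ?_, ?_⟩
      · have g1 := mul_le_mul_of_nonneg_left ht.1 hD
        have g2 := mul_le_mul_of_nonneg_left ht.2 hD
        have g3 := abs_le.1 h₁.1.2
        have g4 := abs_le.1 h₂.1.2
        rw [abs_le]
        constructor <;> linarith
      · have := mem_of_affine_of_dense_progression hP₁ hC hCM hd1 (a := -b) (b := a * x - b * r)
          (by convert h₁.2.1.1 using 1; ring) (by convert h₂.2.1.1 using 1; ring) ht.1 ht.2
        convert this using 1; ring
      · have := mem_of_affine_of_dense_progression hP₂ hC hCM hd2 (a := a) (b := b * x + a * r)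
          (by convert h₁.2.1.2 using 1; ring) (by convert h₂.2.1.2 using 1; ring) ht.1 ht.2
        convert this using 1; ring
      · have := mem_of_affine_of_dense_progression hP₁ hC hCM hd1 (a := -b') (b := a' * x - b' * r)
          (by convert h₁.2.2.1 using 1; ring) (by convert h₂.2.2.1 using 1; ring) ht.1 ht.2
        convert this using 1; ring
      · have := mem_of_affine_of_dense_progression hP₂ hC hCM hd2 (a := a') (b := b' * x + a' * r)
          (by convert h₁.2.2.2 using 1; ring) (by convert h₂.2.2.2 using 1; ring) ht.1 ht.2
        convert this using 1; ring)
    (hεC.trans (mul_le_mul_of_nonneg_left hlarge.le hCr.le))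
  obtain ⟨nA, nB, nE, n₁, n₂⟩ := hrec M hM0 u v hu hv e₁ e₂ A B E _ _ _ _ _ rfl rfl rfl rfl rfl
    kA kB kE kf₁ kf₂
  exact hmajor M (by omega) c e₁ e₂ A B E nA nB nE n₁ n₂ heq

/-! ### Primes congruent to 1 modulo 4 and the Gaussian primes above them -/

open ArithmeticFunction.vonMangoldt in
/-- The sum of the reciprocals of the primes `p ≡ 1 mod 4` diverges. -/
lemma not_summable_one_div_primes_one_mod_four :
    ¬ Summable fun n : ℕ => if n.Prime ∧ n % 4 = 1 then (1 : ℝ) / n else 0 := by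
  intro hsum
  set f : ℕ → ℝ := fun n => if n.Prime ∧ n % 4 = 1 then (1 : ℝ) / n else 0 with hf
  have hf0 : ∀ n, 0 ≤ f n := fun n => by simp only [hf]; split_ifs <;> positivity
  have hunit : IsUnit (1 : ZMod 4) := isUnit_one
  obtain ⟨C, hC⟩ := LSeries_residueClass_lower_bound hunit
  have hnp := summable_residueClass_non_primes_div (1 : ZMod 4)
  set g : ℕ → ℝ := fun n => (if n.Prime then 0 else residueClass (1 : ZMod 4) n) / n with hg
  -- Suppose the sum converges, with tail below 1/4 beyond Y. In ∑ Λ(n) n^(-1-s) over n ≡ 1 mod 4,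
  -- the non-primes (`g`) and the n < Y (`h`) contribute O(1). The primes beyond Y contribute at
  -- most (1/4)/s, because log p ≤ p^s/s. The lower bound from Dirichlet's theorem has main term
  -- (1/2)/s, which is larger as s → 0.
  obtain ⟨Y, hY⟩ : ∃ Y : ℕ, ∑' n, f n - 1 / 4 < ∑ n ∈ Finset.range Y, f n :=
    (hsum.hasSum.tendsto_sum_nat.eventually (lt_mem_nhds (by linarith))).exists
  set h : ℕ → ℝ := fun n => if n < Y then residueClass (1 : ZMod 4) n / n else 0 with hh
  have hhs : Summable h := summable_of_ne_finset_zero (s := Finset.range Y) (by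
    intro n hn
    rw [Finset.mem_range] at hn
    simp [hh, hn])
  set fY : ℕ → ℝ := fun n => if n < Y then f n else 0 with hfY
  have hfYs : HasSum fY (∑ n ∈ Finset.range Y, f n) := by
    have : ∑ n ∈ Finset.range Y, f n = ∑ n ∈ Finset.range Y, fY n :=
      Finset.sum_congr rfl fun n hn => by simp [hfY, Finset.mem_range.1 hn]
    rw [this]
    refine hasSum_sum_of_ne_finset_zero fun n hn => ?_
    rw [Finset.mem_range] at hn
    simp [hfY, hn]
  have hT := hsum.hasSum.sub hfYs
  have hr0 : ∀ n, 0 ≤ residueClass (1 : ZMod 4) n := residueClass_nonneg _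
  have hbound : ∀ s : ℝ, 0 < s → s ≤ 1 → (1 / 2 : ℝ) / s - C ≤
      ∑' n, g n + ∑' n, h n + (1 / 4) / s := by
    intro s hs hs1
    have h1 := hC (x := 1 + s) ⟨by linarith, by linarith⟩
    rw [show Nat.totient 4 = 2 by decide] at h1
    have hG : HasSum (fun n => g n + h n + (f n - fY n) / s)
        (∑' n, g n + ∑' n, h n + (∑' n, f n - ∑ n ∈ Finset.range Y, f n) / s) :=
      (hnp.hasSum.add hhs.hasSum).add (hT.div_const s)
    have hle : ∀ n : ℕ, residueClass (1 : ZMod 4) n / (n : ℝ) ^ (1 + s) ≤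
        g n + h n + (f n - fY n) / s := by
      intro n
      have hg0 : 0 ≤ g n := by
        simp only [hg]; split_ifs
        · simp
        · exact div_nonneg (hr0 n) (Nat.cast_nonneg n)
      have hh0 : 0 ≤ h n := by
        simp only [hh]; split_ifs
        · exact div_nonneg (hr0 n) (Nat.cast_nonneg n)
        · exact le_rfl
      have hd0 : 0 ≤ (f n - fY n) / s := by
        refine div_nonneg ?_ hs.le
        simp only [hfY]; split_ifs
        · simp
        · simpa using hf0 n
      rcases Nat.eq_zero_or_pos n with rfl | hn
      · rw [residueClass_apply_zero, zero_div]; positivity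
      have hn1 : (1 : ℝ) ≤ n := by exact_mod_cast hn
      have hpow : (n : ℝ) ≤ (n : ℝ) ^ (1 + s) := by
        conv_lhs => rw [← Real.rpow_one (n : ℝ)]
        exact Real.rpow_le_rpow_of_exponent_le hn1 (by linarith)
      have hle1 : residueClass (1 : ZMod 4) n / (n : ℝ) ^ (1 + s) ≤
          residueClass (1 : ZMod 4) n / n :=
        div_le_div_of_nonneg_left (hr0 n) (by linarith) hpow
      by_cases hp : n.Prime
      · by_cases hnY : n < Y
        · have : h n = residueClass (1 : ZMod 4) n / n := by simp [hh, hnY]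
          linarith
        · by_cases hm : n % 4 = 1
          · have e1 : f n - fY n = 1 / n := by simp [hf, hfY, hp, hm, hnY]
            have e2 : residueClass (1 : ZMod 4) n ≤ Real.log n := by
              refine (residueClass_le _ n).trans ?_
              rw [ArithmeticFunction.vonMangoldt_apply_prime hp]
            have e3 : Real.log n ≤ (n : ℝ) ^ s / s := Real.log_le_rpow_div (by linarith) hs
            have e4 : residueClass (1 : ZMod 4) n / (n : ℝ) ^ (1 + s) ≤ (1 / n) / s := by
              rw [Real.rpow_add (by linarith), Real.rpow_one, div_le_iff₀ (by positivity)]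
              have : (1 / (n : ℝ)) / s * (n * (n : ℝ) ^ s) = (n : ℝ) ^ s / s := by field_simp
              rw [this]; linarith
            rw [e1]; linarith
          · have e1 : residueClass (1 : ZMod 4) n = 0 := by
              refine Set.indicator_of_notMem ?_ _
              intro hmem
              have hmem' : ((n : ℕ) : ZMod 4) = ((1 : ℕ) : ZMod 4) := by simpa using hmem
              rw [ZMod.natCast_eq_natCast_iff'] at hmem'
              omega
            rw [e1, zero_div]; positivity
      · have : g n = residueClass (1 : ZMod 4) n / n := by simp [hg, hp]
        linarith
    have hsumm : Summable fun n : ℕ => residueClass (1 : ZMod 4) n / (n : ℝ) ^ (1 + s) :=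
      Summable.of_nonneg_of_le
        (fun n => div_nonneg (hr0 n) (Real.rpow_nonneg (Nat.cast_nonneg n) _)) hle hG.summable
    have h2 := hsumm.tsum_le_tsum hle hG.summable
    rw [hG.tsum_eq] at h2
    have h3 : (∑' n, f n - ∑ n ∈ Finset.range Y, f n) / s ≤ (1 / 4) / s := by
      gcongr; linarith
    have h4 : ((2 : ℕ) : ℝ)⁻¹ / (1 + s - 1) = (1 / 2 : ℝ) / s := by norm_num
    rw [h4] at h1
    linarith
  set D := |∑' n, g n + ∑' n, h n + C| with hD
  have hD0 : 0 ≤ D := abs_nonneg _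
  -- With 1/s = 8(D + 1) the surplus (1/2 - 1/4)/s is 2(D + 1), which exceeds D.
  have h5 := hbound (1 / (8 * (D + 1))) (by positivity) (by
    rw [div_le_one (by positivity)]; linarith)
  rw [div_div_eq_mul_div, div_div_eq_mul_div, div_one, div_one] at h5
  have h6 := le_abs_self (∑' n, g n + ∑' n, h n + C)
  linarith

lemma exists_primes_one_mod_four (W : ℝ) :
    ∃ S : Finset ℕ, (∀ p ∈ S, p.Prime ∧ p % 4 = 1) ∧ W ≤ ∑ p ∈ S, (1 : ℝ) / p := by
  have h := (not_summable_iff_tendsto_nat_atTop_of_nonneg (fun n => by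
    split_ifs <;> positivity)).1 not_summable_one_div_primes_one_mod_four
  obtain ⟨n, hn⟩ := (h.eventually (Filter.eventually_ge_atTop W)).exists
  refine ⟨(Finset.range n).filter fun p => p.Prime ∧ p % 4 = 1,
    fun p hp => (Finset.mem_filter.1 hp).2, ?_⟩
  rwa [Finset.sum_filter]

/-- A Gaussian prime `a + b i` above a prime `p ≡ 1 mod 4`, with its divisibility criterion. -/
lemma exists_gaussian_prime_above {p : ℕ} (hp : p.Prime) (hp4 : p % 4 = 1) :
    ∃ a b r : ℤ, a ^ 2 + b ^ 2 = p ∧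
      ∀ x y : ℤ, (p : ℤ) ∣ x + r * y ↔ ∃ s t : ℤ, a * s - b * t = x ∧ b * s + a * t = y := by
  have := Fact.mk hp
  obtain ⟨a, b, hab⟩ := Nat.Prime.sq_add_sq (p := p) (by omega)
  have hab' : (a : ℤ) ^ 2 + (b : ℤ) ^ 2 = p := by exact_mod_cast hab
  have hpZ : Prime (p : ℤ) := Nat.prime_iff_prime_int.1 hp
  have hp0 : (p : ℤ) ≠ 0 := hpZ.ne_zero
  -- Otherwise p would divide a as well, and p² would divide p.
  have hb : ¬ (p : ℤ) ∣ b := by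
    intro hdvd
    have hb2 : p ∣ b := by exact_mod_cast hdvd
    have ha2 : p ∣ a := by
      refine hp.dvd_of_dvd_pow (n := 2) ?_
      exact (Nat.dvd_add_left (dvd_pow hb2 two_ne_zero)).1 (hab ▸ dvd_rfl)
    obtain ⟨x, rfl⟩ := ha2
    obtain ⟨y, rfl⟩ := hb2
    have h1 : p * (p * (x ^ 2 + y ^ 2)) = p * 1 := by linear_combination hab
    have h2 := Nat.eq_of_mul_eq_mul_left hp.pos h1
    exact hp.one_lt.ne' (Nat.dvd_one.1 (Dvd.intro _ h2))
  obtain ⟨u, v, huv⟩ := (hpZ.coprime_iff_not_dvd.2 hb)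
  -- `v` is an inverse of `b` modulo `p`
  refine ⟨a, b, -(v * a), hab', fun x y => ⟨?_, ?_⟩⟩
  -- Divisibility by π = a + bi means that both coordinates of conj(π)(x + iy) vanish modulo p. As
  -- a² ≡ -b², the single congruence x ≡ (a/b)y implies both.
  · rintro ⟨m, hm⟩
    have h1 : a * x + b * y = p * (a * m + v * y + u * b * y) := by
      linear_combination a * hm + v * y * hab' + (-b * y) * huv
    have h2 : a * y - b * x = p * (-b * m + u * a * y) := by
      linear_combination (-b) * hm - a * y * huv
    refine ⟨a * m + v * y + u * b * y, -b * m + u * a * y, ?_, ?_⟩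
    · apply mul_left_cancel₀ hp0
      linear_combination (-a) * h1 + b * h2 + x * hab'
    · apply mul_left_cancel₀ hp0
      linear_combination (-b) * h1 - a * h2 + y * hab'
  · rintro ⟨s, t, rfl, rfl⟩
    refine ⟨u * a * s - v * t - u * b * t, ?_⟩
    linear_combination (-v * t) * hab' + (-a * s + b * t) * huv

/-! ### Counting multiples in boxes -/

/-- The count is the difference of the floors of (M + c)/n and c/n. -/
lemma abs_card_filter_dvd_sub_le (M n : ℕ) (hn : 0 < n) (c : ℤ) :
    |(((Finset.Icc (1 : ℤ) M).filter fun x => (n : ℤ) ∣ x + c).card : ℝ) - M / n| ≤ 1 := by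
  have hnZ : (0 : ℤ) < n := by exact_mod_cast hn
  have hnR : (0 : ℝ) < n := by exact_mod_cast hn
  have h := Int.Ioc_filter_modEq_card 0 (M : ℤ) hnZ (-c)
  have hset : (Finset.Icc (1 : ℤ) M).filter (fun x => (n : ℤ) ∣ x + c) =
      (Finset.Ioc (0 : ℤ) M).filter fun x => x ≡ -c [ZMOD n] := by
    ext x
    simp only [Finset.mem_filter, Finset.mem_Icc, Finset.mem_Ioc]
    refine and_congr (by constructor <;> rintro ⟨h1, h2⟩ <;> constructor <;> omega) ?_
    rw [Int.modEq_iff_dvd, ← dvd_neg]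
    congr! 1
    ring
  rw [hset]
  set m := ((Finset.Ioc (0 : ℤ) M).filter fun x => x ≡ -c [ZMOD n]).card
  have hmono : ⌊(((0 : ℤ) : ℚ) - ((-c : ℤ) : ℚ)) / ((n : ℤ) : ℚ)⌋ ≤
      ⌊(((M : ℤ) : ℚ) - ((-c : ℤ) : ℚ)) / ((n : ℤ) : ℚ)⌋ := by
    apply Int.floor_le_floor
    gcongr
    positivity
  rw [max_eq_left (by omega)] at h
  have f1 := Int.floor_le ((((0 : ℤ) : ℚ) - ((-c : ℤ) : ℚ)) / ((n : ℤ) : ℚ))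
  have f2 := Int.lt_floor_add_one ((((0 : ℤ) : ℚ) - ((-c : ℤ) : ℚ)) / ((n : ℤ) : ℚ))
  have f3 := Int.floor_le ((((M : ℤ) : ℚ) - ((-c : ℤ) : ℚ)) / ((n : ℤ) : ℚ))
  have f4 := Int.lt_floor_add_one ((((M : ℤ) : ℚ) - ((-c : ℤ) : ℚ)) / ((n : ℤ) : ℚ))
  have hq : ((m : ℤ) : ℚ) = (⌊(((M : ℤ) : ℚ) - ((-c : ℤ) : ℚ)) / ((n : ℤ) : ℚ)⌋ : ℚ) -
      (⌊(((0 : ℤ) : ℚ) - ((-c : ℤ) : ℚ)) / ((n : ℤ) : ℚ)⌋ : ℚ) := by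
    rw [h]; push_cast; ring
  have hMn : (((M : ℤ) : ℚ) - ((-c : ℤ) : ℚ)) / ((n : ℤ) : ℚ) =
      (M : ℚ) / n + (((0 : ℤ) : ℚ) - ((-c : ℤ) : ℚ)) / ((n : ℤ) : ℚ) := by
    push_cast; ring
  have hfin : |(m : ℚ) - M / n| ≤ 1 := by
    rw [abs_le]
    push_cast at hq
    constructor <;> push_cast at * <;> linarith
  have hcast : ((|(m : ℚ) - M / n| : ℚ) : ℝ) ≤ ((1 : ℚ) : ℝ) := Rat.cast_le.2 hfin
  push_cast at hcast
  exact hcast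

/-- The number of points of `[M]²` satisfying a linear divisibility condition in each row. -/
lemma abs_card_filter_rows_sub_le (M n : ℕ) (hn : 0 < n) (P : ℤ → ℤ → Prop)
    [∀ x y, Decidable (P x y)] (c : ℤ → ℤ) (hP : ∀ x y, P x y ↔ (n : ℤ) ∣ x + c y) :
    |(((Finset.Icc (1 : ℤ) M ×ˢ Finset.Icc (1 : ℤ) M).filter fun z => P z.1 z.2).card : ℝ) -
      (M : ℝ) ^ 2 / n| ≤ M := by
  have h1 : (((Finset.Icc (1 : ℤ) M ×ˢ Finset.Icc (1 : ℤ) M).filter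
      fun z => P z.1 z.2).card : ℝ) = ∑ y ∈ Finset.Icc (1 : ℤ) M,
        (((Finset.Icc (1 : ℤ) M).filter fun x => (n : ℤ) ∣ x + c y).card : ℝ) := by
    simp_rw [Finset.card_filter, hP]
    rw [Finset.sum_product_right]
    push_cast
    rfl
  have h2 : (M : ℝ) ^ 2 / n = ∑ y ∈ Finset.Icc (1 : ℤ) M, (M : ℝ) / n := by
    simp [sq]; ring
  rw [h1, h2, ← Finset.sum_sub_distrib]
  refine (Finset.abs_sum_le_sum_abs _ _).trans ((Finset.sum_le_sum fun y _ =>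
    abs_card_filter_dvd_sub_le M n hn (c y)).trans ?_)
  simp

/-! ### Turán–Kubilius and Kátai for a finite family of Gaussian primes -/

/-- The data of a finite set of Gaussian primes of distinct prime norms. -/
structure GaussianPrimeFamily where
  /-- the norms -/
  norms : Finset ℕ
  /-- real parts -/
  re : ℕ → ℤ
  /-- imaginary parts -/
  im : ℕ → ℤ
  /-- the residues governing divisibility -/
  root : ℕ → ℤ
  prime : ∀ p ∈ norms, p.Prime
  norm_eq : ∀ p ∈ norms, re p ^ 2 + im p ^ 2 = p
  dvd_iff : ∀ p ∈ norms, ∀ x y : ℤ, (p : ℤ) ∣ x + root p * y ↔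
    ∃ s t : ℤ, re p * s - im p * t = x ∧ im p * s + re p * t = y

namespace GaussianPrimeFamily

variable (S : GaussianPrimeFamily)

/-- The sum of the reciprocals of the norms. -/
noncomputable def weight : ℝ := ∑ p ∈ S.norms, (1 : ℝ) / p

/-- The Gaussian prime of norm `p` divides `x + y i`. -/
def Dvd (p : ℕ) (z : ℤ × ℤ) : Prop := (p : ℤ) ∣ z.1 + S.root p * z.2

instance (p : ℕ) (z : ℤ × ℤ) : Decidable (S.Dvd p z) :=
  inferInstanceAs (Decidable ((p : ℤ) ∣ z.1 + S.root p * z.2))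

/-- The number of primes of the family dividing `x + y i`. -/
noncomputable def omega (z : ℤ × ℤ) : ℝ := ∑ p ∈ S.norms, if S.Dvd p z then 1 else 0

/-- Multiplication by the Gaussian prime of norm `p`. -/
def dilate (p : ℕ) (z : ℤ × ℤ) : ℤ × ℤ :=
  (S.re p * z.1 - S.im p * z.2, S.im p * z.1 + S.re p * z.2)

/-- The box `[M]²`. -/
noncomputable def box (M : ℕ) : Finset (ℤ × ℤ) := Finset.Icc (1 : ℤ) M ×ˢ Finset.Icc (1 : ℤ) M

lemma card_box (M : ℕ) : ((box M).card : ℝ) = (M : ℝ) ^ 2 := by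
  simp [box, sq]

lemma exists_weight_ge (W : ℝ) : ∃ S : GaussianPrimeFamily, W ≤ S.weight := by
  obtain ⟨T, hT, hW⟩ := exists_primes_one_mod_four W
  have : ∀ p : ℕ, ∃ abr : ℤ × ℤ × ℤ, p ∈ T → abr.1 ^ 2 + abr.2.1 ^ 2 = p ∧
      ∀ x y : ℤ, (p : ℤ) ∣ x + abr.2.2 * y ↔
        ∃ s t : ℤ, abr.1 * s - abr.2.1 * t = x ∧ abr.2.1 * s + abr.1 * t = y := by
    intro p
    by_cases hp : p ∈ T
    · obtain ⟨a, b, r, h1, h2⟩ := exists_gaussian_prime_above (hT p hp).1 (hT p hp).2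
      exact ⟨(a, b, r), fun _ => ⟨h1, h2⟩⟩
    · exact ⟨(0, 0, 0), fun h => absurd h hp⟩
  choose f hf using this
  exact ⟨⟨T, fun p => (f p).1, fun p => (f p).2.1, fun p => (f p).2.2, fun p hp => (hT p hp).1,
    fun p hp => (hf p hp).1, fun p hp => (hf p hp).2⟩, hW⟩

lemma abs_card_dvd_sub_le (M : ℕ) {p : ℕ} (hp : p ∈ S.norms) :
    |(((box M).filter fun z => S.Dvd p z).card : ℝ) - (M : ℝ) ^ 2 / p| ≤ M :=
  abs_card_filter_rows_sub_le M p (S.prime p hp).pos (fun x y => S.Dvd p (x, y))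
    (fun y => S.root p * y) (fun _ _ => Iff.rfl)

/-- For p ≠ q the Chinese remainder theorem merges the two conditions into one congruence modulo pq
on each row, so they are nearly independent. For p = q there is only one condition, whence the
diagonal term. -/
lemma card_dvd_dvd_le (M : ℕ) {p q : ℕ} (hp : p ∈ S.norms) (hq : q ∈ S.norms) :
    (((box M).filter fun z => S.Dvd p z ∧ S.Dvd q z).card : ℝ) ≤
      (M : ℝ) ^ 2 * (1 / p * (1 / q)) + (if p = q then (M : ℝ) ^ 2 * (1 / p) else 0) + M := by
  have hp0 : (0 : ℝ) < p := by exact_mod_cast (S.prime p hp).pos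
  have hq0 : (0 : ℝ) < q := by exact_mod_cast (S.prime q hq).pos
  split_ifs with hpq
  · subst hpq
    simp only [and_self]
    have h := (abs_le.1 (S.abs_card_dvd_sub_le M hp)).2
    have : (0 : ℝ) ≤ (M : ℝ) ^ 2 * (1 / p * (1 / p)) := by positivity
    have h4 : (M : ℝ) ^ 2 * (1 / p) = (M : ℝ) ^ 2 / p := mul_one_div _ _
    linarith
  · have hcop : p.Coprime q := (Nat.coprime_primes (S.prime p hp) (S.prime q hq)).2 hpq
    obtain ⟨u, v, huv⟩ := Nat.isCoprime_iff_coprime.2 hcop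
    have h := abs_card_filter_rows_sub_le M (p * q)
      (Nat.mul_pos (S.prime p hp).pos (S.prime q hq).pos)
      (fun x y => S.Dvd p (x, y) ∧ S.Dvd q (x, y))
      (fun y => v * q * (S.root p * y) + u * p * (S.root q * y)) (by
        intro x y
        simp only [Dvd]
        have hcopZ : IsCoprime (p : ℤ) (q : ℤ) := ⟨u, v, huv⟩
        have e1 : x + (v * q * (S.root p * y) + u * p * (S.root q * y)) =
            (x + S.root p * y) + p * (u * (S.root q * y - S.root p * y)) := by
          linear_combination (S.root p * y) * huv
        have e2 : x + (v * q * (S.root p * y) + u * p * (S.root q * y)) =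
            (x + S.root q * y) + q * (v * (S.root p * y - S.root q * y)) := by
          linear_combination (S.root q * y) * huv
        constructor
        · rintro ⟨h1, h2⟩
          push_cast
          refine hcopZ.mul_dvd ?_ ?_
          · rw [e1]; exact dvd_add h1 (Dvd.intro _ rfl)
          · rw [e2]; exact dvd_add h2 (Dvd.intro _ rfl)
        · intro h
          push_cast at h
          constructor
          · have := (dvd_mul_right (p : ℤ) q).trans h
            rw [e1] at this
            exact (dvd_add_left (Dvd.intro _ rfl)).1 this
          · have := (dvd_mul_left (q : ℤ) p).trans h
            rw [e2] at this
            exact (dvd_add_left (Dvd.intro _ rfl)).1 this)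
    have h2 := (abs_le.1 h).2
    have h3 : (M : ℝ) ^ 2 * (1 / p * (1 / q)) = (M : ℝ) ^ 2 / ((p * q : ℕ) : ℝ) := by
      push_cast; field_simp
    rw [h3, add_zero]
    exact (sub_le_iff_le_add'.1 h2)

/-- The Turán–Kubilius inequality for the family. -/
lemma sum_omega_sub_weight_sq_le (M : ℕ) :
    ∑ z ∈ box M, (S.omega z - S.weight) ^ 2 ≤
      (M : ℝ) ^ 2 * S.weight + 3 * (S.norms.card : ℝ) ^ 2 * M := by
  set n := (S.norms.card : ℝ) with hn
  have hW0 : 0 ≤ S.weight := Finset.sum_nonneg fun _ _ => by positivity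
  have hWn : S.weight ≤ n := by
    rw [hn, weight]
    refine (Finset.sum_le_card_nsmul _ _ 1 fun p hp => ?_).trans (by simp)
    have : (1 : ℝ) ≤ p := by exact_mod_cast (S.prime p hp).one_lt.le
    exact (div_le_one (by linarith)).2 this
  have h1 : (M : ℝ) ^ 2 * S.weight - n * M ≤ ∑ z ∈ box M, S.omega z := by
    have e1 : ∑ z ∈ box M, S.omega z =
        ∑ p ∈ S.norms, (((box M).filter fun z => S.Dvd p z).card : ℝ) := by
      simp only [omega]
      rw [Finset.sum_comm]
      exact Finset.sum_congr rfl fun p _ => by rw [Finset.card_filter]; push_cast; rfl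
    have e2 : (M : ℝ) ^ 2 * S.weight - n * M = ∑ p ∈ S.norms, ((M : ℝ) ^ 2 / p - M) := by
      rw [Finset.sum_sub_distrib, weight, Finset.mul_sum, Finset.sum_const, nsmul_eq_mul, hn]
      simp only [mul_one_div]
    rw [e1, e2]
    exact Finset.sum_le_sum fun p hp => by
      linarith [(abs_le.1 (S.abs_card_dvd_sub_le M hp)).1]
  -- The pairs p = q produce the term M²W of the final bound. The term M²W² is cancelled by the
  -- first moment when the variance is expanded.
  have h2 : ∑ z ∈ box M, S.omega z ^ 2 ≤
      (M : ℝ) ^ 2 * S.weight ^ 2 + (M : ℝ) ^ 2 * S.weight + n ^ 2 * M := by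
    have e1 : ∑ z ∈ box M, S.omega z ^ 2 = ∑ p ∈ S.norms, ∑ q ∈ S.norms,
        (((box M).filter fun z => S.Dvd p z ∧ S.Dvd q z).card : ℝ) := by
      simp only [omega, sq, Finset.sum_mul_sum]
      rw [Finset.sum_comm]
      refine Finset.sum_congr rfl fun p _ => ?_
      rw [Finset.sum_comm]
      refine Finset.sum_congr rfl fun q _ => ?_
      rw [Finset.card_filter]
      push_cast
      refine Finset.sum_congr rfl fun z _ => ?_
      by_cases hp : S.Dvd p z <;> by_cases hq : S.Dvd q z <;> simp [hp, hq]
    have e2 : (M : ℝ) ^ 2 * S.weight ^ 2 + (M : ℝ) ^ 2 * S.weight + n ^ 2 * M =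
        ∑ p ∈ S.norms, ∑ q ∈ S.norms, ((M : ℝ) ^ 2 * (1 / p * (1 / q)) +
          (if p = q then (M : ℝ) ^ 2 * (1 / p) else 0) + M) := by
      simp only [Finset.sum_add_distrib]
      congr 1
      · congr 1
        · rw [weight, sq (∑ p ∈ S.norms, (1 : ℝ) / p), Finset.sum_mul_sum, Finset.mul_sum]
          exact Finset.sum_congr rfl fun p _ => by rw [Finset.mul_sum]
        · rw [weight, Finset.mul_sum]
          refine Finset.sum_congr rfl fun p hp => ?_
          rw [Finset.sum_ite_eq, if_pos hp]
      · simp only [Finset.sum_const, nsmul_eq_mul, hn]; ring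
    rw [e1, e2]
    exact Finset.sum_le_sum fun p hp => Finset.sum_le_sum fun q hq => S.card_dvd_dvd_le M hp hq
  have h3 : ∑ z ∈ box M, (S.omega z - S.weight) ^ 2 = ∑ z ∈ box M, S.omega z ^ 2 -
      2 * S.weight * ∑ z ∈ box M, S.omega z + (M : ℝ) ^ 2 * S.weight ^ 2 := by
    rw [← card_box, ← nsmul_eq_mul, ← Finset.sum_const, Finset.mul_sum, ← Finset.sum_sub_distrib,
      ← Finset.sum_add_distrib]
    exact Finset.sum_congr rfl fun z _ => by ring
  rw [h3]
  have hM0 : (0 : ℝ) ≤ M := by positivity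
  have h4 : 2 * S.weight * ((M : ℝ) ^ 2 * S.weight - n * M) ≤
      2 * S.weight * ∑ z ∈ box M, S.omega z := by gcongr
  have h5 : S.weight * (n * M) ≤ n * (n * M) := by gcongr
  nlinarith

lemma dilate_injective {p : ℕ} (hp : p ∈ S.norms) : Function.Injective (S.dilate p) := by
  rintro ⟨x, y⟩ ⟨x', y'⟩ h
  obtain ⟨h1, h2⟩ := Prod.mk.inj h
  simp only at h1 h2
  have hn := S.norm_eq p hp
  have hp0 : (p : ℤ) ≠ 0 := by exact_mod_cast (S.prime p hp).ne_zero
  have e1 : (p : ℤ) * x = p * x' := by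
    linear_combination S.re p * h1 + S.im p * h2 - (x - x') * hn
  have e2 : (p : ℤ) * y = p * y' := by
    linear_combination S.re p * h2 - S.im p * h1 - (y - y') * hn
  rw [mul_left_cancel₀ hp0 e1, mul_left_cancel₀ hp0 e2]

/-- The box `[-M, M]²`. -/
noncomputable def symmBox (M : ℕ) : Finset (ℤ × ℤ) := Finset.Icc (-(M : ℤ)) M ×ˢ Finset.Icc (-(M : ℤ)) M

/-- Division by π = a + bi is multiplication by conj(π)/p, and |a| + |b| ≤ a² + b² = p for integers,
so the coordinates of the cofactor do not exceed M in absolute value. -/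
lemma mem_symmBox_of_dilate_mem_box {p M : ℕ} (hp : p ∈ S.norms) {z : ℤ × ℤ}
    (hz : S.dilate p z ∈ box M) : z ∈ symmBox M := by
  obtain ⟨x, y⟩ := z
  simp only [box, dilate, Finset.mem_product, Finset.mem_Icc] at hz
  obtain ⟨⟨h1, h2⟩, h3, h4⟩ := hz
  have hn := S.norm_eq p hp
  have hp0 : (0 : ℤ) < p := by exact_mod_cast (S.prime p hp).pos
  generalize S.re p = a at *
  generalize S.im p = b at *
  set X := a * x - b * y with hX
  set Y := b * x + a * y with hY
  have hsum : |a| + |b| ≤ p := by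
    have ha : |a| ≤ a ^ 2 := by rw [← sq_abs]; exact Int.le_self_sq _
    have hb : |b| ≤ b ^ 2 := by rw [← sq_abs]; exact Int.le_self_sq _
    linarith
  have key : ∀ c d w : ℤ, |c| + |d| ≤ p → p * w = c * X + d * Y → -(M : ℤ) ≤ w ∧ w ≤ M := by
    intro c d w hcd hw
    rw [← abs_le]
    refine le_of_mul_le_mul_left ?_ hp0
    calc (p : ℤ) * |w| = |p * w| := by rw [abs_mul, abs_of_pos hp0]
      _ ≤ |c| * |X| + |d| * |Y| := by
        rw [hw, ← abs_mul, ← abs_mul]; exact abs_add_le _ _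
      _ ≤ |c| * M + |d| * M := by
        gcongr <;> rw [abs_le] <;> constructor <;> linarith
      _ = (|c| + |d|) * M := by ring
      _ ≤ _ := by gcongr
  simp only [symmBox, Finset.mem_product, Finset.mem_Icc]
  refine ⟨key a b x hsum ?_, key (-b) a y (by rw [abs_neg]; linarith) ?_⟩
  · rw [hX, hY]; linear_combination (-x) * hn
  · rw [hX, hY]; linear_combination (-y) * hn

lemma dvd_dilate {p : ℕ} (hp : p ∈ S.norms) (z : ℤ × ℤ) : S.Dvd p (S.dilate p z) :=
  (S.dvd_iff p hp _ _).2 ⟨z.1, z.2, rfl, rfl⟩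

lemma image_dilate {p M : ℕ} (hp : p ∈ S.norms) :
    ((symmBox M).filter fun z => S.dilate p z ∈ box M).image (S.dilate p) =
      (box M).filter fun z => S.Dvd p z := by
  ext z
  simp only [Finset.mem_image, Finset.mem_filter]
  constructor
  · rintro ⟨w, ⟨-, hw⟩, rfl⟩
    exact ⟨hw, S.dvd_dilate hp w⟩
  · rintro ⟨hz, hd⟩
    obtain ⟨s, t, h1, h2⟩ := (S.dvd_iff p hp _ _).1 hd
    have hst : S.dilate p (s, t) = z := Prod.ext h1 h2
    exact ⟨(s, t), ⟨S.mem_symmBox_of_dilate_mem_box hp (hst ▸ hz), hst ▸ hz⟩, hst⟩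

/-- Multiplication by π is a bijection from cofactors to multiples of π. As G vanishes off the box,
the cofactors may run over a range independent of p, as the Cauchy–Schwarz step in Kátai's argument
needs. -/
lemma sum_box_dvd {p M : ℕ} (hp : p ∈ S.norms) {G : ℤ × ℤ → ℂ} (hG : ∀ z, z ∉ box M → G z = 0) :
    ∑ z ∈ (box M).filter (fun z => S.Dvd p z), G z = ∑ z ∈ symmBox M, G (S.dilate p z) := by
  rw [← S.image_dilate hp, Finset.sum_image fun _ _ _ _ h => S.dilate_injective hp h,
    Finset.sum_filter]
  refine Finset.sum_congr rfl fun z _ => ?_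
  split_ifs with h
  · rfl
  · exact (hG _ h).symm

lemma mk_dilate (p : ℕ) (z : ℤ × ℤ) :
    (⟨(S.dilate p z).1, (S.dilate p z).2⟩ : GaussianInt) =
      ⟨S.re p, S.im p⟩ * ⟨z.1, z.2⟩ := by
  ext
  · simp [dilate]; ring
  · simp [dilate]; ring

/-- **Kátai's orthogonality criterion** for the Gaussian integers, in quantitative form. -/
lemma weight_mul_norm_sum_sq_le {M : ℕ} (hW : 1 ≤ S.weight) (hM : 3 * S.norms.card ^ 2 ≤ M)
    (hM1 : 1 ≤ M) {χ : GaussianInt → ℂ} (hχ : IsUnimodularMultiplicative χ) {F : ℤ × ℤ → ℂ}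
    (hF1 : ∀ z, ‖F z‖ ≤ 1) (hF0 : ∀ z, z ∉ box M → F z = 0)
    (hoff : ∀ p ∈ S.norms, ∀ q ∈ S.norms, p ≠ q →
      ‖∑ z ∈ symmBox M, F (S.dilate p z) * (starRingEnd ℂ) (F (S.dilate q z))‖ *
        (S.norms.card : ℝ) ^ 2 ≤ S.weight * (M : ℝ) ^ 2) :
    S.weight * ‖∑ z ∈ box M, χ ⟨z.1, z.2⟩ * F z‖ ^ 2 ≤ 58 * (M : ℝ) ^ 4 := by
  set W := S.weight with hWdef
  set n : ℝ := (S.norms.card : ℝ) with hn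
  have hMr : (1 : ℝ) ≤ M := by exact_mod_cast hM1
  have hnM : 3 * n ^ 2 ≤ M := by rw [hn]; exact_mod_cast hM
  set G : ℤ × ℤ → ℂ := fun z => χ ⟨z.1, z.2⟩ * F z with hG
  have hG0 : ∀ z, z ∉ box M → G z = 0 := fun z hz => by simp only [hG, hF0 z hz, mul_zero]
  have hbox0 : ∀ z ∈ box M, (⟨z.1, z.2⟩ : GaussianInt) ≠ 0 := by
    intro z hz h
    have : z.1 = 0 := congrArg Zsqrtd.re h
    have h2 := (Finset.mem_Icc.1 (Finset.mem_product.1 hz).1).1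
    omega
  have hG1 : ∀ z ∈ box M, ‖G z‖ ≤ 1 := fun z hz => by
    rw [hG, norm_mul, hχ.norm_eq_one _ (hbox0 z hz), one_mul]; exact hF1 z
  -- The weight W is split as (W - ω(z)) + ω(z): A sees only the fluctuation of ω, and B counts each
  -- z once for every prime of the family dividing it.
  set A := ∑ z ∈ box M, ((W - S.omega z : ℝ) : ℂ) * G z with hA
  set B := ∑ z ∈ box M, ((S.omega z : ℝ) : ℂ) * G z with hB
  have hAB : (W : ℂ) * ∑ z ∈ box M, G z = A + B := by
    rw [hA, hB, ← Finset.sum_add_distrib, Finset.mul_sum]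
    exact Finset.sum_congr rfl fun z _ => by push_cast; ring
  -- the first term, by the Turán–Kubilius inequality
  have hAle : ‖A‖ ^ 2 ≤ 2 * (M : ℝ) ^ 4 * W := by
    have h1 : ‖A‖ ≤ ∑ z ∈ box M, 1 * |S.omega z - W| := by
      refine (norm_sum_le _ _).trans (Finset.sum_le_sum fun z hz => ?_)
      rw [norm_mul, Complex.norm_real, Real.norm_eq_abs, abs_sub_comm, one_mul]
      exact mul_le_of_le_one_right (abs_nonneg _) (hG1 z hz)
    have h2 := Finset.sum_mul_sq_le_sq_mul_sq (box M) (fun _ => (1 : ℝ)) (fun z => |S.omega z - W|)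
    simp only [one_pow, Finset.sum_const, nsmul_eq_mul, mul_one, sq_abs, card_box] at h2
    have h3 := S.sum_omega_sub_weight_sq_le M
    rw [← hWdef, ← hn] at h3
    have h4 : 3 * n ^ 2 * M ≤ (M : ℝ) ^ 2 * W := by nlinarith
    calc ‖A‖ ^ 2 ≤ (∑ z ∈ box M, 1 * |S.omega z - W|) ^ 2 := by gcongr
      _ ≤ _ := h2
      _ ≤ (M : ℝ) ^ 2 * (2 * ((M : ℝ) ^ 2 * W)) := by gcongr; linarith
      _ = _ := by ring
  -- the second term, by Cauchy–Schwarz over the cofactor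
  set c : ℕ → ℂ := fun p => χ ⟨S.re p, S.im p⟩ with hc
  have hπ0 : ∀ p ∈ S.norms, (⟨S.re p, S.im p⟩ : GaussianInt) ≠ 0 := by
    intro p hp h
    have e1 : S.re p = 0 := congrArg Zsqrtd.re h
    have e2 : S.im p = 0 := congrArg Zsqrtd.im h
    have := S.norm_eq p hp
    rw [e1, e2] at this
    have := (S.prime p hp).pos
    omega
  have hc1 : ∀ p ∈ S.norms, ‖c p‖ = 1 := fun p hp => hχ.norm_eq_one _ (hπ0 p hp)
  set H : ℤ × ℤ → ℂ := fun z => ∑ p ∈ S.norms, c p * F (S.dilate p z) with hH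
  have hBeq : B = ∑ z ∈ symmBox M, ∑ p ∈ S.norms, G (S.dilate p z) := by
    rw [Finset.sum_comm, hB]
    have e1 : ∀ z ∈ box M, ((S.omega z : ℝ) : ℂ) * G z =
        ∑ p ∈ S.norms, if S.Dvd p z then G z else 0 := by
      intro z _
      rw [omega]
      push_cast
      rw [Finset.sum_mul]
      exact Finset.sum_congr rfl fun p _ => by split_ifs <;> simp
    rw [Finset.sum_congr rfl e1, Finset.sum_comm]
    exact Finset.sum_congr rfl fun p hp => by rw [← Finset.sum_filter, S.sum_box_dvd hp hG0]
  -- χ(z) factors out by multiplicativity and has modulus 1. The point z = 0 is separate, since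
  -- nothing is known of χ(0); there G vanishes because 0 is outside the box.
  have hGH : ∀ z, ‖∑ p ∈ S.norms, G (S.dilate p z)‖ ≤ 1 * ‖H z‖ := by
    intro z
    by_cases hz : (⟨z.1, z.2⟩ : GaussianInt) = 0
    · have e1 : z.1 = 0 := congrArg Zsqrtd.re hz
      have e2 : z.2 = 0 := congrArg Zsqrtd.im hz
      have : ∑ p ∈ S.norms, G (S.dilate p z) = 0 := by
        refine Finset.sum_eq_zero fun p _ => hG0 _ ?_
        simp [dilate, e1, e2, box]
      rw [this, norm_zero]; positivity
    · have : ∑ p ∈ S.norms, G (S.dilate p z) = χ ⟨z.1, z.2⟩ * H z := by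
        rw [hH, Finset.mul_sum]
        refine Finset.sum_congr rfl fun p hp => ?_
        simp only [hG]
        rw [S.mk_dilate, hχ.map_mul _ _ (hπ0 p hp) hz]
        ring
      rw [this, norm_mul, hχ.norm_eq_one _ hz]
  have hcard : ((symmBox M).card : ℝ) ≤ 9 * (M : ℝ) ^ 2 := by
    rw [symmBox, Finset.card_product]
    push_cast
    rw [card_Icc_neg_le]
    nlinarith
  -- Opening the square, the diagonal gives at most M²W + nM ≤ 2M²W. The n² pairs off the diagonal
  -- give at most M²W in total by `hoff`.
  have hHsq : ∑ z ∈ symmBox M, ‖H z‖ ^ 2 ≤ 3 * W * (M : ℝ) ^ 2 := by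
    have e1 : ((∑ z ∈ symmBox M, ‖H z‖ ^ 2 : ℝ) : ℂ) = ∑ p ∈ S.norms, ∑ q ∈ S.norms,
        c p * (starRingEnd ℂ) (c q) *
          ∑ z ∈ symmBox M, F (S.dilate p z) * (starRingEnd ℂ) (F (S.dilate q z)) := by
      push_cast
      have : ∀ z ∈ symmBox M, ((‖H z‖ : ℝ) : ℂ) ^ 2 = ∑ p ∈ S.norms, ∑ q ∈ S.norms,
          c p * (starRingEnd ℂ) (c q) * (F (S.dilate p z) * (starRingEnd ℂ) (F (S.dilate q z))) := by
        intro z _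
        rw [← Complex.mul_conj', hH, map_sum, Finset.sum_mul_sum]
        refine Finset.sum_congr rfl fun p _ => Finset.sum_congr rfl fun q _ => ?_
        rw [map_mul]; ring
      rw [Finset.sum_congr rfl this, Finset.sum_comm]
      refine Finset.sum_congr rfl fun p _ => ?_
      rw [Finset.sum_comm]
      exact Finset.sum_congr rfl fun q _ => by rw [Finset.mul_sum]
    have e2 : ∑ z ∈ symmBox M, ‖H z‖ ^ 2 ≤ ∑ p ∈ S.norms, ∑ q ∈ S.norms,
        ‖∑ z ∈ symmBox M, F (S.dilate p z) * (starRingEnd ℂ) (F (S.dilate q z))‖ := by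
      have h0 : 0 ≤ ∑ z ∈ symmBox M, ‖H z‖ ^ 2 := Finset.sum_nonneg fun _ _ => sq_nonneg _
      have h1 : ∑ z ∈ symmBox M, ‖H z‖ ^ 2 = ‖((∑ z ∈ symmBox M, ‖H z‖ ^ 2 : ℝ) : ℂ)‖ := by
        rw [Complex.norm_real, Real.norm_of_nonneg h0]
      rw [h1, e1]
      refine (norm_sum_le _ _).trans (Finset.sum_le_sum fun p hp => (norm_sum_le _ _).trans
        (Finset.sum_le_sum fun q hq => ?_))
      rw [norm_mul, norm_mul, RCLike.norm_conj, hc1 p hp, hc1 q hq, one_mul, one_mul]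
    have hdiag : ∀ p ∈ S.norms,
        ‖∑ z ∈ symmBox M, F (S.dilate p z) * (starRingEnd ℂ) (F (S.dilate p z))‖ ≤
          (M : ℝ) ^ 2 * (1 / p) + M := by
      intro p hp
      rw [← S.sum_box_dvd hp (G := fun z => F z * (starRingEnd ℂ) (F z))
        (fun z hz => by rw [hF0 z hz, zero_mul])]
      have h1 : (((box M).filter fun z => S.Dvd p z).card : ℝ) ≤ (M : ℝ) ^ 2 * (1 / p) + M := by
        rw [mul_one_div]; linarith [(abs_le.1 (S.abs_card_dvd_sub_le M hp)).2]
      refine (norm_sum_le _ _).trans (le_trans ?_ h1)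
      refine (Finset.sum_le_card_nsmul _ _ 1 fun z _ => ?_).trans (by simp)
      rw [norm_mul, RCLike.norm_conj]
      exact mul_le_one₀ (hF1 z) (norm_nonneg _) (hF1 z)
    have e3 : ∑ p ∈ S.norms, ∑ q ∈ S.norms,
        ‖∑ z ∈ symmBox M, F (S.dilate p z) * (starRingEnd ℂ) (F (S.dilate q z))‖ ≤
        ∑ p ∈ S.norms, ∑ q ∈ S.norms, ((if p = q then (M : ℝ) ^ 2 * (1 / p) + M else 0) +
          W * (M : ℝ) ^ 2 / n ^ 2) := by
      refine Finset.sum_le_sum fun p hp => Finset.sum_le_sum fun q hq => ?_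
      have hn0 : 0 < n := by
        rw [hn]; exact_mod_cast Finset.card_pos.2 ⟨p, hp⟩
      split_ifs with hpq
      · subst hpq
        have : 0 ≤ W * (M : ℝ) ^ 2 / n ^ 2 := by positivity
        linarith [hdiag p hp]
      · rw [zero_add, le_div_iff₀ (by positivity)]
        exact hoff p hp q hq hpq
    have e4 : ∑ p ∈ S.norms, ∑ q ∈ S.norms, ((if p = q then (M : ℝ) ^ 2 * (1 / p) + M else 0) +
          W * (M : ℝ) ^ 2 / n ^ 2) ≤ (M : ℝ) ^ 2 * W + n * M + W * (M : ℝ) ^ 2 := by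
      simp only [Finset.sum_add_distrib, Finset.sum_const, nsmul_eq_mul, ← hn]
      have e5 : ∑ p ∈ S.norms, ∑ q ∈ S.norms, (if p = q then (M : ℝ) ^ 2 * (1 / p) + M else 0) =
          (M : ℝ) ^ 2 * W + n * M := by
        have : ∀ p ∈ S.norms, ∑ q ∈ S.norms, (if p = q then (M : ℝ) ^ 2 * (1 / p) + M else 0) =
            (M : ℝ) ^ 2 * (1 / p) + M := fun p hp => by rw [Finset.sum_ite_eq, if_pos hp]
        rw [Finset.sum_congr rfl this, Finset.sum_add_distrib, ← Finset.mul_sum, Finset.sum_const,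
          nsmul_eq_mul, hWdef, weight, hn]
      rw [e5, add_le_add_iff_left]
      rcases eq_or_ne n 0 with h | h
      · rw [h]; simp; positivity
      · exact le_of_eq (by field_simp)
    have h5 : n * M ≤ W * (M : ℝ) ^ 2 := by
      have h6 : n ≤ M := by
        have : n ≤ 3 * n ^ 2 := by
          rcases Nat.eq_zero_or_pos S.norms.card with h | h
          · rw [hn, h]; simp
          · have : (1 : ℝ) ≤ n := by rw [hn]; exact_mod_cast h
            nlinarith
        linarith
      nlinarith [mul_le_mul_of_nonneg_right h6 (by linarith : (0 : ℝ) ≤ M)]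
    linarith
  have hBle : ‖B‖ ^ 2 ≤ 27 * (M : ℝ) ^ 4 * W := by
    have h1 : ‖B‖ ≤ ∑ z ∈ symmBox M, 1 * ‖H z‖ := by
      rw [hBeq]
      exact (norm_sum_le _ _).trans (Finset.sum_le_sum fun z _ => hGH z)
    have h2 := Finset.sum_mul_sq_le_sq_mul_sq (symmBox M) (fun _ => (1 : ℝ)) (fun z => ‖H z‖)
    simp only [one_pow, Finset.sum_const, nsmul_eq_mul, mul_one] at h2
    calc ‖B‖ ^ 2 ≤ (∑ z ∈ symmBox M, 1 * ‖H z‖) ^ 2 := by gcongr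
      _ ≤ _ := h2
      _ ≤ 9 * (M : ℝ) ^ 2 * (3 * W * (M : ℝ) ^ 2) := by gcongr
      _ = _ := by ring
  have hfin : W * ‖∑ z ∈ box M, G z‖ ≤ ‖A‖ + ‖B‖ := by
    have h1 : ‖(W : ℂ) * ∑ z ∈ box M, G z‖ = W * ‖∑ z ∈ box M, G z‖ := by
      rw [norm_mul, Complex.norm_real, Real.norm_of_nonneg (by linarith)]
    rw [← h1, hAB]
    exact norm_add_le _ _
  have h7 : (W * ‖∑ z ∈ box M, G z‖) ^ 2 ≤ (‖A‖ + ‖B‖) ^ 2 := by gcongr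
  -- (‖A‖ + ‖B‖)² ≤ 2(‖A‖² + ‖B‖²) ≤ 2(2 + 27)M⁴W, whence 58.
  have h8 : W * (W * ‖∑ z ∈ box M, G z‖ ^ 2) ≤ W * (58 * (M : ℝ) ^ 4) := by
    nlinarith [sq_nonneg (‖A‖ - ‖B‖)]
  exact le_of_mul_le_mul_left h8 (by linarith)

end GaussianPrimeFamily

/-! ### Multiplicative functions against quadratic phases -/

lemma exists_pos_le_of_finset {α : Type*} (s : Finset α) (f : α → ℝ) (hf : ∀ a, 0 < f a) :
    ∃ σ : ℝ, 0 < σ ∧ ∀ a ∈ s, σ ≤ f a := by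
  classical
  induction s using Finset.induction_on with
  | empty => exact ⟨1, one_pos, by simp⟩
  | insert a s _ ih =>
    obtain ⟨σ, hσ, h⟩ := ih
    refine ⟨min σ (f a), lt_min hσ (hf a), fun b hb => ?_⟩
    rcases Finset.mem_insert.1 hb with rfl | hb
    · exact min_le_right _ _
    · exact (min_le_left _ _).trans (h b hb)

lemma PhaseEquidistributed.mono {M : ℕ} {σ τ : ℝ} {f : ℤ → ℤ → UnitAddCircle}
    (h : PhaseEquidistributed M σ f) (hστ : σ ≤ τ) : PhaseEquidistributed M τ f :=
  fun P₁ P₂ h₁ h₂ => (h P₁ P₂ h₁ h₂).trans (by gcongr)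

lemma ite_mul_conj_ite (p q : Prop) [Decidable p] [Decidable q] (a b : ℂ) :
    (if p then a else 0) * (starRingEnd ℂ) (if q then b else 0) =
      if p ∧ q then a * (starRingEnd ℂ) b else 0 := by
  by_cases hp : p <;> by_cases hq : q <;> simp [hp, hq]

open GaussianPrimeFamily in
/-- Equidistributed quadratic phases do not correlate with multiplicative functions. -/
lemma norm_sum_multiplicative_mul_phase_le {δ : ℝ} (hδ : 0 < δ) :
    ∃ σ : ℝ, 0 < σ ∧ ∃ K : ℕ, ∀ M : ℕ, K ≤ M → ∀ c e₁ e₂ A B E : UnitAddCircle,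
      PhaseEquidistributed M σ (quadPhase c e₁ e₂ A B E) →
      ∀ u v : ℤ, |u| ≤ M → |v| ≤ M → ∀ χ : GaussianInt → ℂ, IsUnimodularMultiplicative χ →
      ∀ P₁ P₂ : Finset ℤ, IsProgressionIn M P₁ → IsProgressionIn M P₂ →
      ‖∑ z ∈ box M, χ ⟨z.1, z.2⟩ * (if z.1 ∈ P₁ ∧ z.2 ∈ P₂ then
        circleChar (quadPhase c e₁ e₂ A B E (u + z.1) (v + z.2)) else 0)‖ ≤ δ * (M : ℝ) ^ 2 := by
  -- Kátai's criterion bounds the square of the sum by 58M⁴/W, so W ≥ 58/δ² suffices.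
  obtain ⟨S, hS⟩ := exists_weight_ge (max 1 (58 / δ ^ 2))
  have hW1 : 1 ≤ S.weight := (le_max_left _ _).trans hS
  have hWδ : 58 / δ ^ 2 ≤ S.weight := (le_max_right _ _).trans hS
  -- The family is now fixed, so finitely many pairs occur and the least σ works for all. The
  -- conditions on the pair stand after the existential quantifiers so that σ and K become total
  -- functions of it.
  have hpair : ∀ pq : ℕ × ℕ, ∃ σ : ℝ, 0 < σ ∧ ∃ K : ℕ,
      pq.1 ∈ S.norms → pq.2 ∈ S.norms → pq.1 ≠ pq.2 →
      ∀ M : ℕ, K ≤ M → ∀ c e₁ e₂ A B E : UnitAddCircle,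
      PhaseEquidistributed M σ (quadPhase c e₁ e₂ A B E) →
      ∀ u v : ℤ, |u| ≤ M → |v| ≤ M →
      ∀ P₁ P₂ : Finset ℤ, IsProgressionIn M P₁ → IsProgressionIn M P₂ →
      ‖∑ p ∈ dilatePairSet M P₁ P₂ (S.re pq.1) (S.im pq.1) (S.re pq.2) (S.im pq.2), circleChar
        (quadPhase c e₁ e₂ A B E (u + (S.re pq.1 * p.1 - S.im pq.1 * p.2))
          (v + (S.im pq.1 * p.1 + S.re pq.1 * p.2)) -
        quadPhase c e₁ e₂ A B E (u + (S.re pq.2 * p.1 - S.im pq.2 * p.2))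
          (v + (S.im pq.2 * p.1 + S.re pq.2 * p.2)))‖ ≤
        S.weight / (S.norms.card : ℝ) ^ 2 * (M : ℝ) ^ 2 := by
    rintro ⟨p, q⟩
    by_cases h : p ∈ S.norms ∧ q ∈ S.norms ∧ p ≠ q
    · obtain ⟨hp, hq, hpq⟩ := h
      have hcard : 0 < S.norms.card := Finset.card_pos.2 ⟨p, hp⟩
      obtain ⟨σ, hσ, K, hK⟩ := norm_sum_dilatePairSet_le (S.re p) (S.im p) (S.re q) (S.im q)
        (by rw [S.norm_eq p hp, S.norm_eq q hq]; exact_mod_cast hpq)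
        (by rw [S.norm_eq p hp]; exact_mod_cast (S.prime p hp).ne_zero)
        (show 0 < S.weight / (S.norms.card : ℝ) ^ 2 by positivity)
      exact ⟨σ, hσ, K, fun _ _ _ => hK⟩
    · exact ⟨1, one_pos, 0, fun h1 h2 h3 => absurd ⟨h1, h2, h3⟩ h⟩
  choose σ hσ K hK using hpair
  obtain ⟨σ₀, hσ₀, hσle⟩ := exists_pos_le_of_finset (S.norms ×ˢ S.norms) σ hσ
  refine ⟨σ₀, hσ₀, ∑ pq ∈ S.norms ×ˢ S.norms, K pq + 3 * S.norms.card ^ 2 + 1, ?_⟩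
  intro M hM c e₁ e₂ A B E heq u v hu hv χ hχ P₁ P₂ hP₁ hP₂
  set F : ℤ × ℤ → ℂ := fun z => if z.1 ∈ P₁ ∧ z.2 ∈ P₂ then
        circleChar (quadPhase c e₁ e₂ A B E (u + z.1) (v + z.2)) else 0 with hF
  have hmain := S.weight_mul_norm_sum_sq_le (M := M) hW1 (by omega) (by omega) hχ (F := F)
    (by
      intro z
      simp only [hF]
      split_ifs
      · exact (norm_circleChar _).le
      · simp)
    (by
      intro z hz
      simp only [hF]
      refine if_neg fun h => hz ?_
      exact Finset.mem_product.2 ⟨hP₁.2 h.1, hP₂.2 h.2⟩)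
    (by
      intro p hp q hq hpq
      have hmem : (p, q) ∈ S.norms ×ˢ S.norms := Finset.mem_product.2 ⟨hp, hq⟩
      have hKle : K (p, q) ≤ M := by
        have := Finset.single_le_sum (f := K) (fun _ _ => Nat.zero_le _) hmem
        omega
      have h := hK (p, q) hp hq hpq M hKle c e₁ e₂ A B E (heq.mono (hσle _ hmem)) u v hu hv
        P₁ P₂ hP₁ hP₂
      have hcard : 0 < S.norms.card := Finset.card_pos.2 ⟨p, hp⟩
      have hsum : ∑ z ∈ symmBox M, F (S.dilate p z) * (starRingEnd ℂ) (F (S.dilate q z)) =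
          ∑ z ∈ dilatePairSet M P₁ P₂ (S.re p) (S.im p) (S.re q) (S.im q), circleChar
          (quadPhase c e₁ e₂ A B E (u + (S.re p * z.1 - S.im p * z.2))
            (v + (S.im p * z.1 + S.re p * z.2)) -
          quadPhase c e₁ e₂ A B E (u + (S.re q * z.1 - S.im q * z.2))
            (v + (S.im q * z.1 + S.re q * z.2))) := by
        rw [dilatePairSet, Finset.sum_filter, symmBox]
        refine Finset.sum_congr rfl fun z _ => ?_
        simp only [hF, dilate, circleChar_sub]
        exact ite_mul_conj_ite _ _ _ _
      rw [hsum]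
      calc _ ≤ S.weight / (S.norms.card : ℝ) ^ 2 * (M : ℝ) ^ 2 * (S.norms.card : ℝ) ^ 2 := by
            gcongr
        _ = _ := by field_simp)
  rw [div_le_iff₀ (by positivity)] at hWδ
  have h1 : S.weight * ‖∑ z ∈ box M, χ ⟨z.1, z.2⟩ * F z‖ ^ 2 ≤
      S.weight * (δ * (M : ℝ) ^ 2) ^ 2 := by
    refine hmain.trans ?_
    calc 58 * (M : ℝ) ^ 4 ≤ S.weight * δ ^ 2 * (M : ℝ) ^ 4 := by gcongr
      _ = _ := by ring
  have h2 := le_of_mul_le_mul_left h1 (by linarith)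
  exact (pow_le_pow_iff_left₀ (norm_nonneg _) (by positivity) two_ne_zero).1 h2

/-! ### Test functions and characters of the torus -/

section Torus

variable {s : ℕ}

lemma torusDist_nonneg (x y : UnitAddTorus (Fin s)) : 0 ≤ torusDist x y := Real.sqrt_nonneg _

lemma norm_sub_le_torusDist (x y : UnitAddTorus (Fin s)) (i : Fin s) :
    ‖x i - y i‖ ≤ torusDist x y := by
  refine Real.le_sqrt_of_sq_le ?_
  exact Finset.single_le_sum (f := fun i => ‖x i - y i‖ ^ 2) (fun _ _ => sq_nonneg _)
    (Finset.mem_univ i)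

lemma torusDist_pos {x y : UnitAddTorus (Fin s)} (h : x ≠ y) : 0 < torusDist x y := by
  obtain ⟨i, hi⟩ := Function.ne_iff.1 h
  exact (norm_pos_iff.2 (sub_ne_zero.2 hi)).trans_le (norm_sub_le_torusDist x y i)

/-- Compactness arguments use the maximum metric of the product; the crude factor s in place of √s
is enough for them. -/
lemma torusDist_le (x y : UnitAddTorus (Fin s)) : torusDist x y ≤ (s : ℝ) * dist x y := by
  rw [torusDist]
  refine Real.sqrt_le_iff.2 ⟨by positivity, ?_⟩
  have h : ∑ i, ‖x i - y i‖ ^ 2 ≤ ∑ _i : Fin s, dist x y ^ 2 := by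
    refine Finset.sum_le_sum fun i _ => ?_
    gcongr
    rw [← dist_eq_norm]
    exact dist_le_pi_dist x y i
  refine h.trans ?_
  rw [Finset.sum_const, Finset.card_univ, Fintype.card_fin, nsmul_eq_mul, mul_pow]
  gcongr
  rcases Nat.eq_zero_or_pos s with h | h
  · simp [h]
  · exact_mod_cast Nat.le_self_pow two_ne_zero s

lemma IsTestFunction.norm_le_one {F : UnitAddTorus (Fin s) → ℂ} (hF : IsTestFunction F)
    (x : UnitAddTorus (Fin s)) : ‖F x‖ ≤ 1 := by
  have h : ENNReal.ofReal ‖F x‖ ≤ 1 :=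
    (le_iSup (fun x => ENNReal.ofReal ‖F x‖) x).trans (le_self_add.trans hF.1)
  rwa [ENNReal.ofReal_le_one] at h

lemma IsTestFunction.norm_sub_le {F : UnitAddTorus (Fin s) → ℂ} (hF : IsTestFunction F)
    (x y : UnitAddTorus (Fin s)) : ‖F x - F y‖ ≤ torusDist x y := by
  rcases eq_or_ne x y with rfl | hxy
  · simpa using torusDist_nonneg x x
  have h : ENNReal.ofReal (‖F x - F y‖ / torusDist x y) ≤ 1 := by
    refine le_trans ?_ (le_add_self.trans hF.1)
    exact le_iSup_of_le x (le_iSup_of_le y (le_iSup_of_le hxy le_rfl))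
  rw [ENNReal.ofReal_le_one, div_le_one (torusDist_pos hxy)] at h
  exact h

/-- The Lipschitz norm is a sum of two suprema, and the allowance of 1 is divided equally between
them. -/
lemma isTestFunction_of_bounds {F : UnitAddTorus (Fin s) → ℂ} (h₁ : ∀ x, ‖F x‖ ≤ 1 / 2)
    (h₂ : ∀ x y, ‖F x - F y‖ ≤ 1 / 2 * torusDist x y) (h₃ : ∫ x, F x = 0) :
    IsTestFunction F := by
  refine ⟨?_, h₃⟩
  have e : (1 : ℝ≥0∞) = ENNReal.ofReal (1 / 2) + ENNReal.ofReal (1 / 2) := by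
    rw [← ENNReal.ofReal_add (by norm_num) (by norm_num)]; norm_num
  rw [torusLipNorm, e]
  refine add_le_add (iSup_le fun x => ENNReal.ofReal_le_ofReal (h₁ x))
    (iSup_le fun x => iSup_le fun y => iSup_le fun hxy => ENNReal.ofReal_le_ofReal ?_)
  rw [div_le_iff₀ (torusDist_pos hxy)]
  exact h₂ x y

lemma isTestFunction_zero : IsTestFunction (fun _ : UnitAddTorus (Fin s) => (0 : ℂ)) :=
  isTestFunction_of_bounds (by simp) (fun x y => by simpa using torusDist_nonneg x y) (by simp)

/-- The linear form `x ↦ ∑ kᵢ xᵢ` on the torus. -/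
noncomputable def torusForm (k : Fin s → ℤ) : UnitAddTorus (Fin s) →+ UnitAddCircle where
  toFun x := ∑ i, k i • x i
  map_zero' := by simp
  map_add' x y := by simp [smul_add, Finset.sum_add_distrib]

lemma circleChar_sum {α : Type*} (t : Finset α) (f : α → UnitAddCircle) :
    circleChar (∑ i ∈ t, f i) = ∏ i ∈ t, circleChar (f i) := by
  classical
  induction t using Finset.induction_on with
  | empty => simp [circleChar_zero]
  | insert a t ha ih => rw [Finset.sum_insert ha, Finset.prod_insert ha, circleChar_add, ih]

lemma mFourier_eq_circleChar (k : Fin s → ℤ) (x : UnitAddTorus (Fin s)) :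
    UnitAddTorus.mFourier k x = circleChar (torusForm k x) := by
  change ∏ i, fourier (k i) (x i) = circleChar (∑ i, k i • x i)
  rw [circleChar_sum]
  exact Finset.prod_congr rfl fun i _ => fourier_apply

lemma torusForm_quadraticSequence (k : Fin s → ℤ) (α₀ α₁ α₂ β₁ β₂ β₃ : UnitAddTorus (Fin s))
    (m n : ℤ) : torusForm k (quadraticSequence α₀ α₁ α₂ β₁ β₂ β₃ m n) =
      quadPhase (torusForm k α₀) (torusForm k α₁) (torusForm k α₂) (torusForm k β₁)
        (torusForm k β₂) (torusForm k β₃) m n := by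
  simp only [quadraticSequence, quadPhase, map_add, map_zsmul]

lemma norm_torusForm_sub_le (k : Fin s → ℤ) (x y : UnitAddTorus (Fin s)) :
    ‖torusForm k x - torusForm k y‖ ≤ (∑ i, |(k i : ℝ)|) * torusDist x y := by
  rw [← map_sub, Finset.sum_mul]
  change ‖∑ i, k i • (x - y) i‖ ≤ _
  refine (norm_sum_le _ _).trans (Finset.sum_le_sum fun i _ => ?_)
  refine (norm_zsmul_le' _ _).trans ?_
  gcongr
  exact norm_sub_le_torusDist x y i

/-- A factor with non-zero frequency changes sign under translation by half of its period, so its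
integral vanishes. -/
lemma integral_mFourier {k : Fin s → ℤ} (hk : k ≠ 0) :
    ∫ x : UnitAddTorus (Fin s), UnitAddTorus.mFourier k x = 0 := by
  obtain ⟨i, hi⟩ := Function.ne_iff.1 hk
  have h := integral_fintype_prod_eq_prod (𝕜 := ℂ) (ι := Fin s) (E := fun _ => UnitAddCircle)
    (fun i x => (fourier (k i) : C(UnitAddCircle, ℂ)) x) (μ := fun _ => volume)
  refine h.trans (Finset.prod_eq_zero (Finset.mem_univ i) ?_)
  exact integral_eq_zero_of_add_right_eq_neg (fourier_add_half_inv_index hi one_pos)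

lemma volume_univ_torus : (volume : Measure (UnitAddTorus (Fin s))) Set.univ = 1 := by
  have : (volume : Measure (UnitAddTorus (Fin s))) = Measure.pi fun _ => volume := rfl
  rw [this, Measure.pi_univ]
  simp

/-- A non-trivial character has mean zero and Lipschitz constant at most 7 ∑ |kᵢ|, so only a scaling
is needed. Through it, equidistribution can be tested on characters. -/
lemma exists_isTestFunction_mFourier {k : Fin s → ℤ} (hk : k ≠ 0) :
    ∃ c : ℝ, 0 < c ∧
      IsTestFunction fun x : UnitAddTorus (Fin s) => (c : ℂ) * UnitAddTorus.mFourier k x := by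
  set C := ∑ i, |(k i : ℝ)| with hC
  have hC0 : 0 ≤ C := Finset.sum_nonneg fun _ _ => abs_nonneg _
  refine ⟨1 / (2 * (1 + 7 * C)), by positivity, isTestFunction_of_bounds ?_ ?_ ?_⟩
  · intro x
    rw [norm_mul, mFourier_eq_circleChar, norm_circleChar, mul_one, Complex.norm_real,
      Real.norm_of_nonneg (by positivity)]
    gcongr
    linarith
  · intro x y
    rw [← mul_sub, norm_mul, mFourier_eq_circleChar, mFourier_eq_circleChar, Complex.norm_real,
      Real.norm_of_nonneg (by positivity)]
    have h1 := norm_circleChar_sub_le (torusForm k x) (torusForm k y)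
    have h2 := norm_torusForm_sub_le k x y
    have h3 := torusDist_nonneg x y
    rw [← hC] at h2
    rw [div_mul_eq_mul_div, one_mul, div_le_iff₀ (by positivity)]
    nlinarith [mul_nonneg hC0 h3]
  · rw [integral_const_mul, integral_mFourier hk, mul_zero]

/-- All test functions are uniformly approximated by finitely many trigonometric polynomials
without constant term. -/
lemma exists_finset_trigPoly_approx (s : ℕ) {δ : ℝ} (hδ : 0 < δ) :
    ∃ T : Finset ((Fin s → ℤ) →₀ ℂ), (∀ P ∈ T, P 0 = 0) ∧
      ∀ Φ : UnitAddTorus (Fin s) → ℂ, IsTestFunction Φ → ∃ P ∈ T, ∀ x,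
        ‖Φ x - P.sum fun k c => c * UnitAddTorus.mFourier k x‖ ≤ δ := by
  classical
  -- Test functions are bounded by 1 and uniformly Lipschitz, hence totally bounded by
  -- Arzelà–Ascoli. A finite net makes the choice of trigonometric polynomials depend on s and δ
  -- only.
  set A : Set (BoundedContinuousFunction (UnitAddTorus (Fin s)) ℂ) :=
    {f | IsTestFunction (f : UnitAddTorus (Fin s) → ℂ)} with hA
  have hlip : ∀ Φ : UnitAddTorus (Fin s) → ℂ, IsTestFunction Φ → LipschitzWith s Φ := by
    intro Φ hΦ
    refine LipschitzWith.of_dist_le_mul fun x y => ?_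
    rw [dist_eq_norm]
    exact (hΦ.norm_sub_le x y).trans (by simpa using torusDist_le x y)
  have hcomp : IsCompact (closure A) := by
    refine BoundedContinuousFunction.arzela_ascoli (Metric.closedBall (0 : ℂ) 1)
      (isCompact_closedBall _ _) A ?_ ?_
    · intro f x hf
      rw [mem_closedBall_zero_iff]
      exact IsTestFunction.norm_le_one hf x
    · exact (LipschitzWith.uniformEquicontinuous _ (s : NNReal)
        (fun f : A => hlip _ f.2)).equicontinuous
  have htb : TotallyBounded A := hcomp.totallyBounded.subset subset_closure
  -- One δ/3 goes to the net, one to the density of trigonometric polynomials, and one to erasing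
  -- the constant term, which is small because f has mean zero.
  obtain ⟨t, htA, htf, htc⟩ := Metric.finite_approx_of_totallyBounded htb (δ / 3) (by positivity)
  have hpoly : ∀ f : BoundedContinuousFunction (UnitAddTorus (Fin s)) ℂ, ∃ P : (Fin s → ℤ) →₀ ℂ,
      P 0 = 0 ∧ (f ∈ A → ∀ x, ‖f x - P.sum fun k c => c * UnitAddTorus.mFourier k x‖ ≤
        2 * (δ / 3)) := by
    intro f
    by_cases hf : f ∈ A
    · have hmem : f.toContinuousMap ∈
          closure (Submodule.span ℂ (Set.range (UnitAddTorus.mFourier (d := Fin s))) :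
            Set C(UnitAddTorus (Fin s), ℂ)) := by
        have h := UnitAddTorus.span_mFourier_closure_eq_top (d := Fin s)
        rw [← Submodule.topologicalClosure_coe, h]
        trivial
      obtain ⟨g, hg, hfg⟩ := Metric.mem_closure_iff.1 hmem (δ / 3) (by positivity)
      obtain ⟨P, rfl⟩ := Finsupp.mem_span_range_iff_exists_finsupp.1 hg
      have heval : ∀ x, (P.sum fun k c => c • UnitAddTorus.mFourier k :
          C(UnitAddTorus (Fin s), ℂ)) x = P.sum fun k c => c * UnitAddTorus.mFourier k x := by
        intro x
        simp [Finsupp.sum, ContinuousMap.sum_apply]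
      have hclose : ∀ x, ‖f x - P.sum fun k c => c * UnitAddTorus.mFourier k x‖ ≤ δ / 3 := by
        intro x
        rw [← heval, ← dist_eq_norm]
        exact (ContinuousMap.dist_apply_le_dist x).trans hfg.le
      have hsplit : ∀ x, (P.sum fun k c => c * UnitAddTorus.mFourier k x) =
          P 0 + (P.erase 0).sum fun k c => c * UnitAddTorus.mFourier k x := by
        intro x
        rw [← Finsupp.add_sum_erase' P 0 (fun k c => c * UnitAddTorus.mFourier k x)
          (fun _ => by simp), UnitAddTorus.mFourier_zero]
        simp
      have hfin : IsFiniteMeasure (volume : Measure (UnitAddTorus (Fin s))) :=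
        ⟨by rw [volume_univ_torus]; exact ENNReal.one_lt_top⟩
      have hint0 : ∫ x, ((P.erase 0).sum fun k c => c * UnitAddTorus.mFourier k x) = 0 := by
        simp only [Finsupp.sum]
        rw [integral_finsetSum]
        · refine Finset.sum_eq_zero fun k hk => ?_
          rw [integral_const_mul, integral_mFourier, mul_zero]
          rintro rfl
          simp at hk
        · intro k _
          exact ((UnitAddTorus.mFourier k).continuous.integrable_of_hasCompactSupport
            (HasCompactSupport.of_compactSpace _)).const_mul _
      have hcont : Continuous fun x => (P.erase 0).sum fun k c => c * UnitAddTorus.mFourier k x := by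
        simp only [Finsupp.sum]
        fun_prop
      have hc0 : ‖P 0‖ ≤ δ / 3 := by
        have hint : ∫ x, (f x - P.sum fun k c => c * UnitAddTorus.mFourier k x) = -P 0 := by
          simp_rw [hsplit]
          have i1 : Integrable (fun x => f x) (volume : Measure (UnitAddTorus (Fin s))) :=
            f.continuous.integrable_of_hasCompactSupport (HasCompactSupport.of_compactSpace _)
          have i2 : Integrable (fun x => (P.erase 0).sum fun k c => c * UnitAddTorus.mFourier k x)
              (volume : Measure (UnitAddTorus (Fin s))) :=
            hcont.integrable_of_hasCompactSupport (HasCompactSupport.of_compactSpace _)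
          have i3 : Integrable (fun x => P 0 +
              (P.erase 0).sum fun k c => c * UnitAddTorus.mFourier k x)
              (volume : Measure (UnitAddTorus (Fin s))) := (integrable_const _).add i2
          rw [integral_sub i1 i3, integral_add (integrable_const _) i2,
            hint0, hf.2, integral_const, Measure.real, volume_univ_torus]
          simp
        have h := norm_integral_le_of_norm_le_const (μ := (volume : Measure (UnitAddTorus (Fin s))))
          (Filter.Eventually.of_forall hclose)
        rw [hint, norm_neg, Measure.real, volume_univ_torus] at h
        simpa using h
      refine ⟨P.erase 0, by simp, fun _ x => ?_⟩
      have h1 := hclose x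
      rw [hsplit] at h1
      have h2 : f x - (P.erase 0).sum (fun k c => c * UnitAddTorus.mFourier k x) =
          (f x - (P 0 + (P.erase 0).sum fun k c => c * UnitAddTorus.mFourier k x)) + P 0 := by ring
      rw [h2]
      exact (norm_add_le _ _).trans (by linarith)
    · exact ⟨0, rfl, fun h => absurd h hf⟩
  choose poly hpoly0 hpolyle using hpoly
  refine ⟨htf.toFinset.image poly, ?_, ?_⟩
  · intro P hP
    obtain ⟨f, -, rfl⟩ := Finset.mem_image.1 hP
    exact hpoly0 f
  · intro Φ hΦ
    set f : BoundedContinuousFunction (UnitAddTorus (Fin s)) ℂ :=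
      BoundedContinuousFunction.mkOfCompact ⟨Φ, (hlip Φ hΦ).continuous⟩ with hf
    have hfA : f ∈ A := hΦ
    obtain ⟨g, hg, hfg⟩ := Set.mem_iUnion₂.1 (htc hfA)
    refine ⟨poly g, Finset.mem_image.2 ⟨g, htf.mem_toFinset.2 hg, rfl⟩, fun x => ?_⟩
    have h1 := hpolyle g (htA hg) x
    have h2 : ‖f x - g x‖ ≤ δ / 3 := by
      rw [← dist_eq_norm]
      exact (BoundedContinuousFunction.dist_coe_le_dist x).trans (Metric.mem_ball.1 hfg).le
    have h3 : Φ x - (poly g).sum (fun k c => c * UnitAddTorus.mFourier k x) =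
        (f x - g x) + (g x - (poly g).sum fun k c => c * UnitAddTorus.mFourier k x) := by
      change f x - _ = _
      ring
    rw [h3]
    exact (norm_add_le _ _).trans (by linarith)

end Torus

/-! ### From phases to test functions -/

lemma IsTotallyEquidistributed.phaseEquidistributed {s M : ℕ} {σ c : ℝ} {k : Fin s → ℤ}
    {α₀ α₁ α₂ β₁ β₂ β₃ : UnitAddTorus (Fin s)}
    (h : IsTotallyEquidistributed M σ (quadraticSequence α₀ α₁ α₂ β₁ β₂ β₃)) (hM : 0 < M)
    (hc : 0 < c)
    (hF : IsTestFunction fun x : UnitAddTorus (Fin s) => (c : ℂ) * UnitAddTorus.mFourier k x) :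
    PhaseEquidistributed M (σ / c) (quadPhase (torusForm k α₀) (torusForm k α₁)
      (torusForm k α₂) (torusForm k β₁) (torusForm k β₂) (torusForm k β₃)) := by
  intro P₁ P₂ h₁ h₂
  have key := h _ hF P₁ P₂ h₁ h₂
  have hM' : (0 : ℝ) < M := by exact_mod_cast hM
  have hcard : ((GaussianPrimeFamily.box M).card : ℝ) = (M : ℝ) ^ 2 :=
    GaussianPrimeFamily.card_box M
  rw [GaussianPrimeFamily.box] at hcard
  rw [Finset.expect_eq_sum_div_card, norm_div, Complex.norm_natCast, hcard,
    div_le_iff₀ (by positivity)] at key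
  have hsum : ∑ p ∈ Finset.Icc (1 : ℤ) M ×ˢ Finset.Icc (1 : ℤ) M,
      (if p.1 ∈ P₁ ∧ p.2 ∈ P₂ then (1 : ℂ) else 0) * ((c : ℂ) * UnitAddTorus.mFourier k
        (quadraticSequence α₀ α₁ α₂ β₁ β₂ β₃ p.1 p.2)) =
      c * ∑ p ∈ P₁ ×ˢ P₂, circleChar (quadPhase (torusForm k α₀) (torusForm k α₁)
        (torusForm k α₂) (torusForm k β₁) (torusForm k β₂) (torusForm k β₃) p.1 p.2) := by
    rw [Finset.mul_sum, ← Finset.sum_subset (Finset.product_subset_product h₁.2 h₂.2)]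
    · refine Finset.sum_congr rfl fun p hp => ?_
      rw [if_pos (Finset.mem_product.1 hp), one_mul, mFourier_eq_circleChar,
        torusForm_quadraticSequence]
    · intro p _ hp
      rw [if_neg (fun h => hp (Finset.mem_product.2 h)), zero_mul]
  rw [hsum, norm_mul, Complex.norm_real, Real.norm_of_nonneg hc.le] at key
  rw [div_mul_eq_mul_div, le_div_iff₀ hc, mul_comm]
  exact key

open GaussianPrimeFamily in
/-- Equidistributed quadratic sequences do not correlate with multiplicative functions on
products of progressions. -/
lemma norm_sum_multiplicative_mul_testFunction_le (s : ℕ) {δ : ℝ} (hδ : 0 < δ) :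
    ∃ σ : ℝ, 0 < σ ∧ ∃ K : ℕ, ∀ M : ℕ, K ≤ M → ∀ α₀ α₁ α₂ β₁ β₂ β₃ : UnitAddTorus (Fin s),
      IsTotallyEquidistributed M σ (quadraticSequence α₀ α₁ α₂ β₁ β₂ β₃) →
      ∀ u v : ℤ, |u| ≤ M → |v| ≤ M → ∀ χ : GaussianInt → ℂ, IsUnimodularMultiplicative χ →
      ∀ Φ : UnitAddTorus (Fin s) → ℂ, IsTestFunction Φ →
      ∀ P₁ P₂ : Finset ℤ, IsProgressionIn M P₁ → IsProgressionIn M P₂ →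
      ‖∑ z ∈ box M, (if z.1 ∈ P₁ ∧ z.2 ∈ P₂ then 1 else 0) * χ ⟨z.1, z.2⟩ *
        Φ (quadraticSequence α₀ α₁ α₂ β₁ β₂ β₃ (u + z.1) (v + z.2))‖ ≤ δ * (M : ℝ) ^ 2 := by
  classical
  obtain ⟨T, hT0, hT⟩ := exists_finset_trigPoly_approx s (half_pos hδ)
  -- C bounds the coefficient sum of every approximant at once, so the level δ/(2(1 + C)) for single
  -- phases keeps the polynomial part below δ/2.
  set C : ℝ := ∑ P ∈ T, ∑ k ∈ P.support, ‖P k‖ with hC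
  have hC0 : 0 ≤ C := Finset.sum_nonneg fun _ _ => Finset.sum_nonneg fun _ _ => norm_nonneg _
  obtain ⟨σ, hσ, K, hK⟩ := norm_sum_multiplicative_mul_phase_le
    (δ := δ / (2 * (1 + C))) (by positivity)
  have hex : ∀ k : Fin s → ℤ, ∃ c : ℝ, 0 < c ∧ (k ≠ 0 →
      IsTestFunction fun x : UnitAddTorus (Fin s) => (c : ℂ) * UnitAddTorus.mFourier k x) := by
    intro k
    by_cases hk : k = 0
    · exact ⟨1, one_pos, fun h => absurd hk h⟩
    · obtain ⟨c, hc, h⟩ := exists_isTestFunction_mFourier hk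
      exact ⟨c, hc, fun _ => h⟩
  choose c hc hcF using hex
  -- Scaling the character of frequency k by c k turns level στ into level στ / c k for its phase.
  -- With τ the least scaling over the frequencies that occur, this is at most σ.
  obtain ⟨τ, hτ, hτc⟩ := exists_pos_le_of_finset (T.biUnion fun P => P.support) c hc
  refine ⟨σ * τ, by positivity, K + 1, ?_⟩
  intro M hM α₀ α₁ α₂ β₁ β₂ β₃ heq u v hu hv χ hχ Φ hΦ P₁ P₂ h₁ h₂
  obtain ⟨P, hPT, hP⟩ := hT Φ hΦ
  set g := quadraticSequence α₀ α₁ α₂ β₁ β₂ β₃ with hg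
  have hχ1 : ∀ z ∈ box M, ‖χ ⟨z.1, z.2⟩‖ = 1 := by
    intro z hz
    refine hχ.norm_eq_one _ fun h => ?_
    have h1 := (Finset.mem_Icc.1 (Finset.mem_product.1 hz).1).1
    have h2 : z.1 = 0 := congrArg Zsqrtd.re h
    omega
  have hterm : ∀ k ∈ P.support, ‖∑ z ∈ box M, (if z.1 ∈ P₁ ∧ z.2 ∈ P₂ then (1 : ℂ) else 0) *
      χ ⟨z.1, z.2⟩ * UnitAddTorus.mFourier k (g (u + z.1) (v + z.2))‖ ≤
        δ / (2 * (1 + C)) * (M : ℝ) ^ 2 := by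
    intro k hk
    have hk0 : k ≠ 0 := by
      rintro rfl
      exact (Finsupp.mem_support_iff.1 hk) (hT0 P hPT)
    have hphase := (heq.phaseEquidistributed (by omega) (hc k) (hcF k hk0)).mono
      (τ := σ) (by
        rw [div_le_iff₀ (hc k)]
        exact mul_le_mul_of_nonneg_left (hτc k (Finset.mem_biUnion.2 ⟨P, hPT, hk⟩)) hσ.le)
    refine le_trans (le_of_eq ?_) (hK M (by omega) _ _ _ _ _ _ hphase u v hu hv χ hχ P₁ P₂ h₁ h₂)
    congr 1
    refine Finset.sum_congr rfl fun z _ => ?_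
    rw [hg, mFourier_eq_circleChar, torusForm_quadraticSequence]
    split_ifs <;> simp
  have hsplit : ∑ z ∈ box M, (if z.1 ∈ P₁ ∧ z.2 ∈ P₂ then (1 : ℂ) else 0) * χ ⟨z.1, z.2⟩ *
        Φ (g (u + z.1) (v + z.2)) =
      ∑ z ∈ box M, (if z.1 ∈ P₁ ∧ z.2 ∈ P₂ then (1 : ℂ) else 0) * χ ⟨z.1, z.2⟩ *
        (Φ (g (u + z.1) (v + z.2)) -
          P.sum fun k a => a * UnitAddTorus.mFourier k (g (u + z.1) (v + z.2))) +
      ∑ k ∈ P.support, P k * ∑ z ∈ box M, (if z.1 ∈ P₁ ∧ z.2 ∈ P₂ then (1 : ℂ) else 0) *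
        χ ⟨z.1, z.2⟩ * UnitAddTorus.mFourier k (g (u + z.1) (v + z.2)) := by
    simp_rw [Finset.mul_sum]
    rw [Finset.sum_comm, ← Finset.sum_add_distrib]
    refine Finset.sum_congr rfl fun z _ => ?_
    rw [mul_sub, Finsupp.sum, Finset.mul_sum, eq_comm]
    convert sub_add_cancel _ _ using 2
    exact Finset.sum_congr rfl fun k _ => by ring
  have hfirst : ‖∑ z ∈ box M, (if z.1 ∈ P₁ ∧ z.2 ∈ P₂ then (1 : ℂ) else 0) * χ ⟨z.1, z.2⟩ *
        (Φ (g (u + z.1) (v + z.2)) -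
          P.sum fun k a => a * UnitAddTorus.mFourier k (g (u + z.1) (v + z.2)))‖ ≤
      δ / 2 * (M : ℝ) ^ 2 := by
    refine (norm_sum_le_of_le (n := fun _ => δ / 2) _ fun z hz => ?_).trans (le_of_eq ?_)
    · rw [norm_mul, norm_mul, hχ1 z hz, mul_one]
      refine (mul_le_of_le_one_left (norm_nonneg _) ?_).trans (hP _)
      split_ifs <;> simp
    · rw [Finset.sum_const, nsmul_eq_mul, card_box, mul_comm]
  have hsecond : ‖∑ k ∈ P.support, P k * ∑ z ∈ box M,
      (if z.1 ∈ P₁ ∧ z.2 ∈ P₂ then (1 : ℂ) else 0) *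
        χ ⟨z.1, z.2⟩ * UnitAddTorus.mFourier k (g (u + z.1) (v + z.2))‖ ≤
      δ / 2 * (M : ℝ) ^ 2 := by
    refine (norm_sum_le_of_le (n := fun k => ‖P k‖ * (δ / (2 * (1 + C)) * (M : ℝ) ^ 2)) _
      fun k hk => ?_).trans ?_
    · rw [norm_mul]
      exact mul_le_mul_of_nonneg_left (hterm k hk) (norm_nonneg _)
    · rw [← Finset.sum_mul, ← mul_assoc]
      refine mul_le_mul_of_nonneg_right ?_ (by positivity)
      have hPC : ∑ k ∈ P.support, ‖P k‖ ≤ C :=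
        Finset.single_le_sum (f := fun P : (Fin s → ℤ) →₀ ℂ => ∑ k ∈ P.support, ‖P k‖)
          (fun _ _ => Finset.sum_nonneg fun _ _ => norm_nonneg _) hPT
      calc (∑ k ∈ P.support, ‖P k‖) * (δ / (2 * (1 + C)))
          ≤ (1 + C) * (δ / (2 * (1 + C))) := by gcongr; linarith
        _ = δ / 2 := by field_simp
  rw [hsplit]
  refine (norm_add_le _ _).trans ?_
  linarith

/-! ### Reduction modulo M and the suprema -/

/-- Cutting at b keeps an initial segment. With `filter_lt`, this separates the α for which a
coordinate of β + α leaves the box. -/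
lemma IsProgressionIn.filter_le {M : ℕ} {P : Finset ℤ} (h : IsProgressionIn M P) (b : ℤ) :
    IsProgressionIn M (P.filter (· ≤ b)) := by
  obtain ⟨⟨a, d, L, hd, rfl⟩, hP⟩ := h
  refine ⟨⟨a, d, min L ((b - a) / d + 1).toNat, hd, ?_⟩, (Finset.filter_subset _ _).trans hP⟩
  have hiff : ∀ k : ℕ, a + d * k ≤ b ↔ k < ((b - a) / d + 1).toNat := by
    intro k
    rw [Int.lt_toNat, Int.lt_add_one_iff, Int.le_ediv_iff_mul_le hd, mul_comm]
    omega
  ext x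
  simp only [Finset.mem_filter, Finset.mem_image, Finset.mem_range, lt_min_iff]
  constructor
  · rintro ⟨⟨k, hk, rfl⟩, hx⟩
    exact ⟨k, ⟨hk, (hiff k).1 hx⟩, rfl⟩
  · rintro ⟨k, ⟨hk, hk'⟩, rfl⟩
    exact ⟨⟨k, hk, rfl⟩, (hiff k).2 hk'⟩

lemma IsProgressionIn.filter_lt {M : ℕ} {P : Finset ℤ} (h : IsProgressionIn M P) (b : ℤ) :
    IsProgressionIn M (P.filter (b < ·)) := by
  obtain ⟨⟨a, d, L, hd, rfl⟩, hP⟩ := h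
  set t := ((b - a) / d + 1).toNat with ht
  refine ⟨⟨a + d * t, d, L - t, hd, ?_⟩, (Finset.filter_subset _ _).trans hP⟩
  have hiff : ∀ k : ℕ, b < a + d * k ↔ t ≤ k := by
    intro k
    rw [← not_iff_not, not_lt, not_le, ht, Int.lt_toNat, Int.lt_add_one_iff,
      Int.le_ediv_iff_mul_le hd, mul_comm]
    omega
  ext x
  simp only [Finset.mem_filter, Finset.mem_image, Finset.mem_range]
  constructor
  · rintro ⟨⟨k, hk, rfl⟩, hx⟩
    have := (hiff k).1 hx
    refine ⟨k - t, by omega, ?_⟩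
    rw [Nat.cast_sub this]
    ring
  · rintro ⟨k, hk, rfl⟩
    have e : a + d * t + d * k = a + d * ((t + k : ℕ) : ℤ) := by push_cast; ring
    rw [e]
    exact ⟨⟨t + k, by omega, rfl⟩, (hiff _).2 (by omega)⟩

lemma norm_expect_gaussianBox (M : ℕ) (f : GaussianInt → ℂ) :
    ‖𝔼 α ∈ gaussianBox M, f α‖ =
      ‖∑ z ∈ GaussianPrimeFamily.box M, f ⟨z.1, z.2⟩‖ / (M : ℝ) ^ 2 := by
  have hinj : Function.Injective fun p : ℤ × ℤ => (⟨p.1, p.2⟩ : GaussianInt) := by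
    intro p q h
    exact Prod.ext (congrArg Zsqrtd.re h) (congrArg Zsqrtd.im h)
  have hcard : ((gaussianBox M).card : ℝ) = (M : ℝ) ^ 2 := by
    rw [gaussianBox, Finset.card_image_of_injective _ hinj]
    exact GaussianPrimeFamily.card_box M
  rw [Finset.expect_eq_sum_div_card, norm_div, Complex.norm_natCast, hcard, gaussianBox,
    Finset.sum_image fun _ _ _ _ h => hinj h]
  rfl

lemma mem_gaussianBox {M : ℕ} {z : GaussianInt} :
    z ∈ gaussianBox M ↔ (1 ≤ z.re ∧ z.re ≤ M) ∧ 1 ≤ z.im ∧ z.im ≤ M := by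
  simp only [gaussianBox, Finset.mem_image, Finset.mem_product, Finset.mem_Icc, Prod.exists]
  constructor
  · rintro ⟨a, b, h, rfl⟩
    exact h
  · intro h
    exact ⟨z.re, z.im, h, rfl⟩

lemma sub_one_emod_add_one_of_le {M x : ℤ} (h₁ : 1 ≤ x) (h₂ : x ≤ M) : (x - 1) % M + 1 = x := by
  rw [Int.emod_eq_of_lt (by omega) (by omega)]
  ring

lemma sub_one_emod_add_one_of_lt {M x : ℤ} (h₁ : M < x) (h₂ : x ≤ 2 * M) :
    (x - 1) % M + 1 = x - M := by
  rw [← Int.sub_emod_right, Int.emod_eq_of_lt (by omega) (by omega)]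
  ring

/-- The margin Δ/2 makes the inequality strict after passing to the supremum. Empty progressions
with the zero test function provide a value, so that the supremum is a genuine least upper bound. -/
lemma exists_isLUB_correlationValues_lt {s M : ℕ} {h : GaussianInt → UnitAddTorus (Fin s)}
    {Δ : ℝ} (hΔ : 0 < Δ) (hM : 0 < M) (hb : ∀ r ∈ correlationValues M h, r ≤ Δ / 2) :
    ∃ S : ℝ, IsLUB (correlationValues M h) S ∧ S < Δ := by
  have hM' : (1 : ℤ) ≤ M := by exact_mod_cast hM
  have hne : (correlationValues M h).Nonempty := by
    have hempty : IsProgressionIn M ∅ := ⟨⟨0, 1, 0, one_pos, by simp⟩, by simp⟩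
    exact ⟨_, ⟨1, 1⟩, mem_gaussianBox.2 ⟨⟨le_rfl, hM'⟩, le_rfl, hM'⟩, fun _ => 1, ⟨by simp, by simp⟩, _, isTestFunction_zero,
      ∅, ∅, hempty, hempty, rfl⟩
  exact ⟨_, Real.isLUB_sSup hne ⟨_, hb⟩, (csSup_le hne hb).trans_lt (half_lt_self hΔ)⟩

lemma le_primeScale {ℓ : ℕ} (hℓ : 1 ≤ ℓ) (N : ℕ) : N < primeScale ℓ N := by
  have h : 100 * ℓ * N < primeScale ℓ N :=
    (Nat.find_spec (p := fun p => 100 * ℓ * N < p ∧ p.Prime) _).1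
  nlinarith

/-- The two suprema are those for the two readings of `g'(β + α)`: with the sum `β + α` reduced
modulo `primeScale ℓ N` into the box on which `g'` lives, and with the polynomial formula
evaluated at the actual sum. -/
theorem proposition7p8 (ℓ : ℕ) (hℓ : 1 ≤ ℓ) (s : ℕ) (Δ : ℝ) (hΔ : 0 < Δ) :
    ∃ σ : ℝ, 0 < σ ∧ ∃ N₀ : ℕ, ∀ N : ℕ, N₀ ≤ N →
      ∀ α₀ α₁ α₂ β₁ β₂ β₃ : UnitAddTorus (Fin s),
        IsTotallyEquidistributed (primeScale ℓ N) σ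
          (quadraticSequence α₀ α₁ α₂ β₁ β₂ β₃) →
        (∃ S : ℝ, IsLUB (correlationValues (primeScale ℓ N) fun z =>
            quadraticSequence α₀ α₁ α₂ β₁ β₂ β₃
              (reduceToBox (primeScale ℓ N) z).re (reduceToBox (primeScale ℓ N) z).im) S ∧
          S < Δ) ∧
        (∃ S : ℝ, IsLUB (correlationValues (primeScale ℓ N) fun z =>
            quadraticSequence α₀ α₁ α₂ β₁ β₂ β₃ z.re z.im) S ∧
          S < Δ) := by
  -- Reduction modulo M will split the sum into four parts, each at most (Δ/8)M², for a total of
  -- (Δ/2)M².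
  obtain ⟨σ, hσ, K, hK⟩ := norm_sum_multiplicative_mul_testFunction_le s
    (δ := Δ / 8) (by positivity)
  refine ⟨σ, hσ, K, fun N hN α₀ α₁ α₂ β₁ β₂ β₃ heq => ?_⟩
  have hNM := le_primeScale hℓ N
  generalize primeScale ℓ N = M at heq hNM ⊢
  have hM : 0 < M := by omega
  have hMr : (0 : ℝ) < (M : ℝ) ^ 2 := by positivity
  have hmain := hK M (by omega) α₀ α₁ α₂ β₁ β₂ β₃ heq
  generalize quadraticSequence α₀ α₁ α₂ β₁ β₂ β₃ = g at hmain ⊢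
  constructor
  · refine exists_isLUB_correlationValues_lt hΔ hM ?_
    rintro r ⟨β, hβ, χ, hχ, Φ, hΦ, P₁, P₂, h₁, h₂, rfl⟩
    obtain ⟨⟨hr1, hr2⟩, hi1, hi2⟩ := mem_gaussianBox.1 hβ
    rw [norm_expect_gaussianBox, div_le_iff₀ hMr]
    have hu : |β.re| ≤ (M : ℤ) := abs_le.2 ⟨by omega, hr2⟩
    have hv : |β.im| ≤ (M : ℤ) := abs_le.2 ⟨by omega, hi2⟩
    -- Where a coordinate of β + α exceeds M, reduction subtracts M once, which amounts to replacing
    -- that coordinate of β by itself minus M. The estimate is uniform over shifts of size at most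
    -- M, so it applies to each of the four subproducts with its own shift.
    have hu' : |β.re - M| ≤ (M : ℤ) := abs_le.2 ⟨by omega, by omega⟩
    have hv' : |β.im - M| ≤ (M : ℤ) := abs_le.2 ⟨by omega, by omega⟩
    have A := hmain _ _ hu hv χ hχ Φ hΦ _ _ (h₁.filter_le (M - β.re)) (h₂.filter_le (M - β.im))
    have B := hmain _ _ hu hv' χ hχ Φ hΦ _ _ (h₁.filter_le (M - β.re)) (h₂.filter_lt (M - β.im))
    have C := hmain _ _ hu' hv χ hχ Φ hΦ _ _ (h₁.filter_lt (M - β.re)) (h₂.filter_le (M - β.im))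
    have D := hmain _ _ hu' hv' χ hχ Φ hΦ _ _ (h₁.filter_lt (M - β.re)) (h₂.filter_lt (M - β.im))
    have hle := (norm_add_le _ _).trans (add_le_add
      ((norm_add_le _ _).trans (add_le_add A B)) ((norm_add_le _ _).trans (add_le_add C D)))
    rw [← Finset.sum_add_distrib, ← Finset.sum_add_distrib, ← Finset.sum_add_distrib] at hle
    refine (le_of_eq ?_).trans (hle.trans (le_of_eq (by ring)))
    congr 1
    refine Finset.sum_congr rfl fun z hz => ?_
    obtain ⟨hz1, hz2⟩ := Finset.mem_product.1 hz
    rw [Finset.mem_Icc] at hz1 hz2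
    simp only [reduceToBox, Zsqrtd.re_add, Zsqrtd.im_add, Finset.mem_filter]
    by_cases hx : z.1 ≤ M - β.re <;> by_cases hy : z.2 ≤ M - β.im
    · rw [sub_one_emod_add_one_of_le (by omega) (by omega),
        sub_one_emod_add_one_of_le (by omega) (by omega)]
      simp [hx, hy, not_lt.2 hx, not_lt.2 hy]
    · rw [sub_one_emod_add_one_of_le (by omega) (by omega),
        sub_one_emod_add_one_of_lt (by omega) (by omega), add_sub_right_comm]
      simp [hx, hy, not_lt.2 hx, not_le.1 hy]
    · rw [sub_one_emod_add_one_of_lt (by omega) (by omega),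
        sub_one_emod_add_one_of_le (by omega) (by omega), add_sub_right_comm]
      simp [hx, hy, not_le.1 hx, not_lt.2 hy]
    · rw [sub_one_emod_add_one_of_lt (by omega) (by omega),
        sub_one_emod_add_one_of_lt (by omega) (by omega), add_sub_right_comm,
        add_sub_right_comm β.im]
      simp [hx, hy, not_le.1 hx, not_le.1 hy]
  · refine exists_isLUB_correlationValues_lt hΔ hM ?_
    rintro r ⟨β, hβ, χ, hχ, Φ, hΦ, P₁, P₂, h₁, h₂, rfl⟩
    obtain ⟨⟨hr1, hr2⟩, hi1, hi2⟩ := mem_gaussianBox.1 hβ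
    rw [norm_expect_gaussianBox, div_le_iff₀ hMr]
    refine (hmain β.re β.im (abs_le.2 ⟨by omega, hr2⟩) (abs_le.2 ⟨by omega, hi2⟩)
      χ hχ Φ hΦ P₁ P₂ h₁ h₂).trans ?_
    gcongr
    norm_num
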